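/- Let $X=(X_1,\dots,X_d)$ be a real random vector all of whose components are discrete-continuous mixtures: the law of $X_j$ is $p_0\rho+\sum_{k\ge1}p_k\delta_{z_k}$ with $p_k\ge 0$, $\sum_{k\ge0}p_k=1$, and $\rho$ an absolutely continuous probability law. For a law $\mu$ on $\mathbb R$ with distribution function $F$, let $\mathcal X=\{x:\mu\{x\}>0\}$, let $F^-(x)=\lim_{\varepsilon\searrow0}F(x-\varepsilon)$, let $\nu_\mu$ be the sum of Lebesgue measure on $\mathbb R\setminus\mathcal X$ and of the Dirac measures at the points of $\mathcal X$, and let $f=d\mu/d\nu_\mu$. Let $\nu_j$ and $f_j$ be this measure and this density for the law of $X_j$, and assume that $X$ has a joint density $f_{1,\dots,d}$ with respect to $\nu=\nu_1\otimes\dots\otimes\nu_d$, i.e. that its law is absolutely continuous with respect to $\nu$. For $D\subseteq\{1,\dots,d\}$ let $F_{j|D}(\cdot\mid x_D)$ be the distribution function of the conditional law of $X_j$ given $X_D=x_D$. A conditional copula of $(X_i,X_j)$ given $X_D$ is a family $C_{i,j;D}(\cdot\,;x_D)$ of bivariate copulas (distribution functions with uniform margins on $[0,1]$), measurable in $x_D$,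 such that for almost every $x_D$ (under the law of $X_D$) and all $y,z\in\mathbb R$ $$P(X_i\le y,X_j\le z\mid X_D=x_D)=C_{i,j;D}\big(F_{i|D}(y\mid x_D),F_{j|D}(z\mid x_D);x_D\big).$$ For a copula $C$ put $C^{(k)}=\partial C/\partial u_k$, and let $c$ be its Lebesgue density (the density of the absolutely continuous part), chosen jointly measurable for families of copulas. For two laws on $\mathbb R$ with distribution functions $F_1,F_2$, densities $f_1,f_2$ and atom sets $\mathcal X_1,\mathcal X_2$ as above, define the generalized copula density $$\mathfrak c(x_1,x_2)=\begin{cases}\dfrac{C(F_1(x_1),F_2(x_2))-C(F_1(x_1),F_2^-(x_2))-C(F_1^-(x_1),F_2(x_2))+C(F_1^-(x_1),F_2^-(x_2))}{f_1(x_1)f_2(x_2)},&x_1\in\mathcal X_1,\ x_2\in\mathcal X_2,\\[1ex]\dfrac{C^{(2)}(F_1(x_1),F_2(x_2))-C^{(2)}(F_1^-(x_1),F_2(x_2))}{f_1(x_1)},&x_1\in\mathcal X_1,\ x_2\notin\mathcal X_2,\\[1ex]\dfrac{C^{(1)}(F_1(x_1),F_2(x_2))-C^{(1)}(F_1(x_1),F_2^-(x_2))}{f_2(x_2)},&x_1\notin\mathcal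 X_1,\ x_2\in\mathcal X_2,\\[1ex]c(F_1(x_1),F_2(x_2)),&x_1\notin\mathcal X_1,\ x_2\notin\mathcal X_2,\end{cases}$$ and the generalized h-function $$\mathfrak h_{1|2}(x_1,x_2)=\begin{cases}\dfrac{C(F_1(x_1),F_2(x_2))-C(F_1(x_1),F_2^-(x_2))}{f_2(x_2)},&x_2\in\mathcal X_2,\\[1ex]C^{(2)}(F_1(x_1),F_2(x_2)),&x_2\notin\mathcal X_2;\end{cases}$$ $\mathfrak h_{2|1}(x_1,x_2)$ is defined in the same way with the roles of the two coordinates exchanged. A regular vine on $\{1,\dots,d\}$ is a sequence of trees $T_1,\dots,T_{d-1}$ such that $T_1$ has node set $\{1,\dots,d\}$, the node set of $T_{t+1}$ is the edge set $E_t$ of $T_t$, and two edges of $T_t$ that are joined in $T_{t+1}$ share a node of $T_t$. The complete union $U$ of a variable $i$ is $\{i\}$, and that of an edge $e=\{p,q\}$ is $U_p\cup U_q$; its conditioning set is $D_e=U_p\cap U_q$, and its conditioned set $U_e\setminus D_e$ is written $\{a_e,b_e\}$ (in either order). Then the following hold. (i) For every regular vine, every labelling $a_e,b_e$ of the conditioned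 sets and every choice of conditional copulas $C_{a_e,b_e;D_e}$ for its edges, for $\nu$-almost every $x$, $$f_{1,\dots,d}(x)=\prod_{k=1}^d f_k(x_k)\ \prod_{t=1}^{d-1}\ \prod_{e\in E_t}\mathfrak c_{a_e,b_e;D_e}(x_{a_e},x_{b_e};x_{D_e}),$$ where $\mathfrak c_{a_e,b_e;D_e}(\cdot,\cdot\,;x_{D_e})$ is the generalized copula density $\mathfrak c$ for the copula $C_{a_e,b_e;D_e}(\cdot\,;x_{D_e})$ and the conditional laws of $X_{a_e}$ and $X_{b_e}$ given $X_{D_e}=x_{D_e}$. (ii) Let $r\in D\subseteq\{1,\dots,d\}$ and $j\notin D$, and let $C_{j,r;D\setminus r}$ be any conditional copula of $(X_j,X_r)$ given $X_{D\setminus r}$. For almost every $x_D$ under the law of $X_D$, and all $x_j\in\mathbb R$, $$F_{j|D}(x_j\mid x_D)=\mathfrak h_{j|r;D}(x_j,x_r;x_{D\setminus r}),$$ where $\mathfrak h_{j|r;D}(\cdot,\cdot\,;x_{D\setminus r})$ is $\mathfrak h_{1|2}$ for the copula $C_{j,r;D\setminus r}(\cdot\,;x_{D\setminus r})$ and the conditional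 laws of $X_j$ and $X_r$ given $X_{D\setminus r}=x_{D\setminus r}$. If instead a conditional copula $C_{r,j;D\setminus r}$ of $(X_r,X_j)$ is given, the same holds with $\mathfrak h_{2|1}(x_r,x_j)$ for $C_{r,j;D\setminus r}(\cdot\,;x_{D\setminus r})$. On a regular vine this is a recursion along the trees: for every edge $e\in E_{t+1}$ and every $j\in\{a_e,b_e\}$ there are $r\in D_e$ and an edge $p\in E_t$ that is an endpoint of $e$ in $T_{t+1}$ such that $\{a_p,b_p\}=\{j,r\}$ and $D_p=D_e\setminus\{r\}$. -/

import Mathlib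

open MeasureTheory ProbabilityTheory Set

noncomputable section

/-! ### Discrete-continuous mixtures, reference measures and densities -/

/-- `μ` is the law of `Y^(K)`, where `Y^(0)` is absolutely continuous with law `ρ`, the
`Y^(k)`, `k ≥ 1`, are constants `z k`, and `K` is integer valued with `P (K = k) = p k`. -/
def IsDiscreteContinuousMixture (μ : Measure ℝ) : Prop :=
  ∃ (p : ℕ → ENNReal) (z : ℕ → ℝ) (ρ : Measure ℝ),
    IsProbabilityMeasure ρ ∧ ρ ≪ volume ∧ ∑' k, p k = 1 ∧
      μ = p 0 • ρ + Measure.sum (fun k : ℕ => p (k + 1) • Measure.dirac (z (k + 1)))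

/-- The set of atoms of a law on the line. -/
def discreteSupport (μ : Measure ℝ) : Set ℝ := {x | 0 < μ {x}}

/-- Lebesgue measure off the atoms of `μ` plus the sum of the Dirac measures at the atoms. -/
def refMeasure (μ : Measure ℝ) : Measure ℝ :=
  volume.restrict (discreteSupport μ)ᶜ +
    Measure.sum (fun z : discreteSupport μ => Measure.dirac (z : ℝ))

/-- The density of a law on the line with respect to its Dirac-plus-Lebesgue measure. -/
def mixDensity (μ : Measure ℝ) (x : ℝ) : ℝ := (μ.rnDeriv (refMeasure μ) x).toReal

/-- The left limit of the distribution function of `μ`. -/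
def cdfLeft (μ : Measure ℝ) (x : ℝ) : ℝ := Function.leftLim (cdf μ) x

section RandomVector

variable {Ω : Type*} [MeasurableSpace Ω] {d : ℕ}

/-- The product of the Dirac-plus-Lebesgue measures of the components of `X`. -/
def jointRefMeasure (P : Measure Ω) (X : Fin d → Ω → ℝ) : Measure (Fin d → ℝ) :=
  Measure.pi (fun i => refMeasure (P.map (X i)))

/-- The joint density of `X` with respect to the product of Dirac-plus-Lebesgue measures. -/
def jointDensity (P : Measure Ω) (X : Fin d → Ω → ℝ) (x : Fin d → ℝ) : ℝ :=
  ((P.map (fun ω i => X i ω)).rnDeriv (jointRefMeasure P X) x).toReal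

/-- The random vector `X_D`. -/
def subvector (X : Fin d → Ω → ℝ) (D : Finset (Fin d)) : Ω → D → ℝ :=
  fun ω i => X i ω

/-- The vector `xD` without its coordinate `r`. -/
def dropCoord {D : Finset (Fin d)} (r : Fin d) (xD : D → ℝ) : ↥(D.erase r) → ℝ :=
  fun i => xD ⟨i, Finset.mem_of_mem_erase i.2⟩

/-- The conditional law of `X_j` given `X_D = xD`. -/
def condLaw (P : Measure Ω) [IsFiniteMeasure P] (X : Fin d → Ω → ℝ) (j : Fin d)
    (D : Finset (Fin d)) (xD : D → ℝ) : Measure ℝ :=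
  condDistrib (X j) (subvector X D) P xD

/-- The conditional distribution function of `(X_i, X_j)` given `X_D = xD`. -/
def condJointCDF (P : Measure Ω) [IsFiniteMeasure P] (X : Fin d → Ω → ℝ) (i j : Fin d)
    (D : Finset (Fin d)) (xD : D → ℝ) (y z : ℝ) : ℝ :=
  (condDistrib (fun ω => (X i ω, X j ω)) (subvector X D) P xD).real (Iic y ×ˢ Iic z)

end RandomVector

/-! ### Copulas

A bivariate copula is a distribution function with uniform margins; it is handled through the
probability measure `γ` that it is the distribution function of. -/

/-- Both margins of `γ` are the uniform distribution on `[0, 1]`. -/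
def IsCopulaMeasure (γ : Measure (ℝ × ℝ)) : Prop :=
  γ.map Prod.fst = volume.restrict (Icc (0 : ℝ) 1) ∧
    γ.map Prod.snd = volume.restrict (Icc (0 : ℝ) 1)

/-- The copula `C` as a function. -/
def copulaFun (γ : Measure (ℝ × ℝ)) (u v : ℝ) : ℝ := γ.real (Iic u ×ˢ Iic v)

/-- The partial derivative of `C` in its first argument. -/
def copulaDerivFst (γ : Measure (ℝ × ℝ)) (u v : ℝ) : ℝ := deriv (fun s => copulaFun γ s v) u

/-- The partial derivative of `C` in its second argument. -/
def copulaDerivSnd (γ : Measure (ℝ × ℝ)) (u v : ℝ) : ℝ := deriv (fun s => copulaFun γ u s) v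

/-- The Lebesgue density of the copula `C (· ; a)` on the unit square, in its version that is
jointly measurable in the parameter `a` and the arguments. -/
def copulaDensity {α : Type*} [MeasurableSpace α]
    [MeasurableSpace.CountableOrCountablyGenerated α (ℝ × ℝ)]
    (C : Kernel α (ℝ × ℝ)) (a : α) (u v : ℝ) : ℝ :=
  (Kernel.rnDeriv C
    (Kernel.const α (volume.restrict (Icc (0 : ℝ) 1 ×ˢ Icc (0 : ℝ) 1))) a (u, v)).toReal

/-- `C` is a conditional copula of `(X_i, X_j)` given `X_D`: a measurable family of copulas that
satisfies Sklar's identity for the conditional laws. -/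
structure IsCondCopula {Ω : Type*} [MeasurableSpace Ω] {d : ℕ} (P : Measure Ω)
    [IsFiniteMeasure P] (X : Fin d → Ω → ℝ) (i j : Fin d) (D : Finset (Fin d))
    (C : Kernel (D → ℝ) (ℝ × ℝ)) : Prop where
  uniform_margins : ∀ xD, IsCopulaMeasure (C xD)
  sklar : ∀ᵐ xD ∂(P.map (subvector X D)), ∀ y z : ℝ,
    condJointCDF P X i j D xD y z =
      copulaFun (C xD) (cdf (condLaw P X i D xD) y) (cdf (condLaw P X j D xD) z)

/-! ### Generalized copula densities and h-functions

`γ` is the copula, `c` its density, and `μ₁`, `μ₂` are the two marginal laws, with distribution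
functions `F₁`, `F₂` and densities `f₁`, `f₂`. -/

open Classical in
/-- The generalized copula density. -/
def genCopulaDensity (γ : Measure (ℝ × ℝ)) (c : ℝ → ℝ → ℝ) (μ₁ μ₂ : Measure ℝ)
    (x₁ x₂ : ℝ) : ℝ :=
  if x₁ ∈ discreteSupport μ₁ then
    if x₂ ∈ discreteSupport μ₂ then
      (copulaFun γ (cdf μ₁ x₁) (cdf μ₂ x₂) - copulaFun γ (cdf μ₁ x₁) (cdfLeft μ₂ x₂)
        - copulaFun γ (cdfLeft μ₁ x₁) (cdf μ₂ x₂)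
        + copulaFun γ (cdfLeft μ₁ x₁) (cdfLeft μ₂ x₂)) / (mixDensity μ₁ x₁ * mixDensity μ₂ x₂)
    else
      (copulaDerivSnd γ (cdf μ₁ x₁) (cdf μ₂ x₂)
        - copulaDerivSnd γ (cdfLeft μ₁ x₁) (cdf μ₂ x₂)) / mixDensity μ₁ x₁
  else
    if x₂ ∈ discreteSupport μ₂ then
      (copulaDerivFst γ (cdf μ₁ x₁) (cdf μ₂ x₂)
        - copulaDerivFst γ (cdf μ₁ x₁) (cdfLeft μ₂ x₂)) / mixDensity μ₂ x₂
    else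
      c (cdf μ₁ x₁) (cdf μ₂ x₂)

open Classical in
/-- The generalized h-function `h_{1|2}`. -/
def genH12 (γ : Measure (ℝ × ℝ)) (μ₁ μ₂ : Measure ℝ) (x₁ x₂ : ℝ) : ℝ :=
  if x₂ ∈ discreteSupport μ₂ then
    (copulaFun γ (cdf μ₁ x₁) (cdf μ₂ x₂) - copulaFun γ (cdf μ₁ x₁) (cdfLeft μ₂ x₂))
      / mixDensity μ₂ x₂
  else
    copulaDerivSnd γ (cdf μ₁ x₁) (cdf μ₂ x₂)

open Classical in
/-- The generalized h-function `h_{2|1}`. -/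
def genH21 (γ : Measure (ℝ × ℝ)) (μ₁ μ₂ : Measure ℝ) (x₁ x₂ : ℝ) : ℝ :=
  if x₁ ∈ discreteSupport μ₁ then
    (copulaFun γ (cdf μ₁ x₁) (cdf μ₂ x₂) - copulaFun γ (cdfLeft μ₁ x₁) (cdf μ₂ x₂))
      / mixDensity μ₁ x₁
  else
    copulaDerivFst γ (cdf μ₁ x₁) (cdf μ₂ x₂)

/-! ### Regular vines

Trees are numbered from `0`: the tree `t` here is the tree `T_{t+1}` of the usual notation. -/

/-- Potential nodes of the tree `t`: the variables for `t = 0`, and unordered pairs of potential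
nodes of the preceding tree afterwards. -/
def VineNode (d : ℕ) : ℕ → Type
  | 0 => Fin d
  | t + 1 => Sym2 (VineNode d t)

/-- The node set of the tree `t`: all variables for `t = 0`, the edges of the preceding tree
afterwards. -/
def vineNodes {d : ℕ} (edges : (t : ℕ) → Finset (Sym2 (VineNode d t))) :
    (t : ℕ) → Set (VineNode d t)
  | 0 => Set.univ
  | t + 1 => {e | e ∈ edges t}

/-- The tree `t` as a graph on its node set. -/
def vineGraph {d : ℕ} (edges : (t : ℕ) → Finset (Sym2 (VineNode d t))) (t : ℕ) :
    SimpleGraph (vineNodes edges t) where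
  Adj u v := u ≠ v ∧ s((u : VineNode d t), (v : VineNode d t)) ∈ edges t
  symm := ⟨fun u v h => ⟨h.1.symm, by rw [Sym2.eq_swap]; exact h.2⟩⟩
  loopless := ⟨fun _ h => h.1 rfl⟩

/-- A regular vine on `d` variables; only the trees `t` with `t + 1 < d` are part of it. -/
structure RegularVine (d : ℕ) where
  edges : (t : ℕ) → Finset (Sym2 (VineNode d t))
  edges_between_nodes : ∀ t, t + 1 < d → ∀ e ∈ edges t,
    ¬ e.IsDiag ∧ ∀ v ∈ e, v ∈ vineNodes edges t
  isTree : ∀ t, t + 1 < d → (vineGraph edges t).IsTree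
  /-- Proximity: two edges of a tree that are joined in the next tree share a node. -/
  proximity : ∀ t, t + 2 < d → ∀ p q : Sym2 (VineNode d t),
    (s(p, q) : Sym2 (VineNode d (t + 1))) ∈ edges (t + 1) → ∃ v, v ∈ p ∧ v ∈ q

/-- The set of variables reachable from a node (its complete union). -/
def completeUnion {d : ℕ} : (t : ℕ) → VineNode d t → Finset (Fin d)
  | 0, i => {(show Fin d from i)}
  | t + 1, e => Sym2.lift ⟨fun p q => completeUnion t p ∪ completeUnion t q,
      fun _ _ => Finset.union_comm _ _⟩ (show Sym2 (VineNode d t) from e)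

/-- The conditioning set `D_e` of an edge. -/
def conditioningSet {d : ℕ} (t : ℕ) (e : Sym2 (VineNode d t)) : Finset (Fin d) :=
  Sym2.lift ⟨fun p q => completeUnion t p ∩ completeUnion t q,
    fun _ _ => Finset.inter_comm _ _⟩ e

/-- The conditioned set `{a_e, b_e}` of an edge. -/
def conditionedSet {d : ℕ} (t : ℕ) (e : Sym2 (VineNode d t)) : Finset (Fin d) :=
  completeUnion (t + 1) e \ conditioningSet t e

end

section Univariate
open Filter Topology
open scoped ENNReal

/-! ### Laws on the line -/

/-! Let Q be the law of X and M the product of its margins. A density of Q with respect to ν forces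
Q ≪ M, and dM/dν is the product of the f_k (`absolutelyContinuous_productLaw`,
`productLaw_eq_withDensity`). So (i) says that dQ/dM is the product of the generalized copula
densities.

For an index set U let l(U) be the density of the law of X_U under Q with respect to its law under M
(`marginDensity`). Coordinates are independent under M, so where l(D) ≠ 0 the conditional densities
given X_D are the quotients l(D ∪ ·) / l(D). Comparing the conditional law of (X_a, X_b) with the
product of its margins gives l(D ∪ {a, b}) l(D) = 𝔠 l(D ∪ {a}) l(D ∪ {b})
(`ae_marginDensity_mul_eq`). That the factor is 𝔠 is a bivariate fact (`HasCopula.ae_density_eq`): a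
law with copula γ is the image of γ under the two quantile functions, which turn half-lines into
half-lines. An atom times an atom becomes a rectangle increment of C, an atom times a non-atomic set
an integrated increment of a partial derivative, and off the atoms only the absolutely continuous
part of γ is seen.

On a vine, an edge e = {p, q} thus satisfies l(U_e) l(D_e) = 𝔠_e l(U_p) l(U_q). If p and q are
themselves edges, D_e = U_v for their shared node v, and v is the shared node of exactly deg v − 1
edges of the next tree (`card_filter_joint_add_one`). Multiplying over all edges, everything cancels
except l of the full set and l of the singletons, which is 1 (`RegularVine.eq_prod_edges`).

For (ii), the conditional law of (X_j, X_r) given the remaining variables is disintegrated along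
X_r. At an atom this is a quotient of masses; elsewhere, for fixed y, it is a derivative of C for
almost every value of X_r. The exceptional null set depends on y, so y is first restricted to the
rationals and the atoms of X_j. Every other y is not charged by the conditional law and is reached
by squeezing difference quotients, which are monotone in y (`hasDerivAt_copulaFun_of_rat`,
`ae_cdf_eq_genH12`). That the recursion closes on a vine follows by counting: complete unions of
nodes at level t have t + 1 elements (`RegularVine.card_completeUnion`). -/

lemma countable_discreteSupport (μ : Measure ℝ) [IsFiniteMeasure μ] :
    (discreteSupport μ).Countable :=
  Measure.countable_meas_pos_of_disjoint_iUnion (As := fun x : ℝ => ({x} : Set ℝ))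
    measurableSet_singleton
    (fun _ _ hxy => Set.disjoint_singleton.2 hxy)

lemma measurableSet_discreteSupport (μ : Measure ℝ) [IsFiniteMeasure μ] :
    MeasurableSet (discreteSupport μ) := (countable_discreteSupport μ).measurableSet

lemma notMem_discreteSupport {μ : Measure ℝ} {x : ℝ} :
    x ∉ discreteSupport μ ↔ μ {x} = 0 := by simp [discreteSupport]

/-- There are countably many atoms, so the Dirac part is the image of a σ-finite counting measure
under a measurable embedding. -/
instance sigmaFinite_refMeasure (μ : Measure ℝ) [IsFiniteMeasure μ] :
    SigmaFinite (refMeasure μ) := by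
  have hc := countable_discreteSupport μ
  have : Countable (discreteSupport μ) := hc.to_subtype
  have h : Measure.sum (fun z : discreteSupport μ => Measure.dirac (z : ℝ))
      = (Measure.count : Measure (discreteSupport μ)).map (Subtype.val) := by
    rw [Measure.count, Measure.map_sum (by fun_prop)]
    congr 1
    ext1 z
    rw [Measure.map_dirac' (by fun_prop)]
  have h2 : SigmaFinite (Measure.sum (fun z : discreteSupport μ => Measure.dirac (z : ℝ))) := by
    rw [h]
    exact (MeasurableEmbedding.subtype_coe (measurableSet_discreteSupport μ)).sigmaFinite_map
  unfold refMeasure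
  infer_instance

lemma refMeasure_singleton {μ : Measure ℝ} {x : ℝ} (hx : x ∈ discreteSupport μ) :
    refMeasure μ {x} = 1 := by
  rw [refMeasure, Measure.add_apply, Measure.sum_apply _ (measurableSet_singleton x)]
  have h1 : volume.restrict (discreteSupport μ)ᶜ {x} = 0 :=
    le_antisymm ((Measure.restrict_apply_le _ _).trans (by simp)) bot_le
  rw [h1, zero_add, tsum_eq_single ⟨x, hx⟩]
  · simp
  · intro y hy
    have : (y : ℝ) ≠ x := fun h => hy (Subtype.ext h)
    simp [this]

lemma mixDensity_nonneg (μ : Measure ℝ) (x : ℝ) : 0 ≤ mixDensity μ x := ENNReal.toReal_nonneg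

/-- The reference measure gives an atom mass one, so the singular part cannot charge it and the
density there is the mass itself. -/
lemma mixDensity_of_mem {μ : Measure ℝ} [IsFiniteMeasure μ] {x : ℝ}
    (hx : x ∈ discreteSupport μ) : mixDensity μ x = μ.real {x} := by
  have h := μ.haveLebesgueDecomposition_add (refMeasure μ)
  have hs : μ.singularPart (refMeasure μ) {x} = 0 := by
    obtain ⟨s, hs, h1, h2⟩ := Measure.mutuallySingular_singularPart μ (refMeasure μ)
    by_cases hxs : x ∈ s
    · exact measure_mono_null (by simpa using hxs) h1
    · have h3 := measure_mono_null (μ := refMeasure μ) (s := {x}) (t := sᶜ) (by simpa using hxs) h2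
      rw [refMeasure_singleton hx] at h3
      exact absurd h3 one_ne_zero
  have h3 : μ {x} = μ.rnDeriv (refMeasure μ) x := by
    conv_lhs => rw [h, Measure.add_apply, hs, zero_add,
      withDensity_apply _ (measurableSet_singleton x), lintegral_singleton,
      refMeasure_singleton hx, mul_one]
  rw [mixDensity, ← h3, measureReal_def]

/-! ### Distribution functions and quantile functions -/

section Cdf

variable (μ : Measure ℝ)

lemma cdfLeft_eq_real [IsProbabilityMeasure μ] (x : ℝ) : cdfLeft μ x = μ.real (Iio x) := by
  have h1 : μ (Iio x) = ENNReal.ofReal (cdfLeft μ x) := by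
    conv_lhs => rw [← measure_cdf μ]
    rw [StieltjesFunction.measure_Iio _ (tendsto_cdf_atBot μ), sub_zero, cdfLeft]
  have h2 : 0 ≤ cdfLeft μ x :=
    (cdf_nonneg μ (x - 1)).trans ((monotone_cdf μ).le_leftLim (by linarith))
  rw [measureReal_def, h1, ENNReal.toReal_ofReal h2]

lemma cdf_sub_cdfLeft [IsProbabilityMeasure μ] (x : ℝ) : cdf μ x - cdfLeft μ x = μ.real {x} := by
  rw [cdf_eq_real, cdfLeft_eq_real, ← Iio_union_right,
    measureReal_union (by simp) (measurableSet_singleton x)]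
  ring

variable {μ} in
lemma cdfLeft_eq_cdf [IsProbabilityMeasure μ] {x : ℝ} (hx : x ∉ discreteSupport μ) :
    cdfLeft μ x = cdf μ x := by
  have := cdf_sub_cdfLeft μ x
  rw [measureReal_def, notMem_discreteSupport.1 hx, ENNReal.toReal_zero] at this
  linarith

open Classical in
/-- The quantile function of a law on the line, with value `0` outside `(0, 1)`. -/
noncomputable def quantile (μ : Measure ℝ) (v : ℝ) : ℝ :=
  if v ∈ Ioo (0 : ℝ) 1 then sInf {x | v ≤ cdf μ x} else 0

/-- Right-continuity makes the infimum attained, which yields the Galois connection between quantile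
and distribution function. -/
lemma quantile_le_iff {v z : ℝ} (hv : v ∈ Ioo (0 : ℝ) 1) : quantile μ v ≤ z ↔ v ≤ cdf μ z := by
  rw [quantile, if_pos hv]
  have hne : {x | v ≤ cdf μ x}.Nonempty :=
    (((tendsto_cdf_atTop μ).eventually (eventually_ge_nhds hv.2))).exists
  obtain ⟨b, hb⟩ := ((tendsto_cdf_atBot μ).eventually (eventually_lt_nhds hv.1)).exists
  have hbdd : BddBelow {x | v ≤ cdf μ x} := by
    refine ⟨b, fun x hx => ?_⟩
    by_contra hlt
    exact absurd ((monotone_cdf μ) (not_le.1 hlt).le) (not_le.2 (hb.trans_le hx))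
  constructor
  · intro h
    have hright : ContinuousWithinAt (cdf μ) (Ioi z) z := (cdf μ).right_continuous z |>.mono Ioi_subset_Ici_self
    refine ge_of_tendsto hright ?_
    filter_upwards [self_mem_nhdsWithin] with w hw
    obtain ⟨x, hx, hxw⟩ := exists_lt_of_csInf_lt hne (h.trans_lt hw)
    exact le_trans hx (monotone_cdf μ hxw.le)
  · exact fun h => csInf_le hbdd h

lemma measurable_quantile : Measurable (quantile μ) := by
  refine measurable_of_Iic fun z => ?_
  have : quantile μ ⁻¹' Iic z =
      (Ioo 0 1 ∩ Iic (cdf μ z)) ∪ ((Ioo 0 1)ᶜ ∩ {_v | (0 : ℝ) ≤ z}) := by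
    ext v
    by_cases hv : v ∈ Ioo (0 : ℝ) 1
    · simp [quantile_le_iff μ hv, hv, -mem_Ioo]
    · simp [quantile, hv, -mem_Ioo]
  rw [this]
  exact (measurableSet_Ioo.inter measurableSet_Iic).union
    (measurableSet_Ioo.compl.inter (by simp))

end Cdf

/-- The uniform distribution on `[0, 1]`. -/
noncomputable abbrev unifMeasure : Measure ℝ := volume.restrict (Icc (0 : ℝ) 1)

instance : IsProbabilityMeasure unifMeasure := ⟨by simp⟩

lemma ae_unifMeasure_mem_Ioo : ∀ᵐ v ∂unifMeasure, v ∈ Ioo (0 : ℝ) 1 := by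
  rw [unifMeasure, ← restrict_Ioo_eq_restrict_Icc]
  exact ae_restrict_mem measurableSet_Ioo

lemma unifMeasure_Iic {u : ℝ} (hu : u ∈ Icc (0 : ℝ) 1) :
    unifMeasure (Iic u) = ENNReal.ofReal u := by
  rw [Measure.restrict_apply measurableSet_Iic]
  have : Iic u ∩ Icc 0 1 = Icc 0 u := by
    ext x; simp only [mem_inter_iff, mem_Iic, mem_Icc]
    exact ⟨fun h => ⟨h.2.1, h.1⟩, fun h => ⟨h.2, h.1, h.2.trans hu.2⟩⟩
  rw [this]; simp

section Cdf

variable (μ : Measure ℝ)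

lemma map_quantile [IsProbabilityMeasure μ] : unifMeasure.map (quantile μ) = μ := by
  have : IsProbabilityMeasure (unifMeasure.map (quantile μ)) :=
    Measure.isProbabilityMeasure_map (measurable_quantile μ).aemeasurable
  refine Measure.ext_of_Iic _ _ fun z => ?_
  rw [Measure.map_apply (measurable_quantile μ) measurableSet_Iic, ← ofReal_cdf,
    ← unifMeasure_Iic ⟨cdf_nonneg μ z, cdf_le_one μ z⟩]
  refine measure_congr ?_
  filter_upwards [ae_unifMeasure_mem_Ioo] with v hv
  exact propext (quantile_le_iff μ hv)

/-- Left of the quantile the distribution function stays below v, and without a jump at the quantile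
it cannot exceed v there either. -/
lemma cdf_quantile [IsProbabilityMeasure μ] {v : ℝ} (hv : v ∈ Ioo (0 : ℝ) 1)
    (hq : quantile μ v ∉ discreteSupport μ) : cdf μ (quantile μ v) = v := by
  refine le_antisymm ?_ ((quantile_le_iff μ hv).1 le_rfl)
  rw [← cdfLeft_eq_cdf hq, cdfLeft]
  refine le_of_tendsto ((monotone_cdf μ).tendsto_leftLim _) ?_
  filter_upwards [self_mem_nhdsWithin] with z hz
  by_contra h
  exact absurd ((quantile_le_iff μ hv).2 (not_le.1 h).le) (not_le.2 hz)

lemma quantile_lt_iff_ae (z : ℝ) : ∀ᵐ v ∂unifMeasure, quantile μ v < z ↔ v ≤ cdfLeft μ z := by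
  -- At the single level v = F⁻(z) the equivalence may fail, for instance when F is constant just
  -- left of z.
  have hne : ∀ᵐ v ∂unifMeasure, v ≠ cdfLeft μ z := Measure.ae_ne _ _
  filter_upwards [ae_unifMeasure_mem_Ioo, hne] with v hv hvz
  constructor
  · intro h
    exact ((quantile_le_iff μ hv).1 le_rfl).trans ((monotone_cdf μ).le_leftLim h)
  · intro h
    have hlt : v < cdfLeft μ z := lt_of_le_of_ne h hvz
    have := ((monotone_cdf μ).tendsto_leftLim z).eventually (eventually_gt_nhds hlt)
    obtain ⟨w, hw, hwz⟩ := (this.and self_mem_nhdsWithin).exists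
    exact ((quantile_le_iff μ hv).2 hw.le).trans_lt hwz

/-- Lebesgue-null sets are not charged by the probability integral transform of the
continuous part of a law. -/
lemma ae_cdf_of_ae [IsProbabilityMeasure μ] {p : ℝ → Prop} (hp : ∀ᵐ v ∂unifMeasure, p v) :
    ∀ᵐ z ∂μ, z ∉ discreteSupport μ → p (cdf μ z) := by
  obtain ⟨N, hpN, hN, hN0⟩ := exists_measurable_superset_of_null (ae_iff.1 hp)
  -- Pulled back by the quantile function, the claim concerns F(quantile v) = v, and v avoids the
  -- null set N.
  have key : ∀ᵐ z ∂(unifMeasure.map (quantile μ)), z ∉ discreteSupport μ → cdf μ z ∉ N := by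
    rw [ae_map_iff (measurable_quantile μ).aemeasurable]
    · filter_upwards [ae_unifMeasure_mem_Ioo, measure_eq_zero_iff_ae_notMem.1 hN0] with v hv hvN hq
      rwa [cdf_quantile μ hv hq]
    · have h1 := (measurableSet_discreteSupport μ)
      have h2 : MeasurableSet (cdf μ ⁻¹' N) := (monotone_cdf μ).measurable hN
      convert h1.union h2.compl using 1
      ext z; simp [imp_iff_not_or]
  rw [map_quantile] at key
  filter_upwards [key] with z hz hzd
  by_contra h
  exact hz hzd (hpN h)

end Cdf

/-- The product of the margins is the image of the uniform law on the square under the pair of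
quantile functions, so the one-dimensional argument applies coordinatewise. -/
lemma ae_cdf_prod_of_ae (μ₁ μ₂ : Measure ℝ) [IsProbabilityMeasure μ₁] [IsProbabilityMeasure μ₂]
    {p : ℝ × ℝ → Prop} (hp : ∀ᵐ w ∂(unifMeasure.prod unifMeasure), p w) :
    ∀ᵐ x ∂(μ₁.prod μ₂), x.1 ∉ discreteSupport μ₁ → x.2 ∉ discreteSupport μ₂ →
      p (cdf μ₁ x.1, cdf μ₂ x.2) := by
  obtain ⟨N, hpN, hN, hN0⟩ := exists_measurable_superset_of_null (ae_iff.1 hp)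
  have hm : Measurable (fun x : ℝ × ℝ => (cdf μ₁ x.1, cdf μ₂ x.2)) :=
    ((monotone_cdf μ₁).measurable.comp measurable_fst).prodMk
      ((monotone_cdf μ₂).measurable.comp measurable_snd)
  have hq : Measurable (Prod.map (quantile μ₁) (quantile μ₂)) :=
    (measurable_quantile μ₁).prodMap (measurable_quantile μ₂)
  have key : ∀ᵐ x ∂((unifMeasure.prod unifMeasure).map (Prod.map (quantile μ₁) (quantile μ₂))),
      x.1 ∉ discreteSupport μ₁ → x.2 ∉ discreteSupport μ₂ → (cdf μ₁ x.1, cdf μ₂ x.2) ∉ N := by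
    rw [ae_map_iff hq.aemeasurable]
    · have h1 := (Measure.quasiMeasurePreserving_fst (μ := unifMeasure) (ν := unifMeasure)).ae
        ae_unifMeasure_mem_Ioo
      have h2 := (Measure.quasiMeasurePreserving_snd (μ := unifMeasure) (ν := unifMeasure)).ae
        ae_unifMeasure_mem_Ioo
      filter_upwards [h1, h2, measure_eq_zero_iff_ae_notMem.1 hN0] with v hv1 hv2 hvN hq1 hq2
      simp only [Prod.map_fst, Prod.map_snd] at hq1 hq2 ⊢
      rwa [cdf_quantile _ hv1 hq1, cdf_quantile _ hv2 hq2]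
    · have h1 : MeasurableSet {x : ℝ × ℝ | x.1 ∈ discreteSupport μ₁} :=
        measurable_fst (measurableSet_discreteSupport μ₁)
      have h2 : MeasurableSet {x : ℝ × ℝ | x.2 ∈ discreteSupport μ₂} :=
        measurable_snd (measurableSet_discreteSupport μ₂)
      convert h1.union (h2.union (hm hN).compl) using 1
      ext z; simp [imp_iff_not_or]
  rw [← Measure.map_prod_map _ _ (measurable_quantile μ₁) (measurable_quantile μ₂),
    map_quantile, map_quantile] at key
  filter_upwards [key] with z hz hzd1 hzd2
  by_contra h
  exact hz hzd1 hzd2 (hpN h)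

end Univariate

section Bivariate
open Filter Topology
open scoped ENNReal

/-! ### Copulas and laws with a given copula -/

namespace IsCopulaMeasure

variable {γ : Measure (ℝ × ℝ)}

lemma isProbabilityMeasure (hγ : IsCopulaMeasure γ) : IsProbabilityMeasure γ := by
  constructor
  have h : γ.map Prod.fst univ = 1 := by rw [hγ.1]; simp
  rwa [Measure.map_apply measurable_fst MeasurableSet.univ, preimage_univ] at h

lemma swap (hγ : IsCopulaMeasure γ) : IsCopulaMeasure (γ.map Prod.swap) := by
  constructor
  · rw [Measure.map_map measurable_fst measurable_swap]; exact hγ.2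
  · rw [Measure.map_map measurable_snd measurable_swap]; exact hγ.1

lemma ae_fst (hγ : IsCopulaMeasure γ) {p : ℝ → Prop} (hp : ∀ᵐ u ∂unifMeasure, p u) :
    ∀ᵐ w ∂γ, p w.1 :=
  ae_of_ae_map measurable_fst.aemeasurable (by rw [hγ.1]; exact hp)

lemma ae_snd (hγ : IsCopulaMeasure γ) {p : ℝ → Prop} (hp : ∀ᵐ u ∂unifMeasure, p u) :
    ∀ᵐ w ∂γ, p w.2 :=
  ae_of_ae_map measurable_snd.aemeasurable (by rw [hγ.2]; exact hp)

end IsCopulaMeasure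

lemma copulaFun_map_swap (γ : Measure (ℝ × ℝ)) (u v : ℝ) :
    copulaFun (γ.map Prod.swap) v u = copulaFun γ u v := by
  rw [copulaFun, copulaFun, measureReal_def, measureReal_def,
    Measure.map_apply measurable_swap (measurableSet_Iic.prod measurableSet_Iic),
    preimage_swap_prod]

lemma copulaDerivSnd_map_swap (γ : Measure (ℝ × ℝ)) (u v : ℝ) :
    copulaDerivSnd (γ.map Prod.swap) v u = copulaDerivFst γ u v := by
  simp_rw [copulaDerivSnd, copulaDerivFst, copulaFun_map_swap]

lemma genH12_map_swap (γ : Measure (ℝ × ℝ)) (μ₁ μ₂ : Measure ℝ) (x₁ x₂ : ℝ) :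
    genH12 (γ.map Prod.swap) μ₂ μ₁ x₂ x₁ = genH21 γ μ₁ μ₂ x₁ x₂ := by
  simp_rw [genH12, genH21, copulaFun_map_swap, copulaDerivSnd_map_swap]

/-! ### Partial derivatives of a copula as densities of its slices -/

section Copula

variable {γ : Measure (ℝ × ℝ)}

/-- The measure `V ↦ γ ((-∞, u] × V)`. -/
noncomputable def copulaSlice (γ : Measure (ℝ × ℝ)) (u : ℝ) : Measure ℝ :=
  (γ.restrict (Iic u ×ˢ univ)).map Prod.snd

lemma copulaSlice_apply (u : ℝ) {V : Set ℝ} (hV : MeasurableSet V) :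
    copulaSlice γ u V = γ (Iic u ×ˢ V) := by
  rw [copulaSlice, Measure.map_apply measurable_snd hV,
    Measure.restrict_apply (measurable_snd hV)]
  congr 1; ext w; simp [and_comm]

lemma copulaSlice_real_Iic (u v : ℝ) : (copulaSlice γ u).real (Iic v) = copulaFun γ u v := by
  rw [measureReal_def, copulaSlice_apply u measurableSet_Iic, copulaFun, measureReal_def]

lemma copulaSlice_le (hγ : IsCopulaMeasure γ) (u : ℝ) : copulaSlice γ u ≤ unifMeasure := by
  rw [unifMeasure, ← hγ.2]
  exact Measure.map_mono Measure.restrict_le_self measurable_snd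

lemma isFiniteMeasure_copulaSlice (hγ : IsCopulaMeasure γ) (u : ℝ) :
    IsFiniteMeasure (copulaSlice γ u) :=
  isFiniteMeasure_of_le _ (copulaSlice_le hγ u)

lemma copulaFun_mono_right (hγ : IsCopulaMeasure γ) (u : ℝ) :
    Monotone (fun v => copulaFun γ u v) := fun _ _ h => by
  have := hγ.isProbabilityMeasure
  exact measureReal_mono (prod_mono subset_rfl (Iic_subset_Iic.2 h))

/-- The increments of a copula in its second argument are monotone in the first one. -/
lemma copulaFun_sub_mono (hγ : IsCopulaMeasure γ) {u u' v v' : ℝ} (hu : u ≤ u') (hv : v ≤ v') :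
    copulaFun γ u v' - copulaFun γ u v ≤ copulaFun γ u' v' - copulaFun γ u' v := by
  have := hγ.isProbabilityMeasure
  have h (w : ℝ) : copulaFun γ w v' - copulaFun γ w v = γ.real (Iic w ×ˢ Ioc v v') := by
    rw [copulaFun, copulaFun, ← Iic_union_Ioc_eq_Iic hv, prod_union, measureReal_union]
    · ring
    · exact Disjoint.set_prod_right ((Iic_disjoint_Ioc le_rfl)) _ _
    · exact measurableSet_Iic.prod measurableSet_Ioc
  rw [h, h]
  exact measureReal_mono (prod_mono (Iic_subset_Iic.2 hu) subset_rfl)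

lemma copulaDerivSnd_nonneg (hγ : IsCopulaMeasure γ) (u v : ℝ) : 0 ≤ copulaDerivSnd γ u v :=
  (copulaFun_mono_right hγ u).deriv_nonneg

/-- Lebesgue differentiation, applied to the distribution function as an integral of the density. -/
lemma ae_hasDerivAt_real_Iic (m : Measure ℝ) [IsFiniteMeasure m] (hm : m ≪ volume) :
    ∀ᵐ v, HasDerivAt (fun v => m.real (Iic v)) (m.rnDeriv volume v).toReal v := by
  have hint : Integrable (fun v => (m.rnDeriv volume v).toReal) volume :=
    Measure.integrable_toReal_rnDeriv
  have h (v : ℝ) : m.real (Iic v) =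
      m.real (Iic 0) + ∫ t in (0 : ℝ)..v, (m.rnDeriv volume t).toReal := by
    rw [← intervalIntegral.integral_Iic_sub_Iic hint.integrableOn hint.integrableOn,
      Measure.setIntegral_toReal_rnDeriv hm, Measure.setIntegral_toReal_rnDeriv hm]
    ring
  filter_upwards [LocallyIntegrable.ae_hasDerivAt_integral hint.locallyIntegrable] with v hv
  exact ((hv 0).const_add (m.real (Iic 0))).congr_of_eventuallyEq (.of_forall h)

lemma ae_hasDerivAt_copulaFun (hγ : IsCopulaMeasure γ) (u : ℝ) :
    ∀ᵐ v, HasDerivAt (copulaFun γ u) (copulaDerivSnd γ u v) v := by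
  filter_upwards [(copulaFun_mono_right hγ u).ae_differentiableAt] with v hv
  exact hv.hasDerivAt

/-- The slice is dominated by the uniform law, hence absolutely continuous, and its distribution
function is C(u, ·); its density is therefore the derivative of C(u, ·). -/
lemma copulaSlice_eq_withDensity (hγ : IsCopulaMeasure γ) (u : ℝ) :
    copulaSlice γ u =
      unifMeasure.withDensity (fun v => ENNReal.ofReal (copulaDerivSnd γ u v)) := by
  have := isFiniteMeasure_copulaSlice hγ u
  have hac : copulaSlice γ u ≪ unifMeasure := (copulaSlice_le hγ u).absolutelyContinuous
  have hac' : copulaSlice γ u ≪ volume := hac.trans Measure.restrict_le_self.absolutelyContinuous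
  have h1 : copulaSlice γ u =
      volume.withDensity (fun v => ENNReal.ofReal (copulaDerivSnd γ u v)) := by
    conv_lhs => rw [← Measure.withDensity_rnDeriv_eq _ _ hac']
    refine withDensity_congr_ae ?_
    filter_upwards [ae_hasDerivAt_real_Iic _ hac', (copulaSlice γ u).rnDeriv_lt_top volume]
      with v hv hlt
    simp_rw [copulaSlice_real_Iic] at hv
    rw [copulaDerivSnd, hv.deriv, ENNReal.ofReal_toReal hlt.ne]
  have h2 : (copulaSlice γ u).restrict (Icc 0 1) = copulaSlice γ u := by
    refine Measure.restrict_eq_self_of_ae_mem (hac.ae_le ?_)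
    exact ae_restrict_mem measurableSet_Icc
  rw [← h2, h1, restrict_withDensity measurableSet_Icc]

lemma measurable_copulaDerivSnd (u : ℝ) : Measurable (copulaDerivSnd γ u) := measurable_deriv _

end Copula

/-! ### Laws as quantile images of their copulas -/

section Sklar

variable {γ κ : Measure (ℝ × ℝ)} {μ₁ μ₂ : Measure ℝ}

/-- `κ` has the margins `μ₁` and `μ₂` and the copula `γ`. -/
def HasCopula (κ γ : Measure (ℝ × ℝ)) (μ₁ μ₂ : Measure ℝ) : Prop :=
  γ.map (Prod.map (quantile μ₁) (quantile μ₂)) = κ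

/-- Quadrants form a generating π-system, and by the Galois connection the quantile image of γ has
the prescribed mass on each of them. -/
lemma hasCopula_of_cdf [IsProbabilityMeasure κ] (hγ : IsCopulaMeasure γ)
    (h : ∀ y z, κ.real (Iic y ×ˢ Iic z) = copulaFun γ (cdf μ₁ y) (cdf μ₂ z)) :
    HasCopula κ γ μ₁ μ₂ := by
  have := hγ.isProbabilityMeasure
  have hq : Measurable (Prod.map (quantile μ₁) (quantile μ₂)) :=
    (measurable_quantile μ₁).prodMap (measurable_quantile μ₂)
  have : IsProbabilityMeasure (γ.map (Prod.map (quantile μ₁) (quantile μ₂))) :=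
    Measure.isProbabilityMeasure_map hq.aemeasurable
  have hspan : IsCountablySpanning (range (Iic : ℝ → Set ℝ)) :=
    ⟨fun n : ℕ => Iic (n : ℝ), fun n => mem_range_self _, by
      refine eq_univ_of_forall fun x => ?_
      obtain ⟨n, hn⟩ := exists_nat_ge x
      exact mem_iUnion.2 ⟨n, hn⟩⟩
  have hgen : MeasurableSpace.generateFrom (range (Iic : ℝ → Set ℝ)) = Real.measurableSpace :=
    (borel_eq_generateFrom_Iic ℝ).symm.trans (BorelSpace.measurable_eq (α := ℝ)).symm
  refine ext_of_generate_finite _ (generateFrom_eq_prod hgen hgen hspan hspan).symm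
    (isPiSystem_Iic.prod isPiSystem_Iic) ?_ (by simp)
  rintro _ ⟨_, ⟨y, rfl⟩, _, ⟨z, rfl⟩, rfl⟩
  rw [Measure.map_apply hq (measurableSet_Iic.prod measurableSet_Iic)]
  have h1 : γ (Prod.map (quantile μ₁) (quantile μ₂) ⁻¹' Iic y ×ˢ Iic z) =
      γ (Iic (cdf μ₁ y) ×ˢ Iic (cdf μ₂ z)) := by
    refine measure_congr ?_
    filter_upwards [hγ.ae_fst ae_unifMeasure_mem_Ioo, hγ.ae_snd ae_unifMeasure_mem_Ioo]
      with w h1 h2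
    exact propext (and_congr (quantile_le_iff μ₁ h1) (quantile_le_iff μ₂ h2))
  rw [h1, ← ENNReal.ofReal_toReal (measure_ne_top κ _), ← measureReal_def, h, copulaFun,
    measureReal_def, ENNReal.ofReal_toReal (measure_ne_top γ _)]

lemma HasCopula.swap (h : HasCopula κ γ μ₁ μ₂) :
    HasCopula (κ.map Prod.swap) (γ.map Prod.swap) μ₂ μ₁ := by
  unfold HasCopula at h ⊢
  rw [← h, Measure.map_map ((measurable_quantile μ₂).prodMap (measurable_quantile μ₁))
    measurable_swap, Measure.map_map measurable_swap
    ((measurable_quantile μ₁).prodMap (measurable_quantile μ₂))]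
  rfl

lemma HasCopula.apply_prod (h : HasCopula κ γ μ₁ μ₂) {A B : Set ℝ} (hA : MeasurableSet A)
    (hB : MeasurableSet B) :
    κ (A ×ˢ B) = γ ((quantile μ₁ ⁻¹' A) ×ˢ (quantile μ₂ ⁻¹' B)) := by
  unfold HasCopula at h
  rw [← h, Measure.map_apply ((measurable_quantile μ₁).prodMap (measurable_quantile μ₂))
    (hA.prod hB)]
  rfl

/-- Under the quantile transform of `μ`, the set `A` corresponds to the interval `[0, u]`. -/
def IsQuantileLevel (μ : Measure ℝ) (A : Set ℝ) (u : ℝ) : Prop :=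
  ∀ᵐ s ∂unifMeasure, quantile μ s ∈ A ↔ s ≤ u

lemma isQuantileLevel_Iic (y : ℝ) : IsQuantileLevel μ₁ (Iic y) (cdf μ₁ y) := by
  filter_upwards [ae_unifMeasure_mem_Ioo] with v hv using quantile_le_iff μ₁ hv

lemma isQuantileLevel_Iio (y : ℝ) : IsQuantileLevel μ₁ (Iio y) (cdfLeft μ₁ y) :=
  quantile_lt_iff_ae μ₁ y

lemma HasCopula.real_prod (h : HasCopula κ γ μ₁ μ₂) (hγ : IsCopulaMeasure γ) {A B : Set ℝ}
    {u v : ℝ} (hA : MeasurableSet A) (hB : MeasurableSet B) (hAu : IsQuantileLevel μ₁ A u)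
    (hBv : IsQuantileLevel μ₂ B v) : κ.real (A ×ˢ B) = copulaFun γ u v := by
  rw [measureReal_def, copulaFun, measureReal_def, h.apply_prod hA hB]
  congr 1
  refine measure_congr ?_
  filter_upwards [hγ.ae_fst hAu, hγ.ae_snd hBv] with w h1 h2
  exact propext (and_congr h1 h2)

lemma HasCopula.isProbabilityMeasure (h : HasCopula κ γ μ₁ μ₂) (hγ : IsCopulaMeasure γ) :
    IsProbabilityMeasure κ := by
  have := hγ.isProbabilityMeasure
  rw [← show _ = κ from h]
  exact Measure.isProbabilityMeasure_map
    ((measurable_quantile μ₁).prodMap (measurable_quantile μ₂)).aemeasurable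

lemma HasCopula.real_prod_singleton (h : HasCopula κ γ μ₁ μ₂) (hγ : IsCopulaMeasure γ)
    {A : Set ℝ} {u : ℝ} (hA : MeasurableSet A) (hAu : IsQuantileLevel μ₁ A u) (z : ℝ) :
    κ.real (A ×ˢ {z}) = copulaFun γ u (cdf μ₂ z) - copulaFun γ u (cdfLeft μ₂ z) := by
  have := h.isProbabilityMeasure hγ
  rw [← h.real_prod hγ hA measurableSet_Iic hAu (isQuantileLevel_Iic z),
    ← h.real_prod hγ hA measurableSet_Iio hAu (isQuantileLevel_Iio z), ← Iio_union_right,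
    prod_union, measureReal_union (Disjoint.set_prod_right (by simp) _ _)
      (hA.prod (measurableSet_singleton z))]
  ring

/-- The left side is a slice of γ at the preimage of B. The slice has density C⁽²⁾(u, ·), and off
the atoms F₂ inverts the quantile function, so the integral can be moved to μ₂. -/
lemma HasCopula.apply_prod_eq_lintegral [IsProbabilityMeasure μ₂] (h : HasCopula κ γ μ₁ μ₂) (hγ : IsCopulaMeasure γ)
    {A B : Set ℝ} {u : ℝ} (hA : MeasurableSet A) (hB : MeasurableSet B)
    (hAu : IsQuantileLevel μ₁ A u) (hBd : B ⊆ (discreteSupport μ₂)ᶜ) :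
    κ (A ×ˢ B) = ∫⁻ z in B, ENNReal.ofReal (copulaDerivSnd γ u (cdf μ₂ z)) ∂μ₂ := by
  have hqB : MeasurableSet (quantile μ₂ ⁻¹' B) := measurable_quantile μ₂ hB
  have h1 : κ (A ×ˢ B) = copulaSlice γ u (quantile μ₂ ⁻¹' B) := by
    rw [h.apply_prod hA hB, copulaSlice_apply u hqB]
    refine measure_congr ?_
    filter_upwards [hγ.ae_fst hAu] with w h1
    exact propext (and_congr_left fun _ => h1)
  have hm : Measurable fun z => ENNReal.ofReal (copulaDerivSnd γ u (cdf μ₂ z)) :=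
    ((measurable_copulaDerivSnd u).comp (monotone_cdf μ₂).measurable).ennreal_ofReal
  rw [h1, copulaSlice_eq_withDensity hγ, withDensity_apply _ hqB]
  have h2 := setLIntegral_map (μ := unifMeasure) hB hm (measurable_quantile μ₂)
  rw [map_quantile] at h2
  rw [h2]
  refine setLIntegral_congr_fun_ae hqB ?_
  filter_upwards [ae_unifMeasure_mem_Ioo] with v hv hvB
  rw [cdf_quantile μ₂ hv (hBd hvB)]

end Sklar
end Bivariate

section BivariateDensity
open Filter Topology
open scoped ENNReal

/-! ### The density and the conditional distribution functions of a law with a given copula -/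

lemma ae_prod_of_countable_left (μ₁ μ₂ : Measure ℝ) {S : Set ℝ} (hS : S.Countable) {p : ℝ × ℝ → Prop}
    (h : ∀ x₁ ∈ S, ∀ᵐ z ∂μ₂, p (x₁, z)) : ∀ᵐ x ∂(μ₁.prod μ₂), x.1 ∈ S → p x := by
  have h1 : ∀ᵐ z ∂μ₂, ∀ x₁ ∈ S, p (x₁, z) := (ae_ball_iff hS).2 h
  filter_upwards [Measure.quasiMeasurePreserving_snd.ae h1] with x hx hxS
  exact hx x.1 hxS

lemma ae_prod_of_countable_right (μ₁ μ₂ : Measure ℝ) {S : Set ℝ} (hS : S.Countable) {p : ℝ × ℝ → Prop}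
    (h : ∀ x₂ ∈ S, ∀ᵐ z ∂μ₁, p (z, x₂)) : ∀ᵐ x ∂(μ₁.prod μ₂), x.2 ∈ S → p x := by
  have h1 : ∀ᵐ z ∂μ₁, ∀ x₂ ∈ S, p (z, x₂) := (ae_ball_iff hS).2 h
  filter_upwards [Measure.quasiMeasurePreserving_fst.ae h1] with x hx hxS
  exact hx x.2 hxS

variable {γ κ : Measure (ℝ × ℝ)} {μ₁ μ₂ : Measure ℝ} [IsProbabilityMeasure μ₁]
  [IsProbabilityMeasure μ₂]

/-- Slices of a law along an atom of the first margin. -/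
lemma HasCopula.ae_density_atom_left (h : HasCopula κ γ μ₁ μ₂) (hγ : IsCopulaMeasure γ)
    {g : ℝ × ℝ → ℝ≥0∞} (hg : Measurable g) (hκ : κ = (μ₁.prod μ₂).withDensity g) (x₁ : ℝ) :
    ∀ᵐ z ∂μ₂, z ∉ discreteSupport μ₂ →
      g (x₁, z) * μ₁ {x₁} = ENNReal.ofReal (copulaDerivSnd γ (cdf μ₁ x₁) (cdf μ₂ z)
        - copulaDerivSnd γ (cdfLeft μ₁ x₁) (cdf μ₂ z)) ∧
      copulaDerivSnd γ (cdfLeft μ₁ x₁) (cdf μ₂ z) ≤ copulaDerivSnd γ (cdf μ₁ x₁) (cdf μ₂ z) := by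
  have hd := measurableSet_discreteSupport μ₂
  have hm (u : ℝ) : Measurable fun z => ENNReal.ofReal (copulaDerivSnd γ u (cdf μ₂ z)) :=
    ((measurable_copulaDerivSnd u).comp (monotone_cdf μ₂).measurable).ennreal_ofReal
  have hg1 : Measurable fun z => g (x₁, z) * μ₁ {x₁} := by fun_prop
  -- The slice up to x₁ is the slice strictly below x₁ plus the atom. The additive form avoids
  -- truncated subtraction and also yields the inequality between the two partial derivatives.
  have hmain : (fun z => g (x₁, z) * μ₁ {x₁} +
      ENNReal.ofReal (copulaDerivSnd γ (cdfLeft μ₁ x₁) (cdf μ₂ z)))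
      =ᵐ[μ₂.restrict (discreteSupport μ₂)ᶜ]
      fun z => ENNReal.ofReal (copulaDerivSnd γ (cdf μ₁ x₁) (cdf μ₂ z)) := by
    refine ae_eq_of_forall_setLIntegral_eq_of_sigmaFinite (hg1.add (hm _)) (hm _)
      fun B hB _ => ?_
    rw [Measure.restrict_restrict hB]
    set B' := B ∩ (discreteSupport μ₂)ᶜ with hB'
    have hBm : MeasurableSet B' := hB.inter hd.compl
    rw [lintegral_add_left hg1,
      ← h.apply_prod_eq_lintegral hγ measurableSet_Iic hBm (isQuantileLevel_Iic x₁)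
        inter_subset_right,
      ← h.apply_prod_eq_lintegral hγ measurableSet_Iio hBm (isQuantileLevel_Iio x₁)
        inter_subset_right, ← Iio_union_right, union_prod, measure_union _
        ((measurableSet_singleton x₁).prod hBm), add_comm]
    · congr 1
      rw [hκ, withDensity_apply _ ((measurableSet_singleton x₁).prod hBm),
        ← Measure.prod_restrict, lintegral_prod_symm' _ hg]
      refine lintegral_congr fun z => ?_
      rw [lintegral_singleton]
    · exact Disjoint.set_prod_left (by simp) _ _
  rw [Filter.EventuallyEq, ae_restrict_iff' hd.compl] at hmain
  filter_upwards [hmain] with z hz hzd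
  refine ⟨?_, ?_⟩
  · rw [ENNReal.ofReal_sub _ (copulaDerivSnd_nonneg hγ _ _), ← hz hzd,
      ENNReal.add_sub_cancel_right ENNReal.ofReal_ne_top]
  · rw [← ENNReal.ofReal_le_ofReal_iff (copulaDerivSnd_nonneg hγ _ _), ← hz hzd]
    exact le_add_self

/-- On pairs of non-atoms the two distribution functions invert the quantile transform, so κ there
is a copy of γ. Being absolutely continuous with respect to the product of the margins, κ sees
nothing of the singular part of γ. -/
lemma HasCopula.ae_density_nonatom (h : HasCopula κ γ μ₁ μ₂) (hγ : IsCopulaMeasure γ)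
    {g : ℝ × ℝ → ℝ≥0∞} (hg : Measurable g) (hκ : κ = (μ₁.prod μ₂).withDensity g) :
    ∀ᵐ x ∂(μ₁.prod μ₂), x.1 ∉ discreteSupport μ₁ → x.2 ∉ discreteSupport μ₂ →
      g x = γ.rnDeriv (unifMeasure.prod unifMeasure) (cdf μ₁ x.1, cdf μ₂ x.2) := by
  have := hγ.isProbabilityMeasure
  set ρ := γ.rnDeriv (unifMeasure.prod unifMeasure) with hρ
  have hρm : Measurable ρ := Measure.measurable_rnDeriv _ _
  set G : ℝ × ℝ → ℝ × ℝ := fun x => (cdf μ₁ x.1, cdf μ₂ x.2) with hG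
  have hGm : Measurable G := ((monotone_cdf μ₁).measurable.comp measurable_fst).prodMk
      ((monotone_cdf μ₂).measurable.comp measurable_snd)
  set T : Set (ℝ × ℝ) := (discreteSupport μ₁)ᶜ ×ˢ (discreteSupport μ₂)ᶜ with hT
  have hTm : MeasurableSet T :=
    (measurableSet_discreteSupport μ₁).compl.prod (measurableSet_discreteSupport μ₂).compl
  set Q : ℝ × ℝ → ℝ × ℝ := Prod.map (quantile μ₁) (quantile μ₂) with hQ
  have hQm : Measurable Q := (measurable_quantile μ₁).prodMap (measurable_quantile μ₂)
  have hQmap : (unifMeasure.prod unifMeasure).map Q = μ₁.prod μ₂ := by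
    rw [hQ, ← Measure.map_prod_map _ _ (measurable_quantile μ₁) (measurable_quantile μ₂),
      map_quantile, map_quantile]
  have hGQ {w : ℝ × ℝ} (h1 : w.1 ∈ Ioo (0 : ℝ) 1) (h2 : w.2 ∈ Ioo (0 : ℝ) 1) (hw : Q w ∈ T) :
      G (Q w) = w :=
    Prod.ext (cdf_quantile μ₁ h1 hw.1) (cdf_quantile μ₂ h2 hw.2)
  have hρG : Measurable fun x => ρ (G x) := hρm.comp hGm
  -- N is Lebesgue-null and carries the singular part of γ. Its preimage under the distribution
  -- functions is null on T, so it can be removed from every test set.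
  obtain ⟨N, hN, hN0, hNc⟩ :=
    (Measure.mutuallySingular_singularPart γ (unifMeasure.prod unifMeasure)).symm
  have hGN : ∀ᵐ x ∂(μ₁.prod μ₂), x ∈ T → G x ∉ N := by
    filter_upwards [ae_cdf_prod_of_ae μ₁ μ₂ (measure_eq_zero_iff_ae_notMem.1 hN0)] with x hx hxT
    exact hx hxT.1 hxT.2
  have hmain : g =ᵐ[(μ₁.prod μ₂).restrict T] fun x => ρ (G x) := by
    refine ae_eq_of_forall_setLIntegral_eq_of_sigmaFinite hg (hρm.comp hGm) fun E hE _ => ?_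
    rw [Measure.restrict_restrict hE]
    set E' : Set (ℝ × ℝ) := (E ∩ T) ∩ (G ⁻¹' N)ᶜ with hE'
    have hE'm : MeasurableSet E' := (hE.inter hTm).inter (hGm hN).compl
    have hEE' : (E ∩ T : Set (ℝ × ℝ)) =ᵐ[μ₁.prod μ₂] E' := by
      filter_upwards [hGN] with x hx
      refine propext ⟨fun hxE => ⟨hxE, hx hxE.2⟩, fun hxE => hxE.1⟩
    rw [setLIntegral_congr hEE', setLIntegral_congr hEE', ← withDensity_apply _ hE'm, ← hκ,
      ← hQmap, setLIntegral_map hE'm hρG hQm]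
    have hκE : κ E' = γ (Q ⁻¹' E') := by
      unfold HasCopula at h
      rw [← h, Measure.map_apply hQm hE'm]
    have hsing : γ.singularPart (unifMeasure.prod unifMeasure) (Q ⁻¹' E') = 0 := by
      have hle := Measure.singularPart_le γ (unifMeasure.prod unifMeasure)
      have h1 := hle.absolutelyContinuous.ae_le (hγ.ae_fst ae_unifMeasure_mem_Ioo)
      have h2 := hle.absolutelyContinuous.ae_le (hγ.ae_snd ae_unifMeasure_mem_Ioo)
      rw [measure_eq_zero_iff_ae_notMem]
      filter_upwards [h1, h2, measure_eq_zero_iff_ae_notMem.1 hNc] with w h1 h2 h3 h4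
      apply h4.2
      change G (Q w) ∈ N
      rw [hGQ h1 h2 h4.1.2]
      exact not_not.1 h3
    have hdec : γ (Q ⁻¹' E') = ∫⁻ w in Q ⁻¹' E', ρ w ∂(unifMeasure.prod unifMeasure) := by
      conv_lhs => rw [γ.haveLebesgueDecomposition_add (unifMeasure.prod unifMeasure),
        Measure.add_apply, hsing, zero_add, withDensity_apply _ (hQm hE'm)]
    rw [hκE, hdec]
    refine setLIntegral_congr_fun_ae (hQm hE'm) ?_
    filter_upwards [(Measure.quasiMeasurePreserving_fst (μ := unifMeasure)
        (ν := unifMeasure)).ae ae_unifMeasure_mem_Ioo, (Measure.quasiMeasurePreserving_snd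
        (μ := unifMeasure) (ν := unifMeasure)).ae ae_unifMeasure_mem_Ioo] with w h1 h2 hw
    rw [hGQ h1 h2 hw.1.2]
  rw [Filter.EventuallyEq, ae_restrict_iff' hTm] at hmain
  filter_upwards [hmain] with x hx h1 h2
  exact hx ⟨h1, h2⟩

lemma eq_ofReal_div_of_mul_eq {μ : Measure ℝ} [IsFiniteMeasure μ] {x : ℝ}
    (hx : x ∈ discreteSupport μ) {a : ℝ≥0∞} {b : ℝ} (h : a * μ {x} = ENNReal.ofReal b) :
    a = ENNReal.ofReal (b / mixDensity μ x) := by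
  have h0 : μ {x} ≠ 0 := ne_of_gt hx
  have ht : μ {x} ≠ ∞ := measure_ne_top _ _
  rw [mixDensity_of_mem hx, measureReal_def, ENNReal.ofReal_div_of_pos
    (ENNReal.toReal_pos h0 ht), ENNReal.ofReal_toReal ht, ← h]
  exact (ENNReal.mul_div_cancel_right h0 ht).symm

/-- The generalized copula density is the density of a law with respect to the product of its
margins. -/
lemma HasCopula.ae_density_eq (h : HasCopula κ γ μ₁ μ₂) (hγ : IsCopulaMeasure γ)
    {g : ℝ × ℝ → ℝ≥0∞} (hg : Measurable g) (hκ : κ = (μ₁.prod μ₂).withDensity g)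
    {c : ℝ → ℝ → ℝ} (hc : ∀ᵐ w ∂(unifMeasure.prod unifMeasure),
      c w.1 w.2 = (γ.rnDeriv (unifMeasure.prod unifMeasure) w).toReal) :
    ∀ᵐ x ∂(μ₁.prod μ₂), g x = ENNReal.ofReal (genCopulaDensity γ c μ₁ μ₂ x.1 x.2) ∧
      0 ≤ genCopulaDensity γ c μ₁ μ₂ x.1 x.2 := by
  have := hγ.isProbabilityMeasure
  have hdc := ae_prod_of_countable_left μ₁ μ₂ (countable_discreteSupport μ₁)
    (p := fun x => x.2 ∉ discreteSupport μ₂ → g x * μ₁ {x.1} =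
      ENNReal.ofReal (copulaDerivSnd γ (cdf μ₁ x.1) (cdf μ₂ x.2)
        - copulaDerivSnd γ (cdfLeft μ₁ x.1) (cdf μ₂ x.2)) ∧
      copulaDerivSnd γ (cdfLeft μ₁ x.1) (cdf μ₂ x.2) ≤ copulaDerivSnd γ (cdf μ₁ x.1) (cdf μ₂ x.2))
    fun x₁ _ => h.ae_density_atom_left hγ hg hκ x₁
  -- The case of an atom in the second coordinate only is the previous case for the swapped law.
  have hκ' : κ.map Prod.swap = (μ₂.prod μ₁).withDensity (fun x => g x.swap) := by
    ext E hE
    rw [Measure.map_apply measurable_swap hE, hκ, withDensity_apply _ (measurable_swap hE),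
      withDensity_apply _ hE, ← Measure.prod_swap, setLIntegral_map (measurable_swap hE) hg
        measurable_swap]
    rfl
  have hcd := ae_prod_of_countable_right μ₁ μ₂ (countable_discreteSupport μ₂)
    (p := fun x => x.1 ∉ discreteSupport μ₁ → g x * μ₂ {x.2} =
      ENNReal.ofReal (copulaDerivSnd (γ.map Prod.swap) (cdf μ₂ x.2) (cdf μ₁ x.1)
        - copulaDerivSnd (γ.map Prod.swap) (cdfLeft μ₂ x.2) (cdf μ₁ x.1)) ∧
      copulaDerivSnd (γ.map Prod.swap) (cdfLeft μ₂ x.2) (cdf μ₁ x.1) ≤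
        copulaDerivSnd (γ.map Prod.swap) (cdf μ₂ x.2) (cdf μ₁ x.1))
    fun x₂ _ => h.swap.ae_density_atom_left hγ.swap (hg.comp measurable_swap) hκ' x₂
  filter_upwards [hdc, hcd, h.ae_density_nonatom hγ hg hκ, ae_cdf_prod_of_ae μ₁ μ₂ hc,
    ae_cdf_prod_of_ae μ₁ μ₂ (γ.rnDeriv_lt_top (unifMeasure.prod unifMeasure))]
    with ⟨x₁, x₂⟩ hdc hcd hcc hcc' hlt
  simp only [copulaDerivSnd_map_swap] at hdc hcd hcc hcc' hlt ⊢
  rw [genCopulaDensity]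
  split_ifs with h1 h2 h2
  · have hmass : g (x₁, x₂) * μ₁ {x₁} * μ₂ {x₂} = κ ({x₁} ×ˢ {x₂}) := by
      rw [singleton_prod_singleton, hκ, withDensity_apply _ (measurableSet_singleton _),
        lintegral_singleton, ← singleton_prod_singleton, Measure.prod_prod, mul_assoc]
    have hrect : κ.real ({x₁} ×ˢ {x₂}) = copulaFun γ (cdf μ₁ x₁) (cdf μ₂ x₂)
        - copulaFun γ (cdf μ₁ x₁) (cdfLeft μ₂ x₂) - copulaFun γ (cdfLeft μ₁ x₁) (cdf μ₂ x₂)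
        + copulaFun γ (cdfLeft μ₁ x₁) (cdfLeft μ₂ x₂) := by
      have := h.isProbabilityMeasure hγ
      have e1 := h.real_prod_singleton hγ measurableSet_Iic (isQuantileLevel_Iic x₁) x₂
      have e2 := h.real_prod_singleton hγ measurableSet_Iio (isQuantileLevel_Iio x₁) x₂
      rw [← Iio_union_right, union_prod, measureReal_union
        (Disjoint.set_prod_left (by simp) _ _)
        ((measurableSet_singleton x₁).prod (measurableSet_singleton x₂))] at e1
      linarith
    have := h.isProbabilityMeasure hγ
    rw [← hrect, mul_comm (mixDensity μ₁ x₁), ← div_div]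
    refine ⟨?_, div_nonneg (div_nonneg measureReal_nonneg (mixDensity_nonneg _ _))
      (mixDensity_nonneg _ _)⟩
    refine eq_ofReal_div_of_mul_eq h1 (eq_ofReal_div_of_mul_eq h2 ?_)
    rw [hmass, measureReal_def, ENNReal.ofReal_toReal (measure_ne_top _ _)]
  · exact ⟨eq_ofReal_div_of_mul_eq h1 (hdc h1 h2).1,
      div_nonneg (sub_nonneg.2 (hdc h1 h2).2) (mixDensity_nonneg _ _)⟩
  · exact ⟨eq_ofReal_div_of_mul_eq h2 (hcd h2 h1).1,
      div_nonneg (sub_nonneg.2 (hcd h2 h1).2) (mixDensity_nonneg _ _)⟩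
  · rw [hcc h1 h2, hcc' h1 h2, ENNReal.ofReal_toReal (hlt h1 h2).ne]
    exact ⟨rfl, ENNReal.toReal_nonneg⟩

omit [IsProbabilityMeasure μ₁] in
/-- The generalized h-function at an atom of the conditioning variable. -/
lemma HasCopula.genH12_of_mem (h : HasCopula κ γ μ₁ μ₂) (hγ : IsCopulaMeasure γ)
    {η : Kernel ℝ ℝ} [IsMarkovKernel η] (hη : κ.map Prod.swap = μ₂ ⊗ₘ η) {z : ℝ}
    (hz : z ∈ discreteSupport μ₂) (y : ℝ) : genH12 γ μ₁ μ₂ y z = (η z).real (Iic y) := by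
  have := h.isProbabilityMeasure hγ
  have h1 : κ (Iic y ×ˢ {z}) = η z (Iic y) * μ₂ {z} := by
    have : κ.map Prod.swap ({z} ×ˢ Iic y) = κ (Iic y ×ˢ {z}) := by
      rw [Measure.map_apply measurable_swap ((measurableSet_singleton z).prod measurableSet_Iic),
        preimage_swap_prod]
    rw [← this, hη, Measure.compProd_apply_prod (measurableSet_singleton z) measurableSet_Iic,
      lintegral_singleton]
  rw [genH12, if_pos hz, ← h.real_prod_singleton hγ measurableSet_Iic (isQuantileLevel_Iic y) z,
    measureReal_def, h1, mixDensity_of_mem hz, ENNReal.toReal_mul, measureReal_def,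
    measureReal_def, mul_div_cancel_right₀]
  exact (ENNReal.toReal_pos (ne_of_gt hz) (measure_ne_top _ _)).ne'

omit [IsProbabilityMeasure μ₁] in
/-- The partial derivative of the copula off the atoms of the conditioning variable. -/
lemma HasCopula.ae_hasDerivAt (h : HasCopula κ γ μ₁ μ₂) (hγ : IsCopulaMeasure γ)
    {η : Kernel ℝ ℝ} [IsMarkovKernel η] (hη : κ.map Prod.swap = μ₂ ⊗ₘ η) (y : ℝ) :
    ∀ᵐ z ∂μ₂, z ∉ discreteSupport μ₂ →
      HasDerivAt (copulaFun γ (cdf μ₁ y)) ((η z).real (Iic y)) (cdf μ₂ z) := by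
  have hd := measurableSet_discreteSupport μ₂
  have hm : Measurable fun z => ENNReal.ofReal (copulaDerivSnd γ (cdf μ₁ y) (cdf μ₂ z)) :=
    ((measurable_copulaDerivSnd _).comp (monotone_cdf μ₂).measurable).ennreal_ofReal
  have hmain : (fun z => η z (Iic y)) =ᵐ[μ₂.restrict (discreteSupport μ₂)ᶜ]
      fun z => ENNReal.ofReal (copulaDerivSnd γ (cdf μ₁ y) (cdf μ₂ z)) := by
    refine ae_eq_of_forall_setLIntegral_eq_of_sigmaFinite
      (Kernel.measurable_coe η measurableSet_Iic) hm fun B hB _ => ?_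
    rw [Measure.restrict_restrict hB]
    have hBm : MeasurableSet (B ∩ (discreteSupport μ₂)ᶜ) := hB.inter hd.compl
    rw [← h.apply_prod_eq_lintegral hγ measurableSet_Iic hBm (isQuantileLevel_Iic y)
        inter_subset_right, ← Measure.compProd_apply_prod hBm measurableSet_Iic, ← hη,
      Measure.map_apply measurable_swap (hBm.prod measurableSet_Iic), preimage_swap_prod]
  rw [Filter.EventuallyEq, ae_restrict_iff' hd.compl] at hmain
  filter_upwards [hmain, ae_cdf_of_ae μ₂
    (ae_restrict_of_ae (ae_hasDerivAt_copulaFun hγ (cdf μ₁ y)))] with z hz hz' hzd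
  rw [measureReal_def, hz hzd, ENNReal.toReal_ofReal (copulaDerivSnd_nonneg hγ _ _)]
  exact hz' hzd

end BivariateDensity

section Measurability
open Filter Topology
open scoped ENNReal

/-! ### Measurability in a parameter -/

/-- By density of the rationals and continuity off x, any closed neighbourhood of c that captures
the values at nearby rationals captures all nearby values. -/
lemma tendsto_nhdsNE_of_tendsto_rat {s : ℝ → ℝ} {x c : ℝ} (hs : ContinuousOn s {x}ᶜ)
    (h : Tendsto (fun q : ℚ => s q) (comap (fun q : ℚ => (q : ℝ)) (𝓝[≠] x)) (𝓝 c)) :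
    Tendsto s (𝓝[≠] x) (𝓝 c) := by
  rw [(closed_nhds_basis c).tendsto_right_iff]
  rintro K ⟨hK, hKc⟩
  obtain ⟨U, hU, hUK⟩ := Filter.mem_comap.1 (h hK)
  obtain ⟨V, hVo, hxV, hVU⟩ := mem_nhdsWithin.1 hU
  refine mem_nhdsWithin.2 ⟨V, hVo, hxV, fun y hy => ?_⟩
  have hWo : IsOpen (V ∩ {x}ᶜ) := hVo.inter isOpen_compl_singleton
  have hy' : y ∈ closure ((V ∩ {x}ᶜ) ∩ range ((↑) : ℚ → ℝ)) :=
    Rat.denseRange_cast.open_subset_closure_inter hWo hy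
  have hcont : ContinuousWithinAt s ((V ∩ {x}ᶜ) ∩ range ((↑) : ℚ → ℝ)) y :=
    (hs y hy.2).mono fun z hz => hz.1.2
  have := hcont.mem_closure_image hy'
  refine hKc.closure_subset_iff.2 ?_ this
  rintro _ ⟨_, ⟨hz, q, rfl⟩, rfl⟩
  exact hUK (hVU hz)

lemma differentiableAt_iff_exists_tendsto_rat {f : ℝ → ℝ} (hf : Continuous f) (x : ℝ) :
    DifferentiableAt ℝ f x ↔ ∃ c, Tendsto (fun q : ℚ => slope f x (x + q))
      (comap (fun q : ℚ => (q : ℝ)) (𝓝[≠] 0)) (𝓝 c) := by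
  have hslope (c : ℝ) : HasDerivAt f c x ↔ Tendsto (fun t => slope f x (x + t)) (𝓝[≠] 0) (𝓝 c) := by
    rw [hasDerivAt_iff_tendsto_slope_zero]
    simp [slope_def_module]
  constructor
  · intro h
    exact ⟨deriv f x, ((hslope _).1 h.hasDerivAt).comp tendsto_comap⟩
  · rintro ⟨c, hc⟩
    refine ((hslope c).2 (tendsto_nhdsNE_of_tendsto_rat ?_ hc)).differentiableAt
    intro t ht
    simp only [slope_def_module, add_sub_cancel_left]
    exact ((continuousAt_inv₀ ht).smul (by fun_prop)).continuousWithinAt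

/-! ### Joint measurability of derivatives in the point and a parameter -/

section Deriv

variable {β : Type*} [MeasurableSpace β] {f : β → ℝ → ℝ}

/-- For continuous functions rational increments decide differentiability, and convergence of a
countable family of measurable functions is a measurable event. -/
lemma measurableSet_differentiableAt_of_continuous (hf : ∀ b, Continuous (f b))
    (hm : Measurable fun p : β × ℝ => f p.1 p.2) :
    MeasurableSet {p : β × ℝ | DifferentiableAt ℝ (f p.1) p.2} := by
  simp_rw [differentiableAt_iff_exists_tendsto_rat (hf _)]
  refine MeasureTheory.measurableSet_exists_tendsto fun q => ?_
  simp only [slope_def_module, add_sub_cancel_left, smul_eq_mul]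
  have h1 : Measurable fun p : β × ℝ => f p.1 (p.2 + q) :=
    hm.comp (measurable_fst.prodMk (measurable_snd.add_const _))
  exact (h1.sub hm).const_mul _

lemma measurable_deriv_of_continuous (hf : ∀ b, Continuous (f b))
    (hm : Measurable fun p : β × ℝ => f p.1 p.2) :
    Measurable fun p : β × ℝ => deriv (f p.1) p.2 := by
  have hD := measurableSet_differentiableAt_of_continuous hf hm
  -- Difference quotients with step 1/(n+1), cut off where the derivative does not exist, since
  -- `deriv` takes the value 0 there.
  refine measurable_of_tendsto_metrizable (f := fun (n : ℕ) =>
    {p : β × ℝ | DifferentiableAt ℝ (f p.1) p.2}.indicator fun p =>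
      (1 / ((n : ℝ) + 1))⁻¹ * (f p.1 (p.2 + 1 / ((n : ℝ) + 1)) - f p.1 p.2)) (fun n => ?_) ?_
  · refine Measurable.indicator ?_ hD
    have h1 : Measurable fun p : β × ℝ => f p.1 (p.2 + 1 / ((n : ℝ) + 1)) :=
      hm.comp (measurable_fst.prodMk (measurable_snd.add_const _))
    exact (h1.sub hm).const_mul _
  · refine tendsto_pi_nhds.2 fun p => ?_
    by_cases hp : DifferentiableAt ℝ (f p.1) p.2
    · have h0 : Tendsto (fun n : ℕ => 1 / ((n : ℝ) + 1)) atTop (𝓝[≠] 0) :=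
        tendsto_nhdsWithin_iff.2 ⟨tendsto_one_div_add_atTop_nhds_zero_nat,
          .of_forall fun n => (Nat.one_div_pos_of_nat (α := ℝ)).ne'⟩
      have := (hasDerivAt_iff_tendsto_slope_zero.1 hp.hasDerivAt).comp h0
      refine this.congr fun n => ?_
      rw [indicator_of_mem (by exact hp)]
      rfl
    · rw [deriv_zero_of_not_differentiableAt hp]
      refine tendsto_const_nhds.congr fun n => ?_
      rw [indicator_of_notMem (by exact hp)]

end Deriv

/-- Slices are dominated by the uniform law, so a copula is 1-Lipschitz in each argument. -/
lemma continuous_copulaFun {γ : Measure (ℝ × ℝ)} (hγ : IsCopulaMeasure γ) (u : ℝ) :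
    Continuous (copulaFun γ u) := by
  have h {v v' : ℝ} (hv : v ≤ v') : copulaFun γ u v' - copulaFun γ u v ≤ v' - v := by
    have := isFiniteMeasure_copulaSlice hγ u
    have h1 : (copulaSlice γ u).real (Ioc v v') = copulaFun γ u v' - copulaFun γ u v := by
      rw [← copulaSlice_real_Iic, ← copulaSlice_real_Iic, ← Iic_union_Ioc_eq_Iic hv,
        measureReal_union (Iic_disjoint_Ioc le_rfl) measurableSet_Ioc]
      ring
    rw [← h1, measureReal_def]
    refine ENNReal.toReal_le_of_le_ofReal (by linarith) ?_
    refine (copulaSlice_le hγ u _).trans ((Measure.restrict_apply_le _ _).trans ?_)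
    simp
  refine (LipschitzWith.of_le_add fun v v' => ?_ : LipschitzWith 1 (copulaFun γ u)).continuous
  rcases le_total v v' with hv | hv
  · exact (copulaFun_mono_right hγ u hv).trans (le_add_of_nonneg_right dist_nonneg)
  · rw [Real.dist_eq, abs_of_nonneg (by linarith)]
    linarith [h hv]

/-! ### Measurability along kernels -/

section Kernels

variable {α : Type*} [MeasurableSpace α]

lemma measurable_kernel_Iic (κ : Kernel α ℝ) [IsSFiniteKernel κ] :
    Measurable fun p : α × ℝ => κ p.1 (Iic p.2) := by
  have hs : MeasurableSet {q : (α × ℝ) × ℝ | q.2 ≤ q.1.2} :=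
    measurableSet_le (by fun_prop) (by fun_prop)
  exact Kernel.measurable_kernel_prodMk_left (κ := κ.comap Prod.fst measurable_fst) hs

lemma measurable_kernel_Iio (κ : Kernel α ℝ) [IsSFiniteKernel κ] :
    Measurable fun p : α × ℝ => κ p.1 (Iio p.2) := by
  have hs : MeasurableSet {q : (α × ℝ) × ℝ | q.2 < q.1.2} :=
    measurableSet_lt (by fun_prop) (by fun_prop)
  exact Kernel.measurable_kernel_prodMk_left (κ := κ.comap Prod.fst measurable_fst) hs

lemma measurable_kernel_singleton (κ : Kernel α ℝ) [IsSFiniteKernel κ] :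
    Measurable fun p : α × ℝ => κ p.1 {p.2} := by
  have hs : MeasurableSet {q : (α × ℝ) × ℝ | q.2 = q.1.2} :=
    measurableSet_eq_fun (by fun_prop) (by fun_prop)
  exact Kernel.measurable_kernel_prodMk_left (κ := κ.comap Prod.fst measurable_fst) hs

lemma measurable_cdf_kernel (κ : Kernel α ℝ) [IsMarkovKernel κ] :
    Measurable fun p : α × ℝ => cdf (κ p.1) p.2 := by
  simp_rw [cdf_eq_real, measureReal_def]
  exact (measurable_kernel_Iic κ).ennreal_toReal

lemma measurable_cdfLeft_kernel (κ : Kernel α ℝ) [IsMarkovKernel κ] :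
    Measurable fun p : α × ℝ => cdfLeft (κ p.1) p.2 := by
  simp_rw [cdfLeft_eq_real, measureReal_def]
  exact (measurable_kernel_Iio κ).ennreal_toReal

lemma measurableSet_discreteSupport_kernel (κ : Kernel α ℝ) [IsSFiniteKernel κ] :
    MeasurableSet {p : α × ℝ | p.2 ∈ discreteSupport (κ p.1)} :=
  measurableSet_lt measurable_const (measurable_kernel_singleton κ)

lemma measurable_copulaFun_kernel (C : Kernel α (ℝ × ℝ)) [IsSFiniteKernel C] :
    Measurable fun p : (α × ℝ) × ℝ => copulaFun (C p.1.1) p.1.2 p.2 := by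
  have h1 : MeasurableSet {q : ((α × ℝ) × ℝ) × (ℝ × ℝ) | q.2.1 ≤ q.1.1.2} :=
    measurableSet_le (by fun_prop) (by fun_prop)
  have h2 : MeasurableSet {q : ((α × ℝ) × ℝ) × (ℝ × ℝ) | q.2.2 ≤ q.1.2} :=
    measurableSet_le (by fun_prop) (by fun_prop)
  have hs := h1.inter h2
  exact (Kernel.measurable_kernel_prodMk_left
    (κ := C.comap (fun p : (α × ℝ) × ℝ => p.1.1) (by fun_prop)) hs).ennreal_toReal

lemma measurableSet_differentiableAt_copulaFun (C : Kernel α (ℝ × ℝ)) [IsSFiniteKernel C]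
    (hC : ∀ a, IsCopulaMeasure (C a)) :
    MeasurableSet {p : (α × ℝ) × ℝ | DifferentiableAt ℝ (copulaFun (C p.1.1) p.1.2) p.2} :=
  measurableSet_differentiableAt_of_continuous
    (f := fun (b : α × ℝ) v => copulaFun (C b.1) b.2 v)
    (fun b => continuous_copulaFun (hC b.1) b.2) (measurable_copulaFun_kernel C)

lemma measurable_copulaDerivSnd_kernel (C : Kernel α (ℝ × ℝ)) [IsSFiniteKernel C]
    (hC : ∀ a, IsCopulaMeasure (C a)) :
    Measurable fun p : (α × ℝ) × ℝ => copulaDerivSnd (C p.1.1) p.1.2 p.2 :=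
  measurable_deriv_of_continuous (f := fun (b : α × ℝ) v => copulaFun (C b.1) b.2 v)
    (fun b => continuous_copulaFun (hC b.1) b.2) (measurable_copulaFun_kernel C)

lemma measurable_copulaDerivFst_kernel (C : Kernel α (ℝ × ℝ)) [IsSFiniteKernel C]
    (hC : ∀ a, IsCopulaMeasure (C a)) :
    Measurable fun p : (α × ℝ) × ℝ => copulaDerivFst (C p.1.1) p.1.2 p.2 := by
  have h := measurable_copulaDerivSnd_kernel (C.map Prod.swap) fun a => by
    rw [Kernel.map_apply _ measurable_swap]; exact (hC a).swap
  simp_rw [Kernel.map_apply _ measurable_swap] at h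
  have h2 : Measurable fun p : (α × ℝ) × ℝ => ((p.1.1, p.2), p.1.2) := by fun_prop
  convert h.comp h2 using 2 with p
  exact (copulaDerivSnd_map_swap _ _ _).symm

/-- Needed to pass from an almost everywhere identity on every fibre to one on the product space. -/
lemma measurable_genCopulaDensity (C : Kernel α (ℝ × ℝ)) [IsFiniteKernel C]
    (hC : ∀ a, IsCopulaMeasure (C a)) (κ₁ κ₂ : Kernel α ℝ) [IsMarkovKernel κ₁]
    [IsMarkovKernel κ₂] :
    Measurable fun p : α × ℝ × ℝ => genCopulaDensity (C p.1) (copulaDensity C p.1)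
      (κ₁ p.1) (κ₂ p.1) p.2.1 p.2.2 := by
  classical
  have p1 : Measurable fun p : α × ℝ × ℝ => (p.1, p.2.1) := by fun_prop
  have p2 : Measurable fun p : α × ℝ × ℝ => (p.1, p.2.2) := by fun_prop
  have F1 := (measurable_cdf_kernel κ₁).comp p1
  have F2 := (measurable_cdf_kernel κ₂).comp p2
  have G1 := (measurable_cdfLeft_kernel κ₁).comp p1
  have G2 := (measurable_cdfLeft_kernel κ₂).comp p2
  -- The densities of the margins enter only at atoms, where they are point masses and hence
  -- measurable in the parameter.
  have m1 := (measurable_kernel_singleton κ₁).ennreal_toReal.comp p1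
  have m2 := (measurable_kernel_singleton κ₂).ennreal_toReal.comp p2
  have hF := measurable_copulaFun_kernel C
  have hD1 := measurable_copulaDerivFst_kernel C hC
  have hD2 := measurable_copulaDerivSnd_kernel C hC
  have s1 := p1 (measurableSet_discreteSupport_kernel κ₁)
  have s2 := p2 (measurableSet_discreteSupport_kernel κ₂)
  have pk {u v : α × ℝ × ℝ → ℝ} (hu : Measurable u) (hv : Measurable v) :
      Measurable fun p : α × ℝ × ℝ => ((p.1, u p), v p) := by fun_prop
  have hc : Measurable fun p : α × ℝ × ℝ =>
      copulaDensity C p.1 (cdf (κ₁ p.1) p.2.1) (cdf (κ₂ p.1) p.2.2) := by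
    unfold copulaDensity
    exact (Kernel.measurable_rnDeriv C _).ennreal_toReal.comp
      (measurable_fst.prodMk (F1.prodMk F2))
  have ite {s : Set (α × ℝ × ℝ)} (hs : MeasurableSet s) {f g : α × ℝ × ℝ → ℝ}
      (hf : Measurable f) (hg : Measurable g) : Measurable fun p => if p ∈ s then f p else g p :=
    Measurable.ite hs hf hg
  have hall := ite s1
    (ite s2
      ((((hF.comp (pk F1 F2)).sub (hF.comp (pk F1 G2))).sub (hF.comp (pk G1 F2))).add
        (hF.comp (pk G1 G2)) |>.div (m1.mul m2))
      (((hD2.comp (pk F1 F2)).sub (hD2.comp (pk G1 F2))).div m1))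
    (ite s2
      (((hD1.comp (pk F1 F2)).sub (hD1.comp (pk F1 G2))).div m2) hc)
  convert hall using 2 with p
  rw [genCopulaDensity]
  by_cases h1 : p.2.1 ∈ discreteSupport (κ₁ p.1) <;>
  by_cases h2 : p.2.2 ∈ discreteSupport (κ₂ p.1)
  · simp [h1, h2, mixDensity_of_mem, measureReal_def]
  · simp [h1, h2, mixDensity_of_mem, measureReal_def]
  · simp [h1, h2, mixDensity_of_mem, measureReal_def]
  · simp [h1, h2]

end Kernels
end Measurability

section ConditionalDensity
open Filter Topology
open scoped ENNReal

/-! ### Densities of composition products -/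

/-- The marginal densities p and q are nonzero κ-almost everywhere, and where p·q ≠ 0 the null sets
of α × β and of μ₁ × μ₂ agree. -/
lemma absolutelyContinuous_prod_of_map {κ : Measure (ℝ × ℝ)} {μ₁ μ₂ α β : Measure ℝ}
    [SFinite α] [SFinite β] {p q : ℝ → ℝ≥0∞} (hp : Measurable p) (hq : Measurable q)
    (h1 : κ.map Prod.fst = μ₁) (h2 : κ.map Prod.snd = μ₂) (hp1 : μ₁ = α.withDensity p)
    (hq2 : μ₂ = β.withDensity q) (h : κ ≪ α.prod β) : κ ≪ μ₁.prod μ₂ := by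
  have hpq : μ₁.prod μ₂ = (α.prod β).withDensity fun x => p x.1 * q x.2 := by
    rw [hp1, hq2, prod_withDensity hp hq]
  have hz {μ ν : Measure ℝ} {f : ℝ → ℝ≥0∞} (hf : Measurable f) (hμ : μ = ν.withDensity f) :
      ∀ᵐ x ∂μ, f x ≠ 0 := by
    rw [hμ, ae_withDensity_iff hf]
    exact .of_forall fun _ h => h
  have hpκ : ∀ᵐ x ∂κ, p x.1 ≠ 0 :=
    ae_of_ae_map measurable_fst.aemeasurable (by rw [h1]; exact hz hp hp1)
  have hqκ : ∀ᵐ x ∂κ, q x.2 ≠ 0 :=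
    ae_of_ae_map measurable_snd.aemeasurable (by rw [h2]; exact hz hq hq2)
  intro N hN
  have hN' : ∀ᵐ x ∂(α.prod β), p x.1 * q x.2 ≠ 0 → x ∉ N := by
    rw [← ae_withDensity_iff (by fun_prop), ← hpq]
    exact measure_eq_zero_iff_ae_notMem.1 hN
  rw [measure_eq_zero_iff_ae_notMem]
  filter_upwards [h.ae_le hN', hpκ, hqκ] with x hx hxp hxq
  exact hx (mul_ne_zero hxp hxq)

variable {F G : Type*} [MeasurableSpace F] [MeasurableSpace G]
  [MeasurableSpace.CountablyGenerated G]

lemma ae_eq_withDensity_rnDeriv_const {τ m : Measure F} {π : Measure G} [IsFiniteMeasure τ]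
    [IsFiniteMeasure m] [IsFiniteMeasure π] {κ : Kernel F G} [IsFiniteKernel κ]
    (h : τ ⊗ₘ κ ≪ m.prod π) :
    ∀ᵐ t ∂τ, κ t = π.withDensity (κ.rnDeriv (Kernel.const F π) t) := by
  rw [← Measure.compProd_const] at h
  filter_upwards [h.kernel_of_compProd] with t ht
  have := Kernel.withDensity_rnDeriv_eq ht
  rw [Kernel.withDensity_apply _ (by fun_prop), Kernel.const_apply] at this
  exact this.symm

/-- The chain rule "joint density = marginal density times conditional density", available because
the reference law is a product. -/
lemma rnDeriv_compProd_const {τ m : Measure F} {π : Measure G} [IsFiniteMeasure τ]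
    [IsFiniteMeasure m] [IsFiniteMeasure π] {κ : Kernel F G} [IsFiniteKernel κ]
    (hτ : τ ≪ m) (h : τ ⊗ₘ κ ≪ m.prod π) :
    (τ ⊗ₘ κ).rnDeriv (m.prod π) =ᵐ[m.prod π]
      fun p => τ.rnDeriv m p.1 * κ.rnDeriv (Kernel.const F π) p.1 p.2 := by
  have hs := Kernel.measurable_rnDeriv κ (Kernel.const F π)
  have hr := Measure.measurable_rnDeriv τ m
  have hm : Measurable fun p : F × G =>
      τ.rnDeriv m p.1 * κ.rnDeriv (Kernel.const F π) p.1 p.2 :=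
    (hr.comp measurable_fst).mul hs
  have key : τ ⊗ₘ κ = (m.prod π).withDensity
      fun p => τ.rnDeriv m p.1 * κ.rnDeriv (Kernel.const F π) p.1 p.2 := by
    ext E hE
    have h1 : ∀ᵐ t ∂τ, κ t (Prod.mk t ⁻¹' E) =
        ∫⁻ y, E.indicator (fun p => κ.rnDeriv (Kernel.const F π) p.1 p.2) (t, y) ∂π := by
      filter_upwards [ae_eq_withDensity_rnDeriv_const h] with t ht
      have hEt : MeasurableSet (Prod.mk t ⁻¹' E) := measurable_prodMk_left hE
      conv_lhs => rw [ht]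
      rw [withDensity_apply _ hEt, ← lintegral_indicator hEt]
      rfl
    rw [Measure.compProd_apply hE, lintegral_congr_ae h1, withDensity_apply _ hE,
      ← lintegral_indicator hE, lintegral_prod _ (hm.indicator hE).aemeasurable]
    conv_lhs => rw [← Measure.withDensity_rnDeriv_eq τ m hτ]
    rw [lintegral_withDensity_eq_lintegral_mul _ hr (hs.indicator hE).lintegral_prod_right']
    refine lintegral_congr fun t => ?_
    have hst : Measurable fun y => E.indicator
        (fun p => κ.rnDeriv (Kernel.const F π) p.1 p.2) (t, y) :=
      (hs.indicator hE).comp measurable_prodMk_left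
    rw [Pi.mul_apply, ← lintegral_const_mul _ hst]
    refine lintegral_congr fun y => ?_
    by_cases hy : (t, y) ∈ E <;> simp [hy]
  conv_lhs => rw [key]
  exact Measure.rnDeriv_withDensity _ hm

lemma HasCopula.map_fst {κ γ : Measure (ℝ × ℝ)} {μ₁ μ₂ : Measure ℝ} [IsProbabilityMeasure μ₁]
    (h : HasCopula κ γ μ₁ μ₂) (hγ : IsCopulaMeasure γ) : κ.map Prod.fst = μ₁ := by
  have hq := (measurable_quantile μ₁).prodMap (measurable_quantile μ₂)
  calc κ.map Prod.fst = (γ.map Prod.fst).map (quantile μ₁) := by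
        rw [← show _ = κ from h, Measure.map_map measurable_fst hq,
          Measure.map_map (measurable_quantile μ₁) measurable_fst]
        rfl
    _ = μ₁ := by rw [hγ.1, map_quantile]

lemma HasCopula.map_snd {κ γ : Measure (ℝ × ℝ)} {μ₁ μ₂ : Measure ℝ} [IsProbabilityMeasure μ₂]
    (h : HasCopula κ γ μ₁ μ₂) (hγ : IsCopulaMeasure γ) : κ.map Prod.snd = μ₂ := by
  rw [← h.swap.map_fst hγ.swap, Measure.map_map measurable_fst measurable_swap]
  rfl

lemma copulaDensity_ae_eq {C : Kernel F (ℝ × ℝ)} [IsFiniteKernel C] (t : F) :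
    ∀ᵐ w ∂(unifMeasure.prod unifMeasure), copulaDensity C t w.1 w.2 =
      ((C t).rnDeriv (unifMeasure.prod unifMeasure) w).toReal := by
  have hsq : unifMeasure.prod unifMeasure =
      volume.restrict (Icc (0 : ℝ) 1 ×ˢ Icc (0 : ℝ) 1) := Measure.prod_restrict _ _
  rw [hsq]
  have : IsFiniteMeasure (volume.restrict (Icc (0 : ℝ) 1 ×ˢ Icc (0 : ℝ) 1)) := by
    rw [← hsq]; infer_instance
  filter_upwards [Kernel.rnDeriv_eq_rnDeriv_measure (κ := C) (a := t)
    (η := Kernel.const F (volume.restrict (Icc (0 : ℝ) 1 ×ˢ Icc (0 : ℝ) 1)))] with w hw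
  rw [copulaDensity, Prod.mk.eta, hw, Kernel.const_apply]

/-- The pair-copula decomposition of the density of `(T, A, B)` with respect to a product law. -/
lemma ae_rnDeriv_mul_eq_genCopulaDensity {τ m : Measure F} {πa πb : Measure ℝ}
    [IsProbabilityMeasure τ] [IsProbabilityMeasure m] [IsProbabilityMeasure πa]
    [IsProbabilityMeasure πb] {κ C : Kernel F (ℝ × ℝ)} {κ₁ κ₂ : Kernel F ℝ} [IsMarkovKernel κ]
    [IsFiniteKernel C] [IsMarkovKernel κ₁] [IsMarkovKernel κ₂]
    (hC : ∀ t, IsCopulaMeasure (C t))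
    (hκ : ∀ᵐ t ∂τ, HasCopula (κ t) (C t) (κ₁ t) (κ₂ t))
    (hτ : τ ≪ m) (h : τ ⊗ₘ κ ≪ m.prod (πa.prod πb)) (h₁ : τ ⊗ₘ κ₁ ≪ m.prod πa)
    (h₂ : τ ⊗ₘ κ₂ ≪ m.prod πb) :
    ∀ᵐ p ∂(m.prod (πa.prod πb)), τ.rnDeriv m p.1 ≠ 0 →
      ((τ ⊗ₘ κ).rnDeriv (m.prod (πa.prod πb)) p).toReal * (τ.rnDeriv m p.1).toReal =
        genCopulaDensity (C p.1) (copulaDensity C p.1) (κ₁ p.1) (κ₂ p.1) p.2.1 p.2.2 *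
          ((τ ⊗ₘ κ₁).rnDeriv (m.prod πa) (p.1, p.2.1)).toReal *
          ((τ ⊗ₘ κ₂).rnDeriv (m.prod πb) (p.1, p.2.2)).toReal := by
  set s := κ.rnDeriv (Kernel.const F (πa.prod πb)) with hs
  set sa := κ₁.rnDeriv (Kernel.const F πa) with hsa
  set sb := κ₂.rnDeriv (Kernel.const F πb) with hsb
  have hsm : Measurable fun p : F × ℝ × ℝ => s p.1 p.2 := Kernel.measurable_rnDeriv _ _
  have hsam : Measurable fun p : F × ℝ => sa p.1 p.2 := Kernel.measurable_rnDeriv _ _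
  have hsbm : Measurable fun p : F × ℝ => sb p.1 p.2 := Kernel.measurable_rnDeriv _ _
  have hcm := measurable_genCopulaDensity C hC κ₁ κ₂
  -- With t fixed, the conditional law is compared first with the product of its margins, which
  -- gives the copula density, and then with πa × πb, which gives the two marginal densities.
  have hfib : ∀ᵐ t ∂τ, ∀ᵐ x ∂(πa.prod πb), (s t x).toReal =
      genCopulaDensity (C t) (copulaDensity C t) (κ₁ t) (κ₂ t) x.1 x.2 *
        ((sa t x.1).toReal * (sb t x.2).toReal) := by
    filter_upwards [hκ, ae_eq_withDensity_rnDeriv_const h, ae_eq_withDensity_rnDeriv_const h₁,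
      ae_eq_withDensity_rnDeriv_const h₂] with t hcop e e1 e2
    have hst : Measurable (s t) := hsm.comp measurable_prodMk_left
    have hsat : Measurable (sa t) := hsam.comp measurable_prodMk_left
    have hsbt : Measurable (sb t) := hsbm.comp measurable_prodMk_left
    have hct : Measurable fun x : ℝ × ℝ => ENNReal.ofReal
        (genCopulaDensity (C t) (copulaDensity C t) (κ₁ t) (κ₂ t) x.1 x.2) :=
      hcm.ennreal_ofReal.comp measurable_prodMk_left
    have hac : κ t ≪ (κ₁ t).prod (κ₂ t) := by
      refine absolutelyContinuous_prod_of_map hsat hsbt (hcop.map_fst (hC t))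
        (hcop.map_snd (hC t)) e1 e2 ?_
      rw [e]
      exact withDensity_absolutelyContinuous _ _
    have e3 := Measure.withDensity_rnDeriv_eq _ _ hac
    have e4 := hcop.ae_density_eq (hC t) (Measure.measurable_rnDeriv _ _) e3.symm
      (copulaDensity_ae_eq t)
    rw [withDensity_congr_ae (e4.mono fun _ h => h.1)] at e3
    have e6 := e4.mono fun _ h => h.2
    have e5 : (κ₁ t).prod (κ₂ t) = (πa.prod πb).withDensity fun x => sa t x.1 * sb t x.2 := by
      conv_lhs => rw [e1, e2]
      exact prod_withDensity hsat hsbt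
    have hprod : Measurable fun x : ℝ × ℝ => sa t x.1 * sb t x.2 := by fun_prop
    rw [e5, ae_withDensity_iff hprod] at e6
    rw [e5, ← withDensity_mul _ hprod hct] at e3
    rw [e] at e3
    have := (withDensity_eq_iff_of_sigmaFinite hst.aemeasurable
      (hprod.mul hct).aemeasurable).1 e3.symm
    filter_upwards [this, e6] with x hx hx0
    rw [hx, Pi.mul_apply, mul_comm, ENNReal.toReal_mul, ← ENNReal.toReal_mul (a := sa t x.1)]
    -- Nonnegativity of the copula density is known only where the product of the marginal densities
    -- is nonzero; elsewhere both sides vanish.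
    by_cases h0 : sa t x.1 * sb t x.2 = 0
    · simp [h0]
    · rw [ENNReal.toReal_ofReal (hx0 h0)]
  rw [← Measure.withDensity_rnDeriv_eq τ m hτ, ae_withDensity_iff
    (Measure.measurable_rnDeriv _ _)] at hfib
  have hr0 := Measure.measurable_rnDeriv τ m
  have hjoint : ∀ᵐ p ∂(m.prod (πa.prod πb)), τ.rnDeriv m p.1 ≠ 0 →
      (s p.1 p.2).toReal = genCopulaDensity (C p.1) (copulaDensity C p.1) (κ₁ p.1) (κ₂ p.1)
        p.2.1 p.2.2 * ((sa p.1 p.2.1).toReal * (sb p.1 p.2.2).toReal) := by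
    have hA : MeasurableSet {p : F × ℝ × ℝ | τ.rnDeriv m p.1 ≠ 0} :=
      ((hr0.comp measurable_fst) (measurableSet_singleton 0)).compl
    have hB : MeasurableSet {p : F × ℝ × ℝ | (s p.1 p.2).toReal = genCopulaDensity
        (C p.1) (copulaDensity C p.1) (κ₁ p.1) (κ₂ p.1) p.2.1 p.2.2 *
        ((sa p.1 p.2.1).toReal * (sb p.1 p.2.2).toReal)} := by
      refine measurableSet_eq_fun hsm.ennreal_toReal (hcm.mul ?_)
      exact (hsam.ennreal_toReal.comp
        (by fun_prop : Measurable fun p : F × ℝ × ℝ => (p.1, p.2.1))).mul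
        (hsbm.ennreal_toReal.comp (by fun_prop : Measurable fun p : F × ℝ × ℝ => (p.1, p.2.2)))
    refine (Measure.ae_prod_iff_ae_ae ?_).2 ?_
    · convert hA.compl.union hB using 1
      ext p; simp [imp_iff_not_or]
    · filter_upwards [hfib] with t ht
      by_cases h0 : τ.rnDeriv m t = 0
      · exact .of_forall fun x hx => absurd h0 hx
      · filter_upwards [ht h0] with x hx _ using hx
  have hqa : Measure.QuasiMeasurePreserving (fun p : F × ℝ × ℝ => (p.1, p.2.1))
      (m.prod (πa.prod πb)) (m.prod πa) := by
    refine ⟨by fun_prop, ?_⟩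
    have := Measure.map_prod_map m (πa.prod πb) measurable_id (measurable_fst (β := ℝ))
    simp only [Measure.map_id, Measure.map_fst_prod, measure_univ, one_smul] at this
    rw [this]
    rfl
  have hqb : Measure.QuasiMeasurePreserving (fun p : F × ℝ × ℝ => (p.1, p.2.2))
      (m.prod (πa.prod πb)) (m.prod πb) := by
    refine ⟨by fun_prop, ?_⟩
    have := Measure.map_prod_map m (πa.prod πb) measurable_id (measurable_snd (α := ℝ))
    simp only [Measure.map_id, Measure.map_snd_prod, measure_univ, one_smul] at this
    rw [this]
    rfl
  filter_upwards [hjoint, rnDeriv_compProd_const hτ h, hqa.ae (rnDeriv_compProd_const hτ h₁),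
    hqb.ae (rnDeriv_compProd_const hτ h₂)] with p hp e e1 e2 h0
  rw [e, e1, e2, ← hs, ← hsa, ← hsb]
  simp only [ENNReal.toReal_mul]
  rw [hp h0]
  ring

end ConditionalDensity

section ConditionalCdf
open Filter Topology
open scoped ENNReal

/-! ### Conditional distribution functions as h-functions -/

/-- This is the 2-increasing property of copulas; it is what permits squeezing between rational
levels. -/
lemma slope_copulaFun_mono {γ : Measure (ℝ × ℝ)} (hγ : IsCopulaMeasure γ) {u u' : ℝ}
    (hu : u ≤ u') (v w : ℝ) : slope (copulaFun γ u) v w ≤ slope (copulaFun γ u') v w := by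
  rw [slope_def_field, slope_def_field]
  rcases le_total v w with h | h
  · exact div_le_div_of_nonneg_right (copulaFun_sub_mono hγ hu h) (by linarith)
  · rw [← neg_div_neg_eq, ← neg_div_neg_eq (copulaFun γ u' w - _)]
    refine div_le_div_of_nonneg_right ?_ (by linarith)
    linarith [copulaFun_sub_mono hγ hu h]

/-- Differentiability of a copula at the levels `F q`, `q` rational, extends to the level `F y`
if the limiting law does not charge `y`. -/
lemma hasDerivAt_copulaFun_of_rat {γ : Measure (ℝ × ℝ)} (hγ : IsCopulaMeasure γ) {F : ℝ → ℝ}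
    (hF : Monotone F) {m : Measure ℝ} [IsProbabilityMeasure m] {v y : ℝ}
    (h : ∀ q : ℚ, HasDerivAt (copulaFun γ (F q)) (m.real (Iic (q : ℝ))) v) (hy : m {y} = 0) :
    HasDerivAt (copulaFun γ (F y)) (m.real (Iic y)) v := by
  have hy' : y ∉ discreteSupport m := notMem_discreteSupport.2 hy
  simp_rw [hasDerivAt_iff_tendsto_slope, ← cdf_eq_real] at h ⊢
  refine tendsto_order.2 ⟨fun a ha => ?_, fun b hb => ?_⟩
  · rw [← cdfLeft_eq_cdf hy'] at ha
    have h1 := (((monotone_cdf m).tendsto_leftLim y).eventually (eventually_gt_nhds ha)).and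
      self_mem_nhdsWithin
    obtain ⟨x, hx, hxy⟩ := h1.exists
    obtain ⟨q, hxq, hqy⟩ := exists_rat_btwn (show x < y from hxy)
    filter_upwards [(h q).eventually (eventually_gt_nhds (hx.trans_le (monotone_cdf m hxq.le)))]
      with w hw
    exact hw.trans_le (slope_copulaFun_mono hγ (hF hqy.le) v w)
  · have hright : Tendsto (cdf m) (𝓝[>] y) (𝓝 (cdf m y)) :=
      ((cdf m).right_continuous y).mono Ioi_subset_Ici_self
    obtain ⟨x, hx, hxy⟩ := ((hright.eventually (eventually_lt_nhds hb)).and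
      self_mem_nhdsWithin).exists
    obtain ⟨q, hyq, hqx⟩ := exists_rat_btwn (show y < x from hxy)
    filter_upwards [(h q).eventually (eventually_lt_nhds ((monotone_cdf m hqx.le).trans_lt hx))]
      with w hw
    exact (slope_copulaFun_mono hγ (hF hyq.le) v w).trans_lt hw

variable {F : Type*} [MeasurableSpace F]

/-- The law of ((T, B), A) is written in two ways over T, and disintegrations are almost surely
unique. -/
lemma ae_map_swap_eq_compProd {τ : Measure F} [IsProbabilityMeasure τ] {κ : Kernel F (ℝ × ℝ)}
    {κ₂ : Kernel F ℝ} [IsMarkovKernel κ] [IsMarkovKernel κ₂] {η : Kernel (F × ℝ) ℝ}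
    [IsMarkovKernel η] (h : (τ ⊗ₘ κ).map (fun p => ((p.1, p.2.2), p.2.1)) = (τ ⊗ₘ κ₂) ⊗ₘ η) :
    ∀ᵐ t ∂τ, (κ t).map Prod.swap = κ₂ t ⊗ₘ (η.sectR t) := by
  have key : τ ⊗ₘ (κ.map Prod.swap) = τ ⊗ₘ (κ₂ ⊗ₖ η) := by
    rw [← Measure.compProd_assoc', ← h, Measure.map_map (by fun_prop) (by fun_prop),
      Measure.compProd_map measurable_swap]
    rfl
  filter_upwards [Kernel.ae_eq_of_compProd_eq key] with t ht
  rw [Kernel.map_apply _ measurable_swap, Kernel.compProd_apply_eq_compProd_sectR] at ht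
  exact ht

/-- S contains all atoms the conditional laws may have. One null set serves all y in S and all
rational y, and any other y is uncharged, so the monotone squeeze between rationals applies to it.
-/
lemma ae_cdf_eq_genH12 {τ : Measure F} [IsProbabilityMeasure τ] {κ C : Kernel F (ℝ × ℝ)}
    {κ₁ κ₂ : Kernel F ℝ} [IsMarkovKernel κ] [IsFiniteKernel C] [IsMarkovKernel κ₁]
    [IsMarkovKernel κ₂] {η : Kernel (F × ℝ) ℝ} [IsMarkovKernel η]
    (hC : ∀ t, IsCopulaMeasure (C t))
    (hκ : ∀ᵐ t ∂τ, HasCopula (κ t) (C t) (κ₁ t) (κ₂ t))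
    (h : (τ ⊗ₘ κ).map (fun p => ((p.1, p.2.2), p.2.1)) = (τ ⊗ₘ κ₂) ⊗ₘ η)
    {S : Set ℝ} (hS : S.Countable) (hη : ∀ᵐ q ∂(τ ⊗ₘ κ₂), ∀ y ∉ S, η q {y} = 0) :
    ∀ᵐ q ∂(τ ⊗ₘ κ₂), ∀ y, cdf (η q) y = genH12 (C q.1) (κ₁ q.1) (κ₂ q.1) y q.2 := by
  have hdis := ae_map_swap_eq_compProd h
  have hfst {p : F → Prop} (hp : ∀ᵐ t ∂τ, p t) : ∀ᵐ q ∂(τ ⊗ₘ κ₂), p q.1 := by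
    refine ae_of_ae_map measurable_fst.aemeasurable ?_
    rwa [← Measure.fst, Measure.fst_compProd]
  have hderiv (y : ℝ) : ∀ᵐ q ∂(τ ⊗ₘ κ₂), q.2 ∉ discreteSupport (κ₂ q.1) →
      HasDerivAt (copulaFun (C q.1) (cdf (κ₁ q.1) y)) ((η q).real (Iic y))
        (cdf (κ₂ q.1) q.2) := by
    refine Measure.ae_compProd_of_ae_ae ?_ ?_
    · have hm : Measurable fun q : F × ℝ => ((q.1, cdf (κ₁ q.1) y), cdf (κ₂ q.1) q.2) := by
        have h1 : Measurable fun q : F × ℝ => cdf (κ₁ q.1) y :=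
          (measurable_cdf_kernel κ₁).comp (measurable_fst.prodMk measurable_const)
        exact (measurable_fst.prodMk h1).prodMk (measurable_cdf_kernel κ₂)
      have hd := hm (measurableSet_differentiableAt_copulaFun C hC)
      have he : MeasurableSet {q : F × ℝ | copulaDerivSnd (C q.1) (cdf (κ₁ q.1) y)
          (cdf (κ₂ q.1) q.2) = (η q).real (Iic y)} :=
        measurableSet_eq_fun ((measurable_copulaDerivSnd_kernel C hC).comp hm)
          (Kernel.measurable_coe η measurableSet_Iic).ennreal_toReal
      convert (measurableSet_discreteSupport_kernel κ₂).union (hd.inter he) using 1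
      ext q
      simp only [mem_ofPred_eq, mem_union, mem_inter_iff, mem_preimage, imp_iff_not_or, not_not]
      refine or_congr Iff.rfl ⟨fun h => ⟨h.differentiableAt, h.deriv⟩, fun h => ?_⟩
      rw [← h.2]
      exact h.1.hasDerivAt
    · filter_upwards [hκ, hdis] with t ht ht'
      exact ht.ae_hasDerivAt (hC t) ht' y
  have hcount : ∀ᵐ q ∂(τ ⊗ₘ κ₂), ∀ y ∈ S ∪ range ((↑) : ℚ → ℝ),
      q.2 ∉ discreteSupport (κ₂ q.1) →
      HasDerivAt (copulaFun (C q.1) (cdf (κ₁ q.1) y)) ((η q).real (Iic y))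
        (cdf (κ₂ q.1) q.2) :=
    (ae_ball_iff (hS.union (countable_range _))).2 fun y _ => hderiv y
  filter_upwards [hcount, hη, hfst hκ, hfst hdis] with q hq hqη hqκ hqd y
  by_cases hz : q.2 ∈ discreteSupport (κ₂ q.1)
  · rw [hqκ.genH12_of_mem (hC q.1) hqd hz, cdf_eq_real, Kernel.sectR_apply]
  · rw [genH12, if_neg hz, cdf_eq_real]
    symm
    by_cases hy : y ∈ S
    · exact (hq y (.inl hy) hz).deriv
    · exact (hasDerivAt_copulaFun_of_rat (hC q.1) (monotone_cdf (κ₁ q.1))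
        (fun r => hq r (.inr (mem_range_self r)) hz) (hqη y hy)).deriv

end ConditionalCdf

section ProductReference
open Filter Topology
open scoped ENNReal

/-! ### Densities with respect to product measures -/

lemma lintegral_fin_prod_eq_prod {n : ℕ} (μ : Fin n → Measure ℝ) [∀ i, SigmaFinite (μ i)]
    (f : Fin n → ℝ → ℝ≥0∞) (hf : ∀ i, Measurable (f i)) :
    ∫⁻ x, ∏ i, f i (x i) ∂(Measure.pi μ) = ∏ i, ∫⁻ y, f i y ∂(μ i) := by
  induction n with
  | zero => simp
  | succ n ih =>
    have hmp := (measurePreserving_piFinSuccAbove μ 0).symm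
    have hm : Measurable fun x : Fin (n + 1) → ℝ => ∏ i, f i (x i) :=
      Finset.measurable_prod _ fun i _ => (hf i).comp (measurable_pi_apply i)
    rw [← hmp.lintegral_comp hm]
    simp_rw [MeasurableEquiv.piFinSuccAbove_symm_apply, Fin.insertNthEquiv,
      Fin.prod_univ_succ, Fin.insertNth_zero]
    simp only [Fin.zero_succAbove, Equiv.coe_fn_mk, Fin.cons_succ, Fin.cons_zero, cast_eq]
    have h2 : Measurable fun x : Fin n → ℝ => ∏ i : Fin n, f i.succ (x i) :=
      Finset.measurable_prod _ fun i _ => (hf i.succ).comp (measurable_pi_apply i)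
    rw [lintegral_prod_mul (hf 0).aemeasurable h2.aemeasurable,
      ih (fun i => μ i.succ) (fun i => f i.succ) fun i => hf i.succ]

lemma pi_withDensity {n : ℕ} (ν μ : Fin n → Measure ℝ) [∀ i, SigmaFinite (ν i)]
    [∀ i, SigmaFinite (μ i)] (f : Fin n → ℝ → ℝ≥0∞) (hf : ∀ i, Measurable (f i))
    (h : ∀ i, μ i = (ν i).withDensity (f i)) :
    Measure.pi μ = (Measure.pi ν).withDensity fun x => ∏ i, f i (x i) := by
  refine Measure.pi_eq fun s hs => ?_
  rw [withDensity_apply _ (.univ_pi hs), ← lintegral_indicator (.univ_pi hs)]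
  have : ∀ x : Fin n → ℝ, (univ.pi s).indicator (fun x => ∏ i, f i (x i)) x =
      ∏ i, (s i).indicator (f i) (x i) := by
    intro x
    by_cases hx : x ∈ univ.pi s
    · rw [indicator_of_mem hx]
      exact Finset.prod_congr rfl fun i _ => (indicator_of_mem (hx i (mem_univ i)) _).symm
    · rw [indicator_of_notMem hx]
      obtain ⟨i, hi⟩ : ∃ i, x i ∉ s i := by simpa [Set.mem_pi] using hx
      exact (Finset.prod_eq_zero (Finset.mem_univ i) (indicator_of_notMem hi _)).symm
  simp_rw [this]
  rw [lintegral_fin_prod_eq_prod ν _ fun i => (hf i).indicator (hs i)]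
  refine Finset.prod_congr rfl fun i _ => ?_
  rw [lintegral_indicator (hs i), h i, withDensity_apply _ (hs i)]

/-- A law that has a density with respect to a product measure has a density with respect to
the product of its margins. -/
lemma absolutelyContinuous_pi_margins {n : ℕ} {Q : Measure (Fin n → ℝ)}
    {ν μ : Fin n → Measure ℝ} [∀ i, SigmaFinite (ν i)] [∀ i, SigmaFinite (μ i)]
    {f : Fin n → ℝ → ℝ≥0∞} (hf : ∀ i, Measurable (f i))
    (h : ∀ i, μ i = (ν i).withDensity (f i)) (hμ : ∀ i, Q.map (fun x => x i) = μ i)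
    (hQ : Q ≪ Measure.pi ν) : Q ≪ Measure.pi μ := by
  have hpos : ∀ᵐ x ∂Q, ∀ i, f i (x i) ≠ 0 := by
    refine ae_all_iff.2 fun i => ae_of_ae_map
      (f := fun x : Fin n → ℝ => x i) (measurable_pi_apply i).aemeasurable (p := fun y => f i y ≠ 0) ?_
    rw [hμ, h, ae_withDensity_iff (hf i)]
    exact .of_forall fun _ h => h
  have hm : Measurable fun x : Fin n → ℝ => ∏ i, f i (x i) :=
    Finset.measurable_prod _ fun i _ => (hf i).comp (measurable_pi_apply i)
  intro N hN
  rw [measure_eq_zero_iff_ae_notMem] at hN ⊢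
  rw [pi_withDensity ν μ f hf h, ae_withDensity_iff hm] at hN
  filter_upwards [hQ.ae_le hN, hpos] with x hx hxp
  exact hx (Finset.prod_ne_zero_iff.2 fun i _ => hxp i)

/-! ### Densities of images of two laws under a common map -/

section MapDensity

variable {E F G : Type*} [MeasurableSpace E] [MeasurableSpace F] [MeasurableSpace G]
  {Q M : Measure E} [IsProbabilityMeasure Q] [IsProbabilityMeasure M]

/-- The density of the law of `T` under `Q` with respect to its law under `M`, as a function of
the sample point. -/
noncomputable def mapDensity (Q M : Measure E) (T : E → F) (x : E) : ℝ≥0∞ :=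
  (Q.map T).rnDeriv (M.map T) (T x)

lemma mapDensity_lt_top {T : E → F} (hT : Measurable T) : ∀ᵐ x ∂M, mapDensity Q M T x < ∞ := by
  have := Measure.isProbabilityMeasure_map (μ := M) hT.aemeasurable
  exact ae_of_ae_map hT.aemeasurable ((Q.map T).rnDeriv_lt_top (M.map T))

/-- Maps that are functions of each other generate the same σ-algebra, and the density at the sample
point depends only on that. -/
lemma mapDensity_congr (hQ : Q ≪ M) {T₁ : E → F} {T₂ : E → G} {ψ : G → F} {φ : F → G}
    (hT₁ : Measurable T₁) (hφ : Measurable φ) (hψ : Measurable ψ)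
    (h₁ : ∀ x, φ (T₁ x) = T₂ x) (h₂ : ∀ x, ψ (T₂ x) = T₁ x) :
    mapDensity Q M T₁ =ᵐ[M] mapDensity Q M T₂ := by
  have hT₂ : Measurable T₂ := by
    rw [show T₂ = φ ∘ T₁ from funext fun x => (h₁ x).symm]; exact hφ.comp hT₁
  have := Measure.isProbabilityMeasure_map (μ := M) hT₁.aemeasurable
  have := Measure.isProbabilityMeasure_map (μ := Q) hT₁.aemeasurable
  have := Measure.isProbabilityMeasure_map (μ := M) hT₂.aemeasurable
  have hr : Measurable ((Q.map T₁).rnDeriv (M.map T₁)) := Measure.measurable_rnDeriv _ _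
  have key : Q.map T₂ = (M.map T₂).withDensity ((Q.map T₁).rnDeriv (M.map T₁) ∘ ψ) := by
    ext A hA
    rw [withDensity_apply _ hA, setLIntegral_map hA (hr.comp hψ) hT₂]
    have hpre : T₂ ⁻¹' A = T₁ ⁻¹' (φ ⁻¹' A) := by ext x; simp [h₁]
    have : ∫⁻ x in T₂ ⁻¹' A, ((Q.map T₁).rnDeriv (M.map T₁) ∘ ψ) (T₂ x) ∂M =
        ∫⁻ x in T₁ ⁻¹' (φ ⁻¹' A), (Q.map T₁).rnDeriv (M.map T₁) (T₁ x) ∂M := by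
      rw [hpre]; simp [h₂]
    rw [this, ← setLIntegral_map (hφ hA) hr hT₁, ← withDensity_apply _ (hφ hA),
      Measure.withDensity_rnDeriv_eq _ _ (hQ.map hT₁), Measure.map_apply hT₂ hA,
      Measure.map_apply hT₁ (hφ hA), hpre]
  have h3 := Measure.rnDeriv_withDensity (M.map T₂) (hr.comp hψ)
  rw [← key] at h3
  filter_upwards [ae_of_ae_map hT₂.aemeasurable h3] with x hx
  rw [mapDensity, mapDensity, hx, Function.comp, h₂]

/-- The density of the coarser map is positive Q-almost surely, so Q does not charge its zero set
and the finer density must vanish there too. This handles the zeros of densities along a vine. -/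
lemma mapDensity_eq_zero (hQ : Q ≪ M) {T₁ : E → F} {T₂ : E → G} {ψ : G → F}
    (hT₂ : Measurable T₂) (hψ : Measurable ψ) (h₂ : ∀ x, ψ (T₂ x) = T₁ x) :
    ∀ᵐ x ∂M, mapDensity Q M T₁ x = 0 → mapDensity Q M T₂ x = 0 := by
  have hT₁ : Measurable T₁ := by
    rw [show T₁ = ψ ∘ T₂ from funext fun x => (h₂ x).symm]; exact hψ.comp hT₂
  have := Measure.isProbabilityMeasure_map (μ := M) hT₁.aemeasurable
  have := Measure.isProbabilityMeasure_map (μ := Q) hT₁.aemeasurable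
  have := Measure.isProbabilityMeasure_map (μ := M) hT₂.aemeasurable
  have := Measure.isProbabilityMeasure_map (μ := Q) hT₂.aemeasurable
  have hr : Measurable ((Q.map T₁).rnDeriv (M.map T₁)) := Measure.measurable_rnDeriv _ _
  have h1 : ∀ᵐ y ∂(Q.map T₁), (Q.map T₁).rnDeriv (M.map T₁) y ≠ 0 := by
    filter_upwards [Measure.rnDeriv_pos (hQ.map hT₁)] with y hy using hy.ne'
  have h2 : ∀ᵐ z ∂(Q.map T₂), (Q.map T₁).rnDeriv (M.map T₁) (ψ z) ≠ 0 := by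
    have hset : MeasurableSet {z | (Q.map T₁).rnDeriv (M.map T₁) (ψ z) ≠ 0} :=
      ((hr.comp hψ) (measurableSet_singleton 0)).compl
    rw [ae_map_iff hT₂.aemeasurable hset]
    simp only [h₂]
    exact ae_of_ae_map hT₁.aemeasurable h1
  rw [← Measure.withDensity_rnDeriv_eq _ _ (hQ.map hT₂), ae_withDensity_iff
    (Measure.measurable_rnDeriv _ _)] at h2
  filter_upwards [ae_of_ae_map hT₂.aemeasurable h2] with x hx h0
  by_contra h
  exact hx h (by rw [h₂]; exact h0)

end MapDensity
end ProductReference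

section CoordinateMaps
open Filter Topology
open scoped ENNReal

/-! ### Subvectors -/

/-- The vector on `U` that is `t` on `D` and `z` elsewhere. -/
def extendVector {d : ℕ} (D U : Finset (Fin d)) (p : (D → ℝ) × ℝ) : U → ℝ :=
  fun i => if h : (i : Fin d) ∈ D then p.1 ⟨i, h⟩ else p.2

lemma measurable_extendVector {d : ℕ} (D U : Finset (Fin d)) :
    Measurable (extendVector D U) := by
  refine measurable_pi_lambda _ fun i => ?_
  unfold extendVector
  by_cases h : (i : Fin d) ∈ D
  · simp only [h, dif_pos]
    exact (measurable_pi_apply _).comp measurable_fst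
  · simp only [h, dif_neg, not_false_iff]
    exact measurable_snd

lemma extendVector_restrict {d : ℕ} {D U : Finset (Fin d)} {a : Fin d} (hU : U ⊆ insert a D)
    (x : Fin d → ℝ) : extendVector D U (D.restrict x, x a) = U.restrict x := by
  funext i
  unfold extendVector
  by_cases h : (i : Fin d) ∈ D
  · simp [h]
  · have : (i : Fin d) = a := (Finset.mem_insert.1 (hU i.2)).resolve_right h
    simp [this]

section Independence

variable {d : ℕ} (μ : Fin d → Measure ℝ) [∀ i, IsProbabilityMeasure (μ i)]

lemma iIndepFun_eval : iIndepFun (fun i (x : Fin d → ℝ) => x i) (Measure.pi μ) :=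
  iIndepFun_pi (X := fun _ y => y) fun _ => aemeasurable_id

lemma pi_map_apply (a : Fin d) : (Measure.pi μ).map (fun x => x a) = μ a :=
  (measurePreserving_eval μ a).map_eq

lemma pi_map_restrict_prod {D : Finset (Fin d)} {a : Fin d} (ha : a ∉ D) :
    (Measure.pi μ).map (fun x => (D.restrict x, x a)) =
      ((Measure.pi μ).map D.restrict).prod (μ a) := by
  have h1 := (iIndepFun_eval μ).indepFun_finset D {a} (by simpa using ha)
    fun i => measurable_pi_apply i
  have h2 : IndepFun D.restrict (fun x : Fin d → ℝ => x a) (Measure.pi μ) :=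
    h1.comp measurable_id (measurable_pi_apply (⟨a, by simp⟩ : ({a} : Finset (Fin d))))
  rw [(indepFun_iff_map_prod_eq_prod_map_map (by fun_prop)
    (measurable_pi_apply a).aemeasurable).1 h2, pi_map_apply]

lemma pi_map_restrict_prod_prod {D : Finset (Fin d)} {a b : Fin d} (ha : a ∉ D) (hb : b ∉ D)
    (hab : a ≠ b) :
    (Measure.pi μ).map (fun x => (D.restrict x, x a, x b)) =
      ((Measure.pi μ).map D.restrict).prod ((μ a).prod (μ b)) := by
  have h1 := (iIndepFun_eval μ).indepFun_finset D {a, b} (by simp [ha, hb])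
    fun i => measurable_pi_apply i
  have h2 : IndepFun D.restrict (fun x : Fin d → ℝ => (x a, x b)) (Measure.pi μ) :=
    h1.comp measurable_id
      ((measurable_pi_apply (⟨a, by simp⟩ : ({a, b} : Finset (Fin d)))).prodMk
        (measurable_pi_apply (⟨b, by simp⟩ : ({a, b} : Finset (Fin d)))))
  have h3 := (iIndepFun_eval μ).indepFun hab
  rw [(indepFun_iff_map_prod_eq_prod_map_map (by fun_prop) (by fun_prop)).1 h2,
    (indepFun_iff_map_prod_eq_prod_map_map (measurable_pi_apply a).aemeasurable
      (measurable_pi_apply b).aemeasurable).1 h3,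
    pi_map_apply, pi_map_apply]

end Independence

/-! ### Densities of subvectors -/

section MarginalDensity

variable {d : ℕ} {Q M : Measure (Fin d → ℝ)} [IsProbabilityMeasure Q] [IsProbabilityMeasure M]

/-- The density of the subvector with indices in `U`, as a function of the full vector. -/
noncomputable def marginDensity (Q M : Measure (Fin d → ℝ)) (U : Finset (Fin d))
    (x : Fin d → ℝ) : ℝ≥0∞ := mapDensity Q M U.restrict x

lemma marginDensity_eq_zero (hQ : Q ≪ M) {U V : Finset (Fin d)} (h : U ⊆ V) :
    ∀ᵐ x ∂M, marginDensity Q M U x = 0 → marginDensity Q M V x = 0 :=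
  mapDensity_eq_zero (T₁ := U.restrict) (T₂ := V.restrict)
    (ψ := fun (t : V → ℝ) (i : U) => t ⟨i, h i.2⟩) hQ (Finset.measurable_restrict V)
    (by fun_prop) fun _ => rfl

lemma mapDensity_prod_eq (hQ : Q ≪ M) (D : Finset (Fin d)) (a : Fin d) :
    mapDensity Q M (fun x => (D.restrict x, x a)) =ᵐ[M] marginDensity Q M (insert a D) := by
  refine mapDensity_congr hQ (φ := extendVector D (insert a D))
    (ψ := fun t => (fun i => t ⟨i, Finset.mem_insert_of_mem i.2⟩,
      t ⟨a, Finset.mem_insert_self a D⟩)) (by fun_prop) (measurable_extendVector _ _)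
    (by fun_prop) (extendVector_restrict subset_rfl) fun x => rfl

lemma mapDensity_prod_prod_eq (hQ : Q ≪ M) (D : Finset (Fin d)) (a b : Fin d) :
    mapDensity Q M (fun x => (D.restrict x, x a, x b)) =ᵐ[M]
      marginDensity Q M (insert a (insert b D)) := by
  refine mapDensity_congr hQ
    (φ := fun p => extendVector (insert b D) (insert a (insert b D))
      (extendVector D (insert b D) (p.1, p.2.2), p.2.1))
    (ψ := fun t => (fun i => t ⟨i, Finset.mem_insert_of_mem (Finset.mem_insert_of_mem i.2)⟩,
      t ⟨a, Finset.mem_insert_self a _⟩,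
      t ⟨b, Finset.mem_insert_of_mem (Finset.mem_insert_self b D)⟩)) (by fun_prop)
    ?_ (by fun_prop) (fun x => ?_) fun x => rfl
  · refine (measurable_extendVector _ _).comp (Measurable.prodMk ?_ (by fun_prop))
    exact (measurable_extendVector _ _).comp (by fun_prop)
  · rw [extendVector_restrict subset_rfl, extendVector_restrict subset_rfl]

end MarginalDensity

/-! ### Conditional copulas of a random vector -/

section RandomVectors

variable {Ω : Type*} [MeasurableSpace Ω] (P : Measure Ω) [IsProbabilityMeasure P] {d : ℕ}
  {X : Fin d → Ω → ℝ}

/-- The product of the margins of `X`. -/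
noncomputable abbrev productLaw (X : Fin d → Ω → ℝ) : Measure (Fin d → ℝ) :=
  Measure.pi fun i => P.map (X i)

lemma isProbabilityMeasure_margin (hX : ∀ i, Measurable (X i)) (i : Fin d) :
    IsProbabilityMeasure (P.map (X i)) :=
  Measure.isProbabilityMeasure_map (hX i).aemeasurable

lemma measurable_subvector (hX : ∀ i, Measurable (X i)) (D : Finset (Fin d)) :
    Measurable (subvector X D) := measurable_pi_lambda _ fun i => hX i

variable {P}

lemma IsCondCopula.isMarkovKernel {i j : Fin d} {D : Finset (Fin d)}
    {C : Kernel (D → ℝ) (ℝ × ℝ)} (h : IsCondCopula P X i j D C) : IsMarkovKernel C :=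
  ⟨fun t => (h.uniform_margins t).isProbabilityMeasure⟩

lemma IsCondCopula.ae_hasCopula {i j : Fin d} {D : Finset (Fin d)}
    {C : Kernel (D → ℝ) (ℝ × ℝ)} (h : IsCondCopula P X i j D C) :
    ∀ᵐ t ∂(P.map (subvector X D)),
      HasCopula (condDistrib (fun ω => (X i ω, X j ω)) (subvector X D) P t) (C t)
        (condLaw P X i D t) (condLaw P X j D t) := by
  filter_upwards [h.sklar] with t ht
  exact hasCopula_of_cdf (h.uniform_margins t) ht

/-- The pair-copula decomposition of the density of a subvector. -/
lemma ae_marginDensity_mul_eq (hX : ∀ i, Measurable (X i))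
    (hQ : P.map (fun ω i => X i ω) ≪ productLaw P X) {D : Finset (Fin d)} {a b : Fin d}
    (ha : a ∉ D) (hb : b ∉ D) (hab : a ≠ b) {C : Kernel (D → ℝ) (ℝ × ℝ)}
    (hC : IsCondCopula P X a b D C) :
    ∀ᵐ x ∂(productLaw P X),
      marginDensity (P.map fun ω i => X i ω) (productLaw P X) D x ≠ 0 →
      (marginDensity (P.map fun ω i => X i ω) (productLaw P X)
          (insert a (insert b D)) x).toReal *
        (marginDensity (P.map fun ω i => X i ω) (productLaw P X) D x).toReal =
      genCopulaDensity (C (D.restrict x)) (copulaDensity C (D.restrict x))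
          (condLaw P X a D (D.restrict x)) (condLaw P X b D (D.restrict x)) (x a) (x b) *
        (marginDensity (P.map fun ω i => X i ω) (productLaw P X) (insert a D) x).toReal *
        (marginDensity (P.map fun ω i => X i ω) (productLaw P X) (insert b D) x).toReal := by
  have := isProbabilityMeasure_margin P hX
  have hXm : Measurable fun ω i => X i ω := measurable_pi_lambda _ hX
  have := hC.isMarkovKernel
  set Q := P.map fun ω i => X i ω with hQdef
  set M := productLaw P X with hM
  have : IsProbabilityMeasure Q := Measure.isProbabilityMeasure_map hXm.aemeasurable
  have hD := measurable_subvector hX D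
  have hτ : P.map (subvector X D) = Q.map D.restrict :=
    (Measure.map_map (Finset.measurable_restrict D) hXm).symm
  have hpair : P.map (subvector X D) ⊗ₘ condDistrib (fun ω => (X a ω, X b ω)) (subvector X D) P
      = Q.map fun x => (D.restrict x, x a, x b) := by
    rw [compProd_map_condDistrib (by fun_prop), hQdef, Measure.map_map (by fun_prop) hXm]
    rfl
  have hsingle (c : Fin d) : P.map (subvector X D) ⊗ₘ condDistrib (X c) (subvector X D) P
      = Q.map fun x => (D.restrict x, x c) := by
    rw [compProd_map_condDistrib (hX c).aemeasurable, hQdef, Measure.map_map (by fun_prop) hXm]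
    rfl
  have hMpair : (M.map D.restrict).prod ((P.map (X a)).prod (P.map (X b))) =
      M.map fun x => (D.restrict x, x a, x b) :=
    (pi_map_restrict_prod_prod (fun i => P.map (X i)) ha hb hab).symm
  have hMsingle {c : Fin d} (hc : c ∉ D) : (M.map D.restrict).prod (P.map (X c)) =
      M.map fun x => (D.restrict x, x c) :=
    (pi_map_restrict_prod (fun i => P.map (X i)) hc).symm
  have : IsProbabilityMeasure (M.map D.restrict) :=
    Measure.isProbabilityMeasure_map (Finset.measurable_restrict D).aemeasurable
  have : IsProbabilityMeasure (P.map (subvector X D)) :=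
    Measure.isProbabilityMeasure_map hD.aemeasurable
  have key := ae_rnDeriv_mul_eq_genCopulaDensity (m := M.map D.restrict)
    (πa := P.map (X a)) (πb := P.map (X b)) hC.uniform_margins hC.ae_hasCopula
    (κ₁ := condDistrib (X a) (subvector X D) P) (κ₂ := condDistrib (X b) (subvector X D) P)
    (by rw [hτ]; exact hQ.map (by fun_prop))
    (by rw [hpair, hMpair]; exact hQ.map (by fun_prop))
    (by rw [hsingle, hMsingle ha]; exact hQ.map (by fun_prop))
    (by rw [hsingle, hMsingle hb]; exact hQ.map (by fun_prop))
  rw [hpair, hsingle, hsingle, hMsingle ha, hMsingle hb, hMpair, hτ] at key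
  have hT : Measurable fun x : Fin d → ℝ => (D.restrict x, x a, x b) := by fun_prop
  filter_upwards [ae_of_ae_map hT.aemeasurable key, mapDensity_prod_eq hQ D a,
    mapDensity_prod_eq hQ D b, mapDensity_prod_prod_eq hQ D a b] with x hx e1 e2 e3 h0
  rw [← e1, ← e2, ← e3]
  exact hx h0

/-- Relabels the conditioning variable; used to read a kernel in X_D as a kernel in the pair formed
by X_{D∖r} and X_r. -/
lemma compProd_map_comap {α β : Type*} [MeasurableSpace α] [MeasurableSpace β] {m : Measure α}
    [SFinite m] {k : Kernel α ℝ} [IsSFiniteKernel k] {φ : α → β} {ψ : β → α} (hφ : Measurable φ)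
    (hψ : Measurable ψ) (h : ∀ x, ψ (φ x) = x) :
    (m.map φ) ⊗ₘ (k.comap ψ hψ) = (m ⊗ₘ k).map (Prod.map φ id) := by
  ext E hE
  rw [Measure.compProd_apply hE, lintegral_map (Kernel.measurable_kernel_prodMk_left hE) hφ,
    Measure.map_apply (hφ.prodMap measurable_id) hE,
    Measure.compProd_apply ((hφ.prodMap measurable_id) hE)]
  refine lintegral_congr fun x => ?_
  rw [Kernel.comap_apply, h]
  rfl

/-- The conditional distribution function given `X_D` is an h-function of the conditional
distribution functions given `X_D` without one coordinate. -/
lemma IsCondCopula.ae_cdf_eq_genH12 (hX : ∀ i, Measurable (X i))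
    (hQ : P.map (fun ω i => X i ω) ≪ productLaw P X) {D : Finset (Fin d)} {j r : Fin d}
    (hj : j ∉ D) (hr : r ∈ D) {C : Kernel (↥(D.erase r) → ℝ) (ℝ × ℝ)}
    (hC : IsCondCopula P X j r (D.erase r) C) :
    ∀ᵐ xD ∂(P.map (subvector X D)), ∀ y : ℝ,
      cdf (condLaw P X j D xD) y =
        genH12 (C (dropCoord r xD)) (condLaw P X j (D.erase r) (dropCoord r xD))
          (condLaw P X r (D.erase r) (dropCoord r xD)) y (xD ⟨r, hr⟩) := by
  have := isProbabilityMeasure_margin P hX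
  have hXm : Measurable fun ω i => X i ω := measurable_pi_lambda _ hX
  have := hC.isMarkovKernel
  have hD := measurable_subvector hX D
  have hD' := measurable_subvector hX (D.erase r)
  have : IsProbabilityMeasure (P.map (subvector X D)) :=
    Measure.isProbabilityMeasure_map hD.aemeasurable
  have : IsProbabilityMeasure (P.map (subvector X (D.erase r))) :=
    Measure.isProbabilityMeasure_map hD'.aemeasurable
  set φ : (D → ℝ) → (↥(D.erase r) → ℝ) × ℝ := fun xD => (dropCoord r xD, xD ⟨r, hr⟩) with hφ
  have hφm : Measurable φ := by
    refine Measurable.prodMk (measurable_pi_lambda _ fun i => ?_) (measurable_pi_apply _)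
    exact measurable_pi_apply _
  set ψ := extendVector (D.erase r) D with hψ
  have hψm : Measurable ψ := measurable_extendVector _ _
  have hψφ (xD : D → ℝ) : ψ (φ xD) = xD := by
    funext i
    by_cases h : (i : Fin d) ∈ D.erase r
    · simp [hψ, hφ, extendVector, h, dropCoord]
    · have hi : i = ⟨r, hr⟩ := by
        ext
        by_contra hne
        exact h (Finset.mem_erase.2 ⟨fun h' => hne (congrArg _ h'), i.2⟩)
      simp [hψ, hφ, extendVector, hi]
  set k := condDistrib (X j) (subvector X D) P with hk
  set κ₂ := condDistrib (X r) (subvector X (D.erase r)) P with hκ₂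
  have hτκ : P.map (subvector X (D.erase r)) ⊗ₘ κ₂ = (P.map (subvector X D)).map φ := by
    rw [hκ₂, compProd_map_condDistrib (hX r).aemeasurable, Measure.map_map hφm hD]
    rfl
  have hlaw : (P.map (subvector X (D.erase r)) ⊗ₘ κ₂) ⊗ₘ (k.comap ψ hψm) =
      (P.map fun ω => (subvector X D ω, X j ω)).map (Prod.map φ id) := by
    rw [hτκ, compProd_map_comap hφm hψm hψφ, hk, compProd_map_condDistrib (hX j).aemeasurable]
  have hη : ∀ᵐ q ∂(P.map (subvector X (D.erase r)) ⊗ₘ κ₂),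
      ∀ y ∉ discreteSupport (P.map (X j)), k.comap ψ hψm q {y} = 0 := by
    -- Absolute continuity with respect to the product of the margins makes almost every conditional
    -- law of X_j absolutely continuous with respect to the law of X_j, so it has no new atoms.
    have hac : (P.map (subvector X (D.erase r)) ⊗ₘ κ₂) ⊗ₘ (k.comap ψ hψm) ≪
        (((productLaw P X).map D.restrict).map φ) ⊗ₘ Kernel.const _ (P.map (X j)) := by
      rw [hlaw, Measure.compProd_const]
      have e1 : P.map (fun ω => (subvector X D ω, X j ω)) =
          (P.map fun ω i => X i ω).map fun x => (D.restrict x, x j) := by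
        rw [Measure.map_map (by fun_prop) hXm]
        rfl
      have e2 : ((productLaw P X).map fun x => (D.restrict x, x j)).map (Prod.map φ id) =
          (((productLaw P X).map D.restrict).map φ).prod (P.map (X j)) := by
        rw [pi_map_restrict_prod (fun i => P.map (X i)) hj, ← Measure.map_prod_map _ _ hφm
          measurable_id, Measure.map_id]
      rw [e1, ← e2]
      exact (hQ.map (by fun_prop)).map (hφm.prodMap measurable_id)
    filter_upwards [hac.kernel_of_compProd] with q hq y hy
    exact hq (notMem_discreteSupport.1 hy)
  have key := _root_.ae_cdf_eq_genH12 hC.uniform_margins hC.ae_hasCopula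
    (κ₁ := condDistrib (X j) (subvector X (D.erase r)) P) (η := k.comap ψ hψm) (κ₂ := κ₂) (by
      rw [hlaw, compProd_map_condDistrib (by fun_prop), Measure.map_map (by fun_prop)
        (by fun_prop), Measure.map_map (hφm.prodMap measurable_id) (by fun_prop)]
      rfl) (countable_discreteSupport (P.map (X j))) hη
  rw [hτκ] at key
  filter_upwards [ae_of_ae_map hφm.aemeasurable key] with xD hxD y
  have := hxD y
  rw [Kernel.comap_apply, hψφ] at this
  exact this

lemma IsCondCopula.swap (hX : ∀ i, Measurable (X i)) {i j : Fin d} {D : Finset (Fin d)}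
    {C : Kernel (D → ℝ) (ℝ × ℝ)} (h : IsCondCopula P X i j D C) :
    IsCondCopula P X j i D (C.map Prod.swap) := by
  constructor
  · intro t
    rw [Kernel.map_apply _ measurable_swap]
    exact (h.uniform_margins t).swap
  · have e : condDistrib (fun ω => (X j ω, X i ω)) (subvector X D) P
        =ᵐ[P.map (subvector X D)]
        (condDistrib (fun ω => (X i ω, X j ω)) (subvector X D) P).map Prod.swap :=
      condDistrib_comp (Y := fun ω => (X i ω, X j ω)) (subvector X D) (by fun_prop)
        measurable_swap
    filter_upwards [h.sklar, e] with t ht he y z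
    rw [Kernel.map_apply _ measurable_swap, copulaFun_map_swap, ← ht z y, condJointCDF,
      condJointCDF, measureReal_def, measureReal_def, he, Kernel.map_apply' _ measurable_swap _
      (measurableSet_Iic.prod measurableSet_Iic), preimage_swap_prod]

lemma IsCondCopula.ae_cdf_eq_genH21 (hX : ∀ i, Measurable (X i))
    (hQ : P.map (fun ω i => X i ω) ≪ productLaw P X) {D : Finset (Fin d)} {j r : Fin d}
    (hj : j ∉ D) (hr : r ∈ D) {C : Kernel (↥(D.erase r) → ℝ) (ℝ × ℝ)}
    (hC : IsCondCopula P X r j (D.erase r) C) :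
    ∀ᵐ xD ∂(P.map (subvector X D)), ∀ y : ℝ,
      cdf (condLaw P X j D xD) y =
        genH21 (C (dropCoord r xD)) (condLaw P X r (D.erase r) (dropCoord r xD))
          (condLaw P X j (D.erase r) (dropCoord r xD)) (xD ⟨r, hr⟩) y := by
  filter_upwards [(hC.swap hX).ae_cdf_eq_genH12 hX hQ hj hr] with xD h y
  rw [h y, Kernel.map_apply _ measurable_swap, genH12_map_swap]

end RandomVectors
end CoordinateMaps

section EdgeSets

/-! ### Trees given by their edge sets -/

/-- The graph on `N` whose edges are the pairs in `E`. -/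
def pairGraph {α : Type*} (N : Set α) (E : Finset (Sym2 α)) : SimpleGraph N where
  Adj u v := u ≠ v ∧ s((u : α), (v : α)) ∈ E
  symm := ⟨fun u v h => ⟨h.1.symm, by rw [Sym2.eq_swap]; exact h.2⟩⟩
  loopless := ⟨fun _ h => h.1 rfl⟩

variable {α : Type*} {N : Finset α} {E : Finset (Sym2 α)}

open scoped Classical in
lemma image_edgeFinset_pairGraph (hE : ∀ e ∈ E, ¬ e.IsDiag ∧ ∀ v ∈ e, v ∈ N) :
    (pairGraph (N : Set α) E).edgeFinset.image (Sym2.map Subtype.val) = E := by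
  ext e
  simp only [Finset.mem_image, SimpleGraph.mem_edgeFinset]
  constructor
  · rintro ⟨e', he', rfl⟩
    induction e' with
    | _ u v => exact he'.2
  · intro he
    have h := hE e he
    induction e with
    | _ u v =>
      refine ⟨s(⟨u, h.2 u (by simp)⟩, ⟨v, h.2 v (by simp)⟩), ⟨?_, he⟩, by simp⟩
      intro h'
      exact h.1 (by simpa using congrArg Subtype.val h')

open scoped Classical in
lemma card_edgeFinset_pairGraph (hE : ∀ e ∈ E, ¬ e.IsDiag ∧ ∀ v ∈ e, v ∈ N) :
    (pairGraph (N : Set α) E).edgeFinset.card = E.card := by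
  conv_rhs => rw [← image_edgeFinset_pairGraph hE]
  exact (Finset.card_image_of_injective _ (Sym2.map.injective Subtype.val_injective)).symm

lemma card_add_one_eq_of_isTree (hE : ∀ e ∈ E, ¬ e.IsDiag ∧ ∀ v ∈ e, v ∈ N)
    (hT : (pairGraph (N : Set α) E).IsTree) : E.card + 1 = N.card := by
  classical
  rw [← card_edgeFinset_pairGraph hE, hT.card_edgeFinset]
  simp

/-- A forest extends to a spanning tree of the complete graph, which has one edge fewer than nodes.
-/
lemma card_add_one_le_of_isAcyclic (hN : N.Nonempty)
    (hE : ∀ e ∈ E, ¬ e.IsDiag ∧ ∀ v ∈ e, v ∈ N)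
    (hT : (pairGraph (N : Set α) E).IsAcyclic) : E.card + 1 ≤ N.card := by
  classical
  have : Nonempty (N : Set α) := hN.to_subtype
  obtain ⟨T, hle, -, hT'⟩ := (SimpleGraph.connected_top
    (V := (N : Set α))).exists_isTree_le_of_le_of_isAcyclic le_top hT
  have h1 := hT'.card_edgeFinset
  have h2 := Finset.card_le_card (SimpleGraph.edgeFinset_mono hle)
  rw [card_edgeFinset_pairGraph hE] at h2
  simp at h1
  omega

lemma isAcyclic_pairGraph_mono {S N : Set α} {F E : Finset (Sym2 α)} (hS : S ⊆ N) (hF : F ⊆ E)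
    (h : (pairGraph N E).IsAcyclic) : (pairGraph S F).IsAcyclic := by
  refine SimpleGraph.IsAcyclic.comap ⟨Set.inclusion hS, ?_⟩ (Set.inclusion_injective hS) h
  intro u v huv
  exact ⟨fun h' => huv.1 (Set.inclusion_injective hS h'), hF huv.2⟩

open scoped Classical in
lemma prod_prod_toFinset_eq {M : Type*} [CommMonoid M] (hE : ∀ e ∈ E, ∀ v ∈ e, v ∈ N) (f : α → M) :
    ∏ e ∈ E, ∏ v ∈ e.toFinset, f v = ∏ v ∈ N, f v ^ (E.filter (v ∈ ·)).card := by
  rw [Finset.prod_comm' (t' := N) (s' := fun v => E.filter (v ∈ ·))]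
  · simp
  · intro e v
    simp only [Sym2.mem_toFinset, Finset.mem_filter]
    exact ⟨fun h => ⟨h, hE e h.1 v h.2⟩, fun h => h.1⟩

open scoped Classical in
lemma sum_card_filter_mem (hE : ∀ e ∈ E, ¬ e.IsDiag ∧ ∀ v ∈ e, v ∈ N) :
    ∑ v ∈ N, (E.filter (v ∈ ·)).card = 2 * E.card := by
  have h := Finset.sum_comm' (s := E) (t := fun e => e.toFinset) (t' := N)
    (s' := fun v => E.filter (v ∈ ·)) (f := fun _ _ => 1) fun e v => by
      simp only [Sym2.mem_toFinset, Finset.mem_filter]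
      exact ⟨fun h => ⟨h, (hE e h.1).2 v h.2⟩, fun h => h.1⟩
  simp only [Finset.sum_const, smul_eq_mul, mul_one] at h
  rw [← h, Finset.sum_congr rfl fun e he => Sym2.card_toFinset_of_not_isDiag e (hE e he).1]
  simp [mul_comm]

lemma exists_mem_edge_of_isTree (hT : (pairGraph (N : Set α) E).IsTree) (hN : 2 ≤ N.card) {v : α}
    (hv : v ∈ N) :
    ∃ w ∈ N, s(v, w) ∈ E := by
  have : Nontrivial (N : Set α) := by
    rw [← Fintype.one_lt_card_iff_nontrivial]; simpa using Nat.lt_of_succ_le hN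
  obtain ⟨w, hw⟩ := hT.connected.preconnected.exists_adj_of_nontrivial ⟨v, hv⟩
  exact ⟨w, w.2, hw.2⟩

open scoped Classical in
/-- If the edges of a tree are joined to a tree such that joined edges share a node, then the
number of joints at a node is its degree minus one. -/
lemma card_filter_joint_add_one {E' : Finset (Sym2 (Sym2 α))}
    (hE : ∀ e ∈ E, ¬ e.IsDiag ∧ ∀ v ∈ e, v ∈ N) (hT : (pairGraph (N : Set α) E).IsTree)
    (hN : 2 ≤ N.card)
    (hE' : ∀ e ∈ E', ¬ e.IsDiag ∧ ∀ v ∈ e, v ∈ E)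
    (hT' : (pairGraph (E : Set (Sym2 α)) E').IsTree) {g : Sym2 (Sym2 α) → α}
    (hg : ∀ e ∈ E', ∀ p ∈ e, g e ∈ p) {v : α} (hv : v ∈ N) :
    (E'.filter (g · = v)).card + 1 = (E.filter (v ∈ ·)).card := by
  -- The joints at v form a forest on the edges at v. Summed over v both sides give 2|E|, so every
  -- inequality is an equality.
  have hle : ∀ v ∈ N, (E'.filter (g · = v)).card + 1 ≤ (E.filter (v ∈ ·)).card := by
    intro v hv
    obtain ⟨w, -, hw⟩ := exists_mem_edge_of_isTree hT hN hv
    refine card_add_one_le_of_isAcyclic ⟨s(v, w), by simp [hw]⟩ (fun e he => ?_)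
      (isAcyclic_pairGraph_mono ?_ (Finset.filter_subset _ _) hT'.isAcyclic)
    · rw [Finset.mem_filter] at he
      refine ⟨(hE' e he.1).1, fun p hp => Finset.mem_filter.2 ⟨(hE' e he.1).2 p hp, ?_⟩⟩
      exact he.2 ▸ hg e he.1 p hp
    · exact_mod_cast Finset.filter_subset _ _
  have hgN : ∀ e ∈ E', g e ∈ N := fun e he => by
    have h1 := (hE' e he).2 _ (Sym2.out_fst_mem e)
    exact (hE _ h1).2 _ (hg e he _ (Sym2.out_fst_mem e))
  have hsum : ∑ v ∈ N, ((E'.filter (g · = v)).card + 1) = ∑ v ∈ N, (E.filter (v ∈ ·)).card := by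
    rw [sum_card_filter_mem hE, Finset.sum_add_distrib, ← Finset.card_eq_sum_card_fiberwise hgN]
    have := card_add_one_eq_of_isTree hE hT
    have := card_add_one_eq_of_isTree hE' hT'
    simp
    omega
  exact (Finset.sum_eq_sum_iff_of_le hle).1 hsum v hv

end EdgeSets

section Vines

/-! ### Complete unions and conditioning sets -/

lemma completeUnion_mk {d t : ℕ} (p q : VineNode d t) :
    completeUnion (t + 1) s(p, q) = completeUnion t p ∪ completeUnion t q := rfl

lemma conditioningSet_mk {d t : ℕ} (p q : VineNode d t) :
    conditioningSet t s(p, q) = completeUnion t p ∩ completeUnion t q := rfl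

lemma conditionedSet_mk {d t : ℕ} (p q : VineNode d t) :
    conditionedSet t s(p, q) = (completeUnion t p ∪ completeUnion t q) \
      (completeUnion t p ∩ completeUnion t q) := rfl

/-- The node set of the tree `t` as a finset. -/
def vineNodeFinset {d : ℕ} (edges : (t : ℕ) → Finset (Sym2 (VineNode d t))) :
    (t : ℕ) → Finset (VineNode d t)
  | 0 => (Finset.univ : Finset (Fin d))
  | t + 1 => edges t

lemma coe_vineNodeFinset {d : ℕ} (edges : (t : ℕ) → Finset (Sym2 (VineNode d t))) (t : ℕ) :
    (vineNodeFinset edges t : Set (VineNode d t)) = vineNodes edges t := by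
  cases t with
  | zero => exact Finset.coe_univ (α := Fin d)
  | succ t => rfl

namespace RegularVine

variable {d : ℕ} (V : RegularVine d)

lemma not_isDiag_and_mem {t : ℕ} (ht : t + 1 < d) :
    ∀ e ∈ V.edges t, ¬ e.IsDiag ∧ ∀ v ∈ e, v ∈ vineNodeFinset V.edges t := by
  intro e he
  refine ⟨(V.edges_between_nodes t ht e he).1, fun v hv => ?_⟩
  rw [← Finset.mem_coe, coe_vineNodeFinset]
  exact (V.edges_between_nodes t ht e he).2 v hv

lemma isTree_pairGraph {t : ℕ} (ht : t + 1 < d) :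
    (pairGraph (vineNodeFinset V.edges t : Set (VineNode d t)) (V.edges t)).IsTree := by
  rw [coe_vineNodeFinset]
  exact V.isTree t ht

lemma card_vineNodeFinset {t : ℕ} (ht : t < d) : (vineNodeFinset V.edges t).card + t = d := by
  induction t with
  | zero => exact Finset.card_fin d
  | succ t ih =>
    have := card_add_one_eq_of_isTree (V.not_isDiag_and_mem ht) (V.isTree_pairGraph ht)
    have := ih (by omega)
    have : (vineNodeFinset V.edges (t + 1)).card = (V.edges t).card := rfl
    omega

lemma exists_mem_edge {t : ℕ} (ht : t + 1 < d) {v : VineNode d t}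
    (hv : v ∈ vineNodeFinset V.edges t) :
    ∃ w ∈ vineNodeFinset V.edges t, s(v, w) ∈ V.edges t := by
  have := V.card_vineNodeFinset (t := t) (by omega)
  exact exists_mem_edge_of_isTree (V.isTree_pairGraph ht) (by omega) hv

/-- If p = {v, w} and q = {v, w'} share v, then whatever q adds to p is contained in what w' adds to
v, so induction applies. -/
lemma card_sdiff_completeUnion_le {t : ℕ} (ht : t + 1 < d) {p q : VineNode d t}
    (h : s(p, q) ∈ V.edges t) : (completeUnion t q \ completeUnion t p).card ≤ 1 := by
  induction t with
  | zero => exact (Finset.card_le_card Finset.sdiff_subset).trans (Finset.card_singleton _).le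
  | succ t ih =>
    obtain ⟨v, ⟨w, rfl⟩, ⟨w', rfl⟩⟩ := V.proximity t ht p q h
    have hq : (s(v, w') : Sym2 (VineNode d t)) ∈ V.edges t :=
      (V.not_isDiag_and_mem ht _ h).2 s(v, w') (Sym2.mem_mk_right _ _)
    refine le_trans (Finset.card_le_card fun i hi => ?_) (ih (by omega) hq)
    rw [completeUnion_mk, completeUnion_mk] at hi
    simp only [Finset.mem_sdiff, Finset.mem_union] at hi ⊢
    tauto

lemma card_completeUnion_le {t : ℕ} (ht : t < d) {v : VineNode d t}
    (hv : v ∈ vineNodeFinset V.edges t) : (completeUnion t v).card ≤ t + 1 := by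
  induction t with
  | zero => exact (Finset.card_singleton _).le
  | succ t ih =>
    obtain ⟨p, q⟩ := v
    have h1 := V.card_sdiff_completeUnion_le ht hv
    have h2 := ih (by omega) ((V.not_isDiag_and_mem ht _ hv).2 p (Sym2.mem_mk_left _ _))
    have h3 : (completeUnion t p ∪ completeUnion t q).card = _ :=
      (congrArg Finset.card Finset.union_sdiff_self_eq_union.symm).trans
        (Finset.card_union_of_disjoint Finset.disjoint_sdiff)
    change (completeUnion t p ∪ completeUnion t q).card ≤ _
    omega

lemma exists_mem_completeUnion {t : ℕ} (ht : t < d) (i : Fin d) :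
    ∃ v ∈ vineNodeFinset V.edges t, i ∈ completeUnion t v := by
  induction t with
  | zero => exact ⟨i, Finset.mem_univ (α := Fin d) i, Finset.mem_singleton_self (α := Fin d) i⟩
  | succ t ih =>
    obtain ⟨v, hv, hi⟩ := ih (by omega)
    obtain ⟨w, -, hw⟩ := V.exists_mem_edge ht hv
    exact ⟨s(v, w), hw, Finset.mem_union_left _ hi⟩

lemma completeUnion_eq_univ {t : ℕ} (ht : t + 1 = d) {v : VineNode d t}
    (hv : v ∈ vineNodeFinset V.edges t) : completeUnion t v = Finset.univ := by
  have h1 : (vineNodeFinset V.edges t).card = 1 := by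
    have := V.card_vineNodeFinset (t := t) (by omega)
    omega
  obtain ⟨v', hv'⟩ := Finset.card_eq_one.1 h1
  refine Finset.eq_univ_iff_forall.2 fun i => ?_
  obtain ⟨w, hw, hi⟩ := V.exists_mem_completeUnion (t := t) (by omega) i
  rw [hv', Finset.mem_singleton] at hv hw
  rw [hv, ← hw]
  exact hi

/-- Downward induction: the single top node reaches all d variables, and each level gains at most
one, so no level may fall short. -/
lemma card_completeUnion {t : ℕ} (ht : t < d) {v : VineNode d t}
    (hv : v ∈ vineNodeFinset V.edges t) : (completeUnion t v).card = t + 1 := by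
  obtain ⟨n, hn⟩ : ∃ n, t + 1 + n = d := ⟨d - (t + 1), by omega⟩
  induction n generalizing t with
  | zero => rw [V.completeUnion_eq_univ hn hv, Finset.card_fin]; omega
  | succ n ih =>
    refine le_antisymm (V.card_completeUnion_le ht hv) ?_
    obtain ⟨w, -, hw⟩ := V.exists_mem_edge (by omega) hv
    have h1 := ih (t := t + 1) (by omega) (v := s(v, w)) hw (by omega)
    have h2 := V.card_sdiff_completeUnion_le (by omega) hw
    have h3 : (completeUnion t v ∪ completeUnion t w).card = _ :=
      (congrArg Finset.card Finset.union_sdiff_self_eq_union.symm).trans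
        (Finset.card_union_of_disjoint Finset.disjoint_sdiff)
    rw [completeUnion_mk] at h1
    omega

/-- The complete unions of the endpoints of an edge arise from its conditioning set by adding one
variable each. -/
lemma exists_conditioned {t : ℕ} (ht : t + 1 < d) {p q : VineNode d t}
    (h : s(p, q) ∈ V.edges t) :
    ∃ a b, a ≠ b ∧ a ∉ conditioningSet t s(p, q) ∧ b ∉ conditioningSet t s(p, q) ∧
      completeUnion t p = insert a (conditioningSet t s(p, q)) ∧
      completeUnion t q = insert b (conditioningSet t s(p, q)) ∧
      conditionedSet t s(p, q) = {a, b} := by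
  have hm := (V.not_isDiag_and_mem ht _ h).2
  have hp := V.card_completeUnion (by omega) (hm p (Sym2.mem_mk_left _ _))
  have hq := V.card_completeUnion (by omega) (hm q (Sym2.mem_mk_right _ _))
  have hu := V.card_completeUnion (t := t + 1) ht (v := s(p, q)) h
  rw [completeUnion_mk] at hu
  have h1 : (completeUnion t p \ completeUnion t q).card = 1 := by
    have := Finset.card_sdiff_add_card (completeUnion t p) (completeUnion t q)
    omega
  have h2 : (completeUnion t q \ completeUnion t p).card = 1 := by
    have := Finset.card_sdiff_add_card (completeUnion t q) (completeUnion t p)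
    rw [Finset.union_comm] at this
    omega
  obtain ⟨a, ha⟩ := Finset.card_eq_one.1 h1
  obtain ⟨b, hb⟩ := Finset.card_eq_one.1 h2
  simp only [Finset.ext_iff, Finset.mem_sdiff, Finset.mem_singleton] at ha hb
  rw [conditioningSet_mk, conditionedSet_mk]
  refine ⟨a, b, ?_, ?_, ?_, ?_, ?_, ?_⟩
  · grind
  · grind
  · grind
  · grind
  · grind
  · grind

/-- The complete union of the shared node lies in both unions, hence in their intersection, and both
sets have t + 1 elements. -/
lemma conditioningSet_eq_of_mem {t : ℕ} (ht : t + 2 < d) {p q : Sym2 (VineNode d t)}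
    (h : (s(p, q) : Sym2 (VineNode d (t + 1))) ∈ V.edges (t + 1)) {v : VineNode d t}
    (hp : v ∈ p) (hq : v ∈ q) :
    conditioningSet (t + 1) (s(p, q) : Sym2 (VineNode d (t + 1))) = completeUnion t v := by
  obtain ⟨a, b, -, ha, -, hpU, -, -⟩ := V.exists_conditioned ht h
  have hm := (V.not_isDiag_and_mem ht _ h).2
  have hpE : p ∈ V.edges t := hm p (Sym2.mem_mk_left _ _)
  have hv := (V.not_isDiag_and_mem (by omega) p hpE).2 v hp
  have h1 := V.card_completeUnion (t := t + 1) (by omega) (v := p) hpE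
  rw [hpU, Finset.card_insert_of_notMem ha] at h1
  refine (Finset.eq_of_subset_of_card_le ?_ ?_).symm
  · obtain ⟨w, rfl⟩ := hp
    obtain ⟨w', rfl⟩ := hq
    exact Finset.subset_inter Finset.subset_union_left Finset.subset_union_left
  · rw [V.card_completeUnion (by omega) hv]
    omega

/-- Write p = {v, w} with v the node shared with q. Then D_e = U_v, so j is the variable contributed
by w, and r is the one contributed by v. -/
lemma exists_preceding_edge {t : ℕ} (ht : t + 2 < d) {p q : Sym2 (VineNode d t)}
    (h : (s(p, q) : Sym2 (VineNode d (t + 1))) ∈ V.edges (t + 1)) {j : Fin d}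
    (hj : j ∈ completeUnion (t + 1) p)
    (hjD : j ∉ conditioningSet (t + 1) (s(p, q) : Sym2 (VineNode d (t + 1)))) :
    ∃ r ∈ conditioningSet (t + 1) (s(p, q) : Sym2 (VineNode d (t + 1))),
      conditionedSet t p = {j, r} ∧ conditioningSet t p =
        (conditioningSet (t + 1) (s(p, q) : Sym2 (VineNode d (t + 1)))).erase r := by
  obtain ⟨v, ⟨w, rfl⟩, hq⟩ := V.proximity t ht p q h
  have hD := V.conditioningSet_eq_of_mem ht h (Sym2.mem_mk_left v w) hq
  have hpE : s(v, w) ∈ V.edges t := (V.not_isDiag_and_mem ht _ h).2 _ (Sym2.mem_mk_left _ _)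
  obtain ⟨a, b, hab, ha, hb, hv, hw, hc⟩ := V.exists_conditioned (by omega) hpE
  rw [hD] at hjD ⊢
  have hjb : j = b := by
    rw [completeUnion_mk, Finset.mem_union, hw, Finset.mem_insert] at hj
    rcases hj.resolve_left hjD with h' | h'
    · exact h'
    · exact absurd (hv ▸ Finset.mem_insert_of_mem h') hjD
  refine ⟨a, hv ▸ Finset.mem_insert_self _ _, ?_, ?_⟩
  · rw [hc, hjb, Finset.pair_comm]
  · rw [hv, Finset.erase_insert ha]

/-- Every conditional distribution function needed on an edge is obtained from an edge of the
preceding tree. -/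
theorem recursion (V : RegularVine d) (t : ℕ) (ht : t + 2 < d) :
    ∀ e ∈ V.edges (t + 1), ∀ j ∈ conditionedSet (t + 1) e,
      ∃ r ∈ conditioningSet (t + 1) e, ∃ p ∈ V.edges t,
        p ∈ e ∧ conditionedSet t p = {j, r} ∧
        conditioningSet t p = (conditioningSet (t + 1) e).erase r := by
  intro e he j hj
  obtain ⟨p, q⟩ := e
  have hm := (V.not_isDiag_and_mem ht _ he).2
  have hj' := Finset.mem_sdiff.1 hj
  rcases Finset.mem_union.1 hj'.1 with h | h
  · obtain ⟨r, hr, h1, h2⟩ := V.exists_preceding_edge ht he h hj'.2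
    exact ⟨r, hr, p, hm p (Sym2.mem_mk_left _ _), Sym2.mem_mk_left _ _, h1, h2⟩
  · have hsw : Quot.mk (Sym2.Rel (VineNode d (t + 1))) (p, q) = s(q, p) := Sym2.eq_swap
    rw [hsw] at he hj' hm ⊢
    obtain ⟨r, hr, h1, h2⟩ := V.exists_preceding_edge ht he h hj'.2
    exact ⟨r, hr, q, hm q (Sym2.mem_mk_left _ _), Sym2.mem_mk_left _ _, h1, h2⟩

end RegularVine
end Vines

section Telescoping

/-! ### Telescoping along a regular vine -/

namespace RegularVine

variable {d : ℕ} (V : RegularVine d)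

open scoped Classical in
-- Each l(U_v) occurs deg v times on the right. On the left it occurs deg v − 1 times as a
-- conditioning set and once as a node.
lemma prod_conditioningSet {t : ℕ} (ht : t + 2 < d) (l : Finset (Fin d) → ℝ) :
    (∏ e ∈ V.edges (t + 1), l (conditioningSet (t + 1) e)) *
      ∏ v ∈ vineNodeFinset V.edges t, l (completeUnion t v) =
    ∏ e ∈ V.edges t, ∏ v ∈ e.toFinset, l (completeUnion t v) := by
  have hex : ∀ e : Sym2 (Sym2 (VineNode d t)), ∃ v, e ∈ V.edges (t + 1) → ∀ p ∈ e, v ∈ p := by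
    intro e
    by_cases he : e ∈ V.edges (t + 1)
    · obtain ⟨p, q⟩ := e
      obtain ⟨v, hp, hq⟩ := V.proximity t ht p q he
      exact ⟨v, fun _ => by simp [hp, hq]⟩
    · exact ⟨e.out.1.out.1, fun h => absurd h he⟩
  choose g hg using hex
  have hcard {v : VineNode d t} (hv : v ∈ vineNodeFinset V.edges t) :=
    card_filter_joint_add_one (E' := V.edges (t + 1)) (V.not_isDiag_and_mem (by omega))
      (V.isTree_pairGraph (by omega)) (by have := V.card_vineNodeFinset (t := t) (by omega); omega)
      (V.not_isDiag_and_mem ht) (V.isTree_pairGraph ht) (fun e he => hg e he) hv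
  rw [prod_prod_toFinset_eq fun e he => (V.not_isDiag_and_mem (by omega) e he).2]
  have hmaps : ∀ e ∈ V.edges (t + 1), g e ∈ vineNodeFinset V.edges t := fun e he => by
    have h1 : e.out.1 ∈ V.edges t := (V.not_isDiag_and_mem ht e he).2 _ (Sym2.out_fst_mem e)
    exact (V.not_isDiag_and_mem (by omega) _ h1).2 _ (hg e he _ (Sym2.out_fst_mem e))
  rw [← Finset.prod_fiberwise_of_maps_to hmaps, ← Finset.prod_mul_distrib]
  refine Finset.prod_congr rfl fun v hv => ?_
  rw [← hcard hv, pow_succ]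
  congr 1
  rw [← Finset.prod_const]
  refine Finset.prod_congr rfl fun e he' => ?_
  obtain ⟨he, rfl⟩ := Finset.mem_filter.1 he'
  have := hg e he
  clear he'
  obtain ⟨p, q⟩ := e
  rw [V.conditioningSet_eq_of_mem ht he (this p (Sym2.mem_mk_left _ _))
    (this q (Sym2.mem_mk_right _ _))]

open scoped Classical in
lemma prod_completeUnion_of_ne_zero {l : Finset (Fin d) → ℝ}
    {c : (t : ℕ) → Sym2 (VineNode d t) → ℝ} (h0 : l ∅ = 1) (h1 : ∀ i, l {i} = 1)
    (hne : ∀ t < d, ∀ v ∈ vineNodeFinset V.edges t, l (completeUnion t v) ≠ 0)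
    (hc : ∀ t, t + 1 < d → ∀ e ∈ V.edges t, l (completeUnion (t + 1) e) * l (conditioningSet t e)
      = c t e * ∏ v ∈ e.toFinset, l (completeUnion t v)) {t : ℕ} (ht : t + 1 < d) :
    (∏ v ∈ vineNodeFinset V.edges (t + 1), l (completeUnion (t + 1) v)) *
      ∏ v ∈ vineNodeFinset V.edges t, l (completeUnion t v) =
      (∏ s ∈ Finset.range (t + 1), ∏ e ∈ V.edges s, c s e) *
        ∏ e ∈ V.edges t, ∏ v ∈ e.toFinset, l (completeUnion t v) := by
  have hmul {t : ℕ} (ht : t + 1 < d) :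
      (∏ v ∈ vineNodeFinset V.edges (t + 1), l (completeUnion (t + 1) v)) *
        ∏ e ∈ V.edges t, l (conditioningSet t e) =
      (∏ e ∈ V.edges t, c t e) * ∏ e ∈ V.edges t, ∏ v ∈ e.toFinset, l (completeUnion t v) := by
    rw [← Finset.prod_mul_distrib]
    exact (Finset.prod_mul_distrib (s := V.edges t)).symm.trans
      (Finset.prod_congr rfl fun e he => hc t ht e he)
  induction t with
  | zero =>
    have hG : ∏ v ∈ vineNodeFinset V.edges 0, l (completeUnion 0 v) = 1 :=
      Finset.prod_eq_one fun v _ => h1 v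
    have hD : ∏ e ∈ V.edges 0, l (conditioningSet 0 e) = 1 := by
      refine Finset.prod_eq_one fun e he => ?_
      obtain ⟨p, q⟩ := e
      have hpq : p ≠ q := (V.not_isDiag_and_mem ht _ he).1
      have : conditioningSet 0 (Quot.mk _ (p, q)) = ∅ := by
        refine Finset.disjoint_iff_inter_eq_empty.1 ?_
        exact Finset.disjoint_singleton.2 hpq
      rw [this, h0]
    have := hmul ht
    rw [hD, mul_one] at this
    rw [hG, mul_one, this]
    simp
  | succ t ih =>
    have e1 := ih (by omega)
    have e2 := V.prod_conditioningSet ht l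
    have e3 := hmul ht
    rw [Finset.prod_range_succ _ (t + 1)]
    have hne1 : ∏ v ∈ vineNodeFinset V.edges t, l (completeUnion t v) ≠ 0 :=
      Finset.prod_ne_zero_iff.2 (hne t (by omega))
    have hne2 : ∏ e ∈ V.edges (t + 1), l (conditioningSet (t + 1) e) ≠ 0 := by
      intro h
      rw [h, zero_mul] at e2
      obtain ⟨e, he, h'⟩ := Finset.prod_eq_zero_iff.1 e2.symm
      obtain ⟨v, hv, h''⟩ := Finset.prod_eq_zero_iff.1 h'
      exact hne t (by omega) v ((V.not_isDiag_and_mem (by omega) e he).2 v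
        (Sym2.mem_toFinset.1 hv)) h''
    refine mul_right_cancel₀ (mul_ne_zero hne1 hne2) ?_
    generalize ∏ v ∈ vineNodeFinset V.edges t, l (completeUnion t v) = G₀ at *
    generalize ∏ v ∈ vineNodeFinset V.edges (t + 1), l (completeUnion (t + 1) v) = G₁ at *
    generalize ∏ s ∈ Finset.range (t + 1), ∏ e ∈ V.edges s, c s e = R at *
    generalize ∏ e ∈ V.edges (t + 1), ∏ v ∈ e.toFinset, l (completeUnion (t + 1) v) = S at *
    generalize ∏ e ∈ V.edges (t + 1), c (t + 1) e = T at *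
    -- The goal was multiplied by G₀ and the product of the conditioning terms, both nonzero; the
    -- product over the endpoints of the edges of tree t then cancels between `e1` and `e2`.
    linear_combination G₁ * G₀ * e3 + T * S * e1 - T * S * R * e2

lemma conditioningSet_subset {t : ℕ} {e : Sym2 (VineNode d t)} {v : VineNode d t} (hv : v ∈ e) :
    conditioningSet t e ⊆ completeUnion t v := by
  obtain ⟨w, rfl⟩ := hv
  exact Finset.inter_subset_left

lemma prod_toFinset_last {t : ℕ} (ht : t + 2 = d) [DecidableEq (VineNode d t)]
    (f : VineNode d t → ℝ) :
    ∏ e ∈ V.edges t, ∏ v ∈ e.toFinset, f v = ∏ v ∈ vineNodeFinset V.edges t, f v := by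
  have hN := V.card_vineNodeFinset (t := t) (by omega)
  have hE : (V.edges t).card = 1 := by
    have := card_add_one_eq_of_isTree (V.not_isDiag_and_mem (t := t) (by omega))
      (V.isTree_pairGraph (by omega))
    omega
  obtain ⟨e, he⟩ := Finset.card_eq_one.1 hE
  have hmem := V.not_isDiag_and_mem (t := t) (by omega) e (by simp [he])
  rw [he, Finset.prod_singleton]
  congr 1
  refine Finset.eq_of_subset_of_card_le (fun v hv => hmem.2 v (Sym2.mem_toFinset.1 hv)) ?_
  rw [Sym2.card_toFinset_of_not_isDiag e hmem.1]
  omega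

lemma prod_last {t : ℕ} (ht : t + 1 = d) (l : Finset (Fin d) → ℝ) :
    ∏ v ∈ vineNodeFinset V.edges t, l (completeUnion t v) = l Finset.univ := by
  have hN := V.card_vineNodeFinset (t := t) (by omega)
  obtain ⟨v, hv⟩ := Finset.card_eq_one.1 (show (vineNodeFinset V.edges t).card = 1 by omega)
  rw [hv, Finset.prod_singleton, V.completeUnion_eq_univ ht (by simp [hv])]

open scoped Classical in
/-- A function of the index sets that satisfies the local identity on every edge telescopes along
the vine. -/
theorem eq_prod_edges (hd : 0 < d) {l : Finset (Fin d) → ℝ}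
    {c : (t : ℕ) → Sym2 (VineNode d t) → ℝ} (h0 : l ∅ = 1) (h1 : ∀ i, l {i} = 1)
    (hmono : ∀ A B, A ⊆ B → l A = 0 → l B = 0)
    (hc : ∀ t, t + 1 < d → ∀ e ∈ V.edges t, l (conditioningSet t e) ≠ 0 →
      l (completeUnion (t + 1) e) * l (conditioningSet t e)
        = c t e * ∏ v ∈ e.toFinset, l (completeUnion t v)) :
    l Finset.univ = ∏ t ∈ Finset.range (d - 1), ∏ e ∈ V.edges t, c t e := by
  by_cases hne : ∀ t < d, ∀ v ∈ vineNodeFinset V.edges t, l (completeUnion t v) ≠ 0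
  · obtain rfl | ⟨t, ht⟩ : d = 1 ∨ ∃ t, t + 2 = d :=
      (Nat.lt_or_ge 1 d).symm.imp (fun h => by omega) fun h => ⟨d - 2, by omega⟩
    · simpa using h1 0
    · have h := V.prod_completeUnion_of_ne_zero (c := c) h0 h1 hne (fun t ht e he => by
        refine hc t ht e he fun h => ?_
        have hp := Sym2.out_fst_mem e
        exact hne t (by omega) _ ((V.not_isDiag_and_mem ht e he).2 _ hp)
          (hmono _ _ (conditioningSet_subset hp) h)) (t := t) (by omega)
      -- The last tree has a single edge joining its only two nodes, so its endpoint product equals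
      -- its node product and cancels.
      rw [V.prod_toFinset_last ht, V.prod_last (by omega)] at h
      rw [show d - 1 = t + 1 by omega]
      exact mul_right_cancel₀ (Finset.prod_ne_zero_iff.2 (hne t (by omega))) h
  · push Not at hne
    have hex := Nat.find_spec hne
    have hmin := fun m => Nat.find_min hne (m := m)
    -- At the first level with a vanishing node, not level 0 since singletons give 1, the node is an
    -- edge with nonvanishing endpoints. Its factor c must be zero, and l of the full set is zero by
    -- monotonicity.
    generalize Nat.find hne = t at hex hmin
    obtain ⟨ht, e, he, h⟩ := hex
    rw [hmono _ _ (Finset.subset_univ _) h]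
    cases t with
    | zero => exact absurd ((h1 e).symm.trans h) one_ne_zero
    | succ t =>
      have hne' : ∀ v ∈ vineNodeFinset V.edges t, l (completeUnion t v) ≠ 0 := fun v hv h' =>
        hmin t (by omega) ⟨by omega, v, hv, h'⟩
      have hmem := (V.not_isDiag_and_mem ht e he).2
      have hp := Sym2.out_fst_mem (α := VineNode d t) e
      have hcz := hc t ht e he fun h' =>
        hne' _ (hmem _ hp) (hmono _ _ (conditioningSet_subset hp) h')
      rw [h, zero_mul] at hcz
      have : c t e = 0 := (mul_eq_zero.1 hcz.symm).resolve_right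
        (Finset.prod_ne_zero_iff.2 fun v hv => hne' v (hmem v (Sym2.mem_toFinset.1 hv)))
      symm
      exact Finset.prod_eq_zero (Finset.mem_range.2 (by omega : t < d - 1))
        (Finset.prod_eq_zero he this)

end RegularVine
end Telescoping

section Factorization
open Filter

/-! ### Factorization of the joint density -/

open scoped Classical in
lemma RegularVine.conditioned_eq_pair {d : ℕ} (V : RegularVine d) {t : ℕ} (ht : t + 1 < d)
    {e : Sym2 (VineNode d t)} (he : e ∈ V.edges t) {a b : Fin d}
    (hab : conditionedSet t e = {a, b}) :
    a ≠ b ∧ a ∉ conditioningSet t e ∧ b ∉ conditioningSet t e ∧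
      completeUnion (t + 1) e = insert a (insert b (conditioningSet t e)) ∧
      ∀ l : Finset (Fin d) → ℝ, ∏ v ∈ e.toFinset, l (completeUnion t v) =
        l (insert a (conditioningSet t e)) * l (insert b (conditioningSet t e)) := by
  obtain ⟨p, q⟩ := e
  change s(p, q) ∈ V.edges t at he
  change conditionedSet t s(p, q) = _ at hab
  have hpq : p ≠ q := (V.not_isDiag_and_mem ht _ he).1
  obtain ⟨a', b', hne, ha, hb, hp, hq, hc⟩ := V.exists_conditioned ht he
  have hprod (l : Finset (Fin d) → ℝ) : ∏ v ∈ s(p, q).toFinset, l (completeUnion t v) =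
      l (completeUnion t p) * l (completeUnion t q) := by
    rw [Sym2.toFinset_mk_eq, Finset.prod_pair hpq]
  have hU : completeUnion (t + 1) s(p, q) = insert a' (insert b' (conditioningSet t s(p, q))) := by
    rw [completeUnion_mk, hp, hq]
    grind
  have hmem (i : Fin d) : i = a' ∨ i = b' ↔ i = a ∨ i = b := by
    simpa [hc] using congrArg (i ∈ ·) hab
  have hcase : a = a' ∧ b = b' ∨ a = b' ∧ b = a' := by
    have h1 := hmem a
    have h2 := hmem b
    have h3 := hmem a'
    have h4 := hmem b'
    grind
  rcases hcase with ⟨rfl, rfl⟩ | ⟨rfl, rfl⟩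
  · exact ⟨hne, ha, hb, hU, fun l => by rw [← hp, ← hq]; exact hprod l⟩
  · exact ⟨hne.symm, hb, ha, hU.trans (Finset.insert_comm _ _ _), fun l => by
      rw [← hp, ← hq, mul_comm]; exact hprod l⟩

section MarginalDensity

variable {d : ℕ} {Q M : Measure (Fin d → ℝ)} [IsProbabilityMeasure Q] [IsProbabilityMeasure M]

lemma marginDensity_lt_top (U : Finset (Fin d)) : ∀ᵐ x ∂M, marginDensity Q M U x < ⊤ :=
  mapDensity_lt_top (Finset.measurable_restrict U)

lemma rnDeriv_eq_marginDensity_univ (hQ : Q ≪ M) :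
    Q.rnDeriv M =ᵐ[M] marginDensity Q M Finset.univ := by
  have h := mapDensity_congr hQ (T₁ := id) (T₂ := (Finset.univ : Finset (Fin d)).restrict)
    (ψ := fun (t : ↥(Finset.univ : Finset (Fin d)) → ℝ) i => t ⟨i, Finset.mem_univ i⟩)
    (φ := (Finset.univ : Finset (Fin d)).restrict) measurable_id
    (Finset.measurable_restrict _) (by fun_prop) (fun _ => rfl) fun _ => rfl
  filter_upwards [h] with x hx
  rw [marginDensity, ← hx, mapDensity, Measure.map_id, Measure.map_id]
  rfl

omit [IsProbabilityMeasure Q] in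
lemma marginDensity_of_map_eq {U : Finset (Fin d)} (h : Q.map U.restrict = M.map U.restrict) :
    ∀ᵐ x ∂M, marginDensity Q M U x = 1 := by
  have := Measure.isProbabilityMeasure_map (μ := M) (Finset.measurable_restrict U).aemeasurable
  have h' := ae_of_ae_map (Finset.measurable_restrict U).aemeasurable
    (M.map U.restrict).rnDeriv_self
  filter_upwards [h'] with x hx
  rw [marginDensity, mapDensity, h]
  exact hx

lemma map_restrict_empty_eq :
    Q.map (∅ : Finset (Fin d)).restrict = M.map (∅ : Finset (Fin d)).restrict := by
  have := Measure.isProbabilityMeasure_map (μ := M)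
    (Finset.measurable_restrict (∅ : Finset (Fin d))).aemeasurable
  have := Measure.isProbabilityMeasure_map (μ := Q)
    (Finset.measurable_restrict (∅ : Finset (Fin d))).aemeasurable
  ext s -
  rcases s.eq_empty_or_nonempty with rfl | ⟨x, hx⟩
  · simp
  · rw [show s = Set.univ from Set.eq_univ_of_forall fun y => Subsingleton.elim x y ▸ hx]
    simp

omit [IsProbabilityMeasure Q] [IsProbabilityMeasure M] in
lemma map_restrict_singleton_eq {i : Fin d} (h : Q.map (fun x => x i) = M.map (fun x => x i)) :
    Q.map ({i} : Finset (Fin d)).restrict = M.map ({i} : Finset (Fin d)).restrict := by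
  have hc : ({i} : Finset (Fin d)).restrict (π := fun _ => ℝ) =
      (fun (y : ℝ) (_ : ({i} : Finset (Fin d))) => y) ∘ fun x => x i := by
    funext x j
    exact congrArg x (Finset.mem_singleton.1 j.2)
  have hm : Measurable fun (y : ℝ) (_ : ({i} : Finset (Fin d))) => y := by fun_prop
  rw [hc, ← Measure.map_map hm (measurable_pi_apply i), h,
    Measure.map_map hm (measurable_pi_apply i)]

end MarginalDensity

/-! ### From the product of the margins back to the reference measure -/

section RandomVectors

variable {Ω : Type*} [MeasurableSpace Ω] {P : Measure Ω} [IsProbabilityMeasure P] {d : ℕ}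
  {X : Fin d → Ω → ℝ}

omit [IsProbabilityMeasure P] in
lemma map_eval_map (hX : ∀ i, Measurable (X i)) (i : Fin d) :
    (P.map fun ω i => X i ω).map (fun x => x i) = P.map (X i) := by
  rw [Measure.map_map (measurable_pi_apply i) (measurable_pi_lambda _ hX)]
  rfl

lemma margin_eq_withDensity (hX : ∀ i, Measurable (X i))
    (hac : P.map (fun ω i => X i ω) ≪ jointRefMeasure P X) (i : Fin d) :
    P.map (X i) =
      (refMeasure (P.map (X i))).withDensity ((P.map (X i)).rnDeriv (refMeasure (P.map (X i)))) := by
  have := isProbabilityMeasure_margin P hX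
  refine (Measure.withDensity_rnDeriv_eq _ _ ?_).symm
  rw [← map_eval_map hX i]
  -- The reference product may be infinite, so projecting it to a coordinate only preserves null
  -- sets, which suffices.
  exact (hac.map (measurable_pi_apply i)).trans
    (by
      have h := (Measure.quasiMeasurePreserving_eval
        (μ := fun i => refMeasure (P.map (X i))) i).absolutelyContinuous
      rw [map_eval_map hX i]
      exact h)

lemma absolutelyContinuous_productLaw (hX : ∀ i, Measurable (X i))
    (hac : P.map (fun ω i => X i ω) ≪ jointRefMeasure P X) :
    P.map (fun ω i => X i ω) ≪ productLaw P X := by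
  have := isProbabilityMeasure_margin P hX
  exact absolutelyContinuous_pi_margins (fun i => Measure.measurable_rnDeriv _ _)
    (margin_eq_withDensity hX hac) (map_eval_map hX) hac

lemma productLaw_eq_withDensity (hX : ∀ i, Measurable (X i))
    (hac : P.map (fun ω i => X i ω) ≪ jointRefMeasure P X) :
    productLaw P X = (jointRefMeasure P X).withDensity
      fun x => ∏ i, (P.map (X i)).rnDeriv (refMeasure (P.map (X i))) (x i) := by
  have := isProbabilityMeasure_margin P hX
  exact pi_withDensity _ _ _ (fun i => Measure.measurable_rnDeriv _ _)
    (margin_eq_withDensity hX hac)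

lemma jointDensity_eq_of_ae_productLaw (hX : ∀ i, Measurable (X i))
    (hac : P.map (fun ω i => X i ω) ≪ jointRefMeasure P X) {g : (Fin d → ℝ) → ℝ}
    (hg : ∀ᵐ x ∂(productLaw P X),
      ((P.map fun ω i => X i ω).rnDeriv (productLaw P X) x).toReal = g x) :
    ∀ᵐ x ∂(jointRefMeasure P X),
      jointDensity P X x = (∏ k, mixDensity (P.map (X k)) (x k)) * g x := by
  have := isProbabilityMeasure_margin P hX
  have hM := productLaw_eq_withDensity hX hac
  have : SigmaFinite (jointRefMeasure P X) := by unfold jointRefMeasure; infer_instance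
  have hFm : Measurable fun x : Fin d → ℝ =>
      ∏ i, (P.map (X i)).rnDeriv (refMeasure (P.map (X i))) (x i) :=
    Finset.measurable_prod _ fun i _ =>
      (Measure.measurable_rnDeriv _ _).comp (measurable_pi_apply i)
  have : IsProbabilityMeasure (P.map fun ω i => X i ω) :=
    Measure.isProbabilityMeasure_map (measurable_pi_lambda _ hX).aemeasurable
  have h1 := Measure.rnDeriv_mul_rnDeriv (κ := jointRefMeasure P X)
    (absolutelyContinuous_productLaw hX hac)
  have h2 : (productLaw P X).rnDeriv (jointRefMeasure P X) =ᵐ[jointRefMeasure P X]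
      fun x => ∏ i, (P.map (X i)).rnDeriv (refMeasure (P.map (X i))) (x i) := by
    conv_lhs => rw [hM]
    exact Measure.rnDeriv_withDensity _ hFm
  rw [hM, ae_withDensity_iff hFm, ← hM] at hg
  filter_upwards [h1, h2, hg] with x h1 h2 hg
  have hprod : ∏ k, mixDensity (P.map (X k)) (x k) =
      (∏ i, (P.map (X i)).rnDeriv (refMeasure (P.map (X i))) (x i)).toReal :=
    (ENNReal.toReal_prod _ _).symm
  rw [jointDensity, ← h1, Pi.mul_apply, h2, ENNReal.toReal_mul, hprod, mul_comm]
  -- The factorization is known only almost everywhere for the product of the margins; where dM/dν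
  -- vanishes both sides are zero.
  by_cases h0 : ∏ i, (P.map (X i)).rnDeriv (refMeasure (P.map (X i))) (x i) = 0
  · simp [h0]
  · rw [hg h0]

/-- The vine factorization of the density with respect to the product of the margins. -/
lemma ae_rnDeriv_productLaw_eq (hX : ∀ i, Measurable (X i))
    (hQ : P.map (fun ω i => X i ω) ≪ productLaw P X) (V : RegularVine d)
    {a b : (t : ℕ) → Sym2 (VineNode d t) → Fin d}
    {C : (t : ℕ) → (e : Sym2 (VineNode d t)) → Kernel (conditioningSet t e → ℝ) (ℝ × ℝ)}
    (hab : ∀ t, t + 1 < d → ∀ e ∈ V.edges t, conditionedSet t e = {a t e, b t e})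
    (hC : ∀ t, t + 1 < d → ∀ e ∈ V.edges t,
      IsCondCopula P X (a t e) (b t e) (conditioningSet t e) (C t e)) :
    ∀ᵐ x ∂(productLaw P X), ((P.map fun ω i => X i ω).rnDeriv (productLaw P X) x).toReal =
      ∏ t ∈ Finset.range (d - 1), ∏ e ∈ V.edges t,
        genCopulaDensity
          (C t e ((conditioningSet t e).restrict x))
          (copulaDensity (C t e) ((conditioningSet t e).restrict x))
          (condLaw P X (a t e) (conditioningSet t e) ((conditioningSet t e).restrict x))
          (condLaw P X (b t e) (conditioningSet t e) ((conditioningSet t e).restrict x))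
          (x (a t e)) (x (b t e)) := by
  classical
  have := isProbabilityMeasure_margin P hX
  have : IsProbabilityMeasure (P.map fun ω i => X i ω) :=
    Measure.isProbabilityMeasure_map (measurable_pi_lambda _ hX).aemeasurable
  have hloc : ∀ᵐ x ∂(productLaw P X), ∀ t, t + 1 < d → ∀ e ∈ V.edges t, _ :=
    ae_all_iff.2 fun t => ae_all_iff.2 fun ht => (eventually_all_finset _).2 fun e he =>
      have h := V.conditioned_eq_pair ht he (hab t ht e he)
      ae_marginDensity_mul_eq hX hQ h.2.1 h.2.2.1 h.1 (hC t ht e he)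
  have h1 : ∀ᵐ x ∂(productLaw P X), ∀ i,
      marginDensity (P.map fun ω i => X i ω) (productLaw P X) {i} x = 1 :=
    ae_all_iff.2 fun i => marginDensity_of_map_eq (map_restrict_singleton_eq
      ((map_eval_map hX i).trans (pi_map_apply (fun i => P.map (X i)) i).symm))
  have hmono : ∀ᵐ x ∂(productLaw P X), ∀ A B : Finset (Fin d), A ⊆ B →
      marginDensity (P.map fun ω i => X i ω) (productLaw P X) A x = 0 →
      marginDensity (P.map fun ω i => X i ω) (productLaw P X) B x = 0 :=
    ae_all_iff.2 fun A => ae_all_iff.2 fun B => ae_all_iff.2 fun h =>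
      marginDensity_eq_zero hQ h
  filter_upwards [hloc, h1, hmono, marginDensity_of_map_eq (map_restrict_empty_eq
      (Q := P.map fun ω i => X i ω) (M := productLaw P X)),
    rnDeriv_eq_marginDensity_univ hQ, ae_all_iff.2 (marginDensity_lt_top
      (Q := P.map fun ω i => X i ω))] with x hloc h1 hmono h0 hL htop
  rw [hL]
  have hzero {A : Finset (Fin d)}
      (h : (marginDensity (P.map fun ω i => X i ω) (productLaw P X) A x).toReal = 0) :
      marginDensity (P.map fun ω i => X i ω) (productLaw P X) A x = 0 :=
    ((ENNReal.toReal_eq_zero_iff _).1 h).resolve_right (htop A).ne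
  -- For d = 0 there is no top node and the claim reduces to l(∅) = 1.
  rcases Nat.eq_zero_or_pos d with rfl | hd
  · rw [show (Finset.univ : Finset (Fin 0)) = ∅ from rfl, h0]
    simp
  · refine V.eq_prod_edges hd
      (l := fun A => (marginDensity (P.map fun ω i => X i ω) (productLaw P X) A x).toReal)
      (by simp [h0]) (by simp [h1]) (fun A B hAB h => by simp [hmono A B hAB (hzero h)]) ?_
    intro t ht e he hne
    obtain ⟨-, -, -, hU, hprod⟩ := V.conditioned_eq_pair ht he (hab t ht e he)
    rw [hprod fun A => (marginDensity (P.map fun ω i => X i ω) (productLaw P X) A x).toReal,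
      ← mul_assoc, hU]
    exact hloc t ht e he fun h => hne (by simp [h])

end RandomVectors
end Factorization

theorem mainTheorem1 {Ω : Type*} [MeasurableSpace Ω] (P : Measure Ω) [IsProbabilityMeasure P]
    {d : ℕ} (X : Fin d → Ω → ℝ) (hX : ∀ i, Measurable (X i))
    (hmix : ∀ i, IsDiscreteContinuousMixture (P.map (X i)))
    (hac : P.map (fun ω i => X i ω) ≪ jointRefMeasure P X) :
    -- (i) the density factorizes over every regular vine
    (∀ (V : RegularVine d)
        (a b : (t : ℕ) → Sym2 (VineNode d t) → Fin d)
        (C : (t : ℕ) → (e : Sym2 (VineNode d t)) → Kernel (conditioningSet t e → ℝ) (ℝ × ℝ)),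
      (∀ t, t + 1 < d → ∀ e ∈ V.edges t, conditionedSet t e = {a t e, b t e}) →
      (∀ t, t + 1 < d → ∀ e ∈ V.edges t,
        IsCondCopula P X (a t e) (b t e) (conditioningSet t e) (C t e)) →
      ∀ᵐ x ∂(jointRefMeasure P X),
        jointDensity P X x =
          (∏ k, mixDensity (P.map (X k)) (x k)) *
            ∏ t ∈ Finset.range (d - 1), ∏ e ∈ V.edges t,
              genCopulaDensity
                (C t e ((conditioningSet t e).restrict x))
                (copulaDensity (C t e) ((conditioningSet t e).restrict x))
                (condLaw P X (a t e) (conditioningSet t e) ((conditioningSet t e).restrict x))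
                (condLaw P X (b t e) (conditioningSet t e) ((conditioningSet t e).restrict x))
                (x (a t e)) (x (b t e))) ∧
    -- (ii) the recursion for the conditional distribution functions, for both orientations
    (∀ (D : Finset (Fin d)) (j r : Fin d) (_ : j ∉ D) (hr : r ∈ D),
      (∀ C : Kernel (↥(D.erase r) → ℝ) (ℝ × ℝ),
        IsCondCopula P X j r (D.erase r) C →
        ∀ᵐ xD ∂(P.map (subvector X D)), ∀ y : ℝ,
          cdf (condLaw P X j D xD) y =
            genH12 (C (dropCoord r xD))
              (condLaw P X j (D.erase r) (dropCoord r xD))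
              (condLaw P X r (D.erase r) (dropCoord r xD))
              y (xD ⟨r, hr⟩)) ∧
      (∀ C : Kernel (↥(D.erase r) → ℝ) (ℝ × ℝ),
        IsCondCopula P X r j (D.erase r) C →
        ∀ᵐ xD ∂(P.map (subvector X D)), ∀ y : ℝ,
          cdf (condLaw P X j D xD) y =
            genH21 (C (dropCoord r xD))
              (condLaw P X r (D.erase r) (dropCoord r xD))
              (condLaw P X j (D.erase r) (dropCoord r xD))
              (xD ⟨r, hr⟩) y)) ∧
    -- the recursion closes on every regular vine: it only uses the copulas of preceding edges
    (∀ (V : RegularVine d) (t : ℕ), t + 2 < d →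
      ∀ e ∈ V.edges (t + 1), ∀ j ∈ conditionedSet (t + 1) e,
        ∃ r ∈ conditioningSet (t + 1) e, ∃ p ∈ V.edges t,
          p ∈ e ∧ conditionedSet t p = {j, r} ∧
          conditioningSet t p = (conditioningSet (t + 1) e).erase r) := by
  have hQ := absolutelyContinuous_productLaw hX hac
  refine ⟨fun V a b C hab hC => ?_, fun D j r hj hr => ⟨fun C hC => ?_, fun C hC => ?_⟩,
    RegularVine.recursion⟩
  · exact jointDensity_eq_of_ae_productLaw hX hac (ae_rnDeriv_productLaw_eq hX hQ V hab hC)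
  · exact hC.ae_cdf_eq_genH12 hX hQ hj hr
  · exact hC.ae_cdf_eq_genH21 hX hQ hj hr
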